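/- Let $\mathfrak k$ be a complex Hilbert space with countable base, $B(\mathfrak k)$ its bounded operators, and let $\mathfrak R=\{\emptyset\}+\mathbb R+\mathbb R^2+\cdots$ (disjoint union, with the sum topology) carry the measure $\int f(w)\,dw=f(\emptyset)+\sum_{n\ge1}\frac1{n!}\int_{\mathbb R^n}f(t_1,\dots,t_n)\,dt_1\cdots dt_n$. A symmetric function on $\mathfrak R$ is regarded as a function of the finite multiset $\{t_1,\dots,t_n\}$. Let $\Gamma=L^2_s(\mathfrak R,\mathfrak k)$ be the Fock space of symmetric square integrable functions, $\mathcal K\subset\Gamma$ the symmetric continuous functions with compact support, and $(\Theta(t)f)(t_1,\dots,t_n)=f(t_1+t,\dots,t_n+t)$ for $t\in\mathbb R$. Let $A_1,A_0,A_{-1},B\in B(\mathfrak k)$. For $s<t$ and $\sigma,\tau,\upsilon\in\mathfrak R$ with all points different, let $s_1<\dots<s_n$ be the points of $\sigma,\tau,\upsilon$ in increasing order and $i_j=1,0,-1$ according to whether $s_j$ belongs to $\sigma$, $\tau$, $\upsilon$, and put $$u^t_s(\sigma,\tau,\upsilon)=\mathbf 1\{s<s_1<\dots<s_n<t\}\,e^{(t-s_n)B}A_{i_n}e^{(s_n-s_{n-1})B}A_{i_{n-1}}\cdots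 A_{i_1}e^{(s_1-s)B}$$ (equal to $e^{(t-s)B}$ when $n=0$). For $g\in\mathcal K$ put $$(\mathcal O(u^t_s)g)(\omega)=\sum_{\alpha\subset\omega}\ \sum_{\beta\subset\omega\setminus\alpha}\int_{\mathfrak R} u^t_s(\alpha,\beta,\upsilon)\,g((\omega\setminus\alpha)+\upsilon)\,d\upsilon .$$ Assume the unitarity conditions: there is a unitary operator $\Upsilon$ on $\mathfrak k$ such that $A_0=\Upsilon-1$, $A_1=-\Upsilon A_{-1}^+$ and $B+B^+=-A_1^+A_1=-A_{-1}A_{-1}^+$. Then there is exactly one family of bounded operators $U^t_s$ $(s,t\in\mathbb R)$ on $\Gamma$ such that $U^t_s$ extends $\mathcal O(u^t_s):\mathcal K\to\Gamma$ for $s<t$, $U^s_s=1$, and $U^t_s=(U^s_t)^+$ for $t<s$. All $U^t_s$ are unitary, and for all $r,s,t\in\mathbb R$ $$U^t_rU^r_s=U^t_s,\qquad \Theta(r)U^t_s\Theta(-r)=U^{t-r}_{s-r}.$$ The operators $W(t)=\Theta(t)U^t_0$, $t\in\mathbb R$, form a strongly continuous one-parameter unitary group on $\Gamma$: each $W(t)$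 is unitary, $W(0)=1$, $W(s+t)=W(s)W(t)$ for all $s,t\in\mathbb R$, $W(-t)=W(t)^+$, and $t\mapsto W(t)f$ is continuous for every $f\in\Gamma$. -/

import Mathlib

open MeasureTheory Set Filter Topology
open scoped ENNReal Nat

namespace WhiteNoise

noncomputable section

/-! ## The space of finite words and its symmetric quotient -/

/-- The space `ℜ = {∅} + ℝ + ℝ² + ⋯` of finite words of real numbers, with the disjoint union
topology and Borel structure. -/
abbrev Words : Type := Σ n : ℕ, (Fin n → ℝ)

/-- The word `(t₁, …, tₙ)`. -/
def word (n : ℕ) (x : Fin n → ℝ) : Words := ⟨n, x⟩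

/-- The finite multiset `{t₁, …, tₙ}` of points of the word `(t₁, …, tₙ)`. Two words have the same
multiset of points iff one is a permutation of the other, so that the symmetric functions on
`Words` are exactly the functions on `Multiset ℝ`, composed with `points`. Symmetric functions of
words are therefore written as functions on `Multiset ℝ` throughout. -/
def points (w : Words) : Multiset ℝ := (Finset.univ : Finset (Fin w.1)).val.map w.2

/-- A set (or a function) on `Multiset ℝ` is measurable iff the corresponding symmetric set (or
function) on `Words` is. -/
instance instMeasurableSpaceMultisetReal : MeasurableSpace (Multiset ℝ) :=
  MeasurableSpace.map points inferInstance

theorem measurable_points : Measurable points := fun _ hs => hs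

/-- Lebesgue measure on `ℜ`: `∫ f(w) dw = f(∅) + ∑ₙ (1/n!) ∫ f(t₁,…,tₙ) dt₁⋯dtₙ`. -/
def wordMeasure : Measure Words :=
  Measure.sum fun n : ℕ =>
    ((n ! : ℝ≥0∞)⁻¹) • Measure.map (word n) (volume : Measure (Fin n → ℝ))

/-- Lebesgue measure of `ℜ` on symmetric functions. -/
def lam : Measure (Multiset ℝ) := Measure.map points wordMeasure

/-! ## The Fock space -/

/-- The Fock space `Γ = L²ₛ(ℜ, 𝔨, λ)` of symmetric square integrable functions. -/
abbrev Fock (k : Type*) [NormedAddCommGroup k] [InnerProductSpace ℂ k] : Type _ :=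
  Lp k 2 lam

/-- The space `𝒦 = 𝒦ₛ(ℜ, 𝔨)` of symmetric continuous functions with compact support on `ℜ`. -/
structure IsTest {k : Type*} [NormedAddCommGroup k] (g : Multiset ℝ → k) : Prop where
  continuous : Continuous fun w : Words => g (points w)
  hasCompactSupport : HasCompactSupport fun w : Words => g (points w)

theorem continuous_word (n : ℕ) : Continuous (word n) :=
  continuous_sigmaMk (σ := fun n : ℕ => Fin n → ℝ) (i := n)

theorem isClosedEmbedding_word (n : ℕ) : Topology.IsClosedEmbedding (word n) :=
  Topology.IsClosedEmbedding.sigmaMk (σ := fun n : ℕ => Fin n → ℝ) (i := n)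

theorem measurable_word (n : ℕ) : Measurable (word n) := by
  intro s hs
  exact MeasurableSpace.measurableSet_iInf.1 hs n

theorem wordMeasure_lt_top {K : Set Words} (hK : IsCompact K) (hKm : MeasurableSet K) :
    wordMeasure K < ∞ := by
  obtain ⟨F, hF⟩ : ∃ F : Finset ℕ, K ⊆ ⋃ n ∈ F, range (word n) := by
    refine hK.elim_finite_subcover _ (fun n => isOpen_range_sigmaMk (σ := fun n : ℕ => Fin n → ℝ) (i := n)) ?_
    rintro ⟨n, x⟩ -
    exact mem_iUnion.2 ⟨n, x, rfl⟩
  rw [wordMeasure, Measure.sum_apply _ hKm, tsum_eq_sum (s := F)]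
  · refine ENNReal.sum_lt_top.2 fun n _ => ?_
    rw [Measure.smul_apply, Measure.map_apply (measurable_word n) hKm, smul_eq_mul]
    refine ENNReal.mul_lt_top ?_ ?_
    · exact ENNReal.inv_lt_top.2 (by exact_mod_cast n.factorial_pos)
    · exact ((isClosedEmbedding_word n).isCompact_preimage hK).measure_lt_top
  · intro n hn
    rw [Measure.smul_apply, Measure.map_apply (measurable_word n) hKm]
    have : (word n) ⁻¹' K = ∅ := by
      ext x
      simp only [mem_preimage, mem_empty_iff_false, iff_false]
      intro hx
      obtain ⟨m, hm, y, hy⟩ := by simpa using hF hx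
      have hmn : m = n := congrArg Sigma.fst hy
      exact hn (hmn ▸ hm)
    simp [this]

theorem measurableSet_of_isClosed {K : Set Words} (hK : IsClosed K) : MeasurableSet K := by
  refine MeasurableSpace.measurableSet_iInf.2 fun n => ?_
  exact (hK.preimage (continuous_word n)).measurableSet

/-- Test functions are square integrable. -/
theorem IsTest.memLp {k : Type*} [NormedAddCommGroup k] [TopologicalSpace.SeparableSpace k]
    {g : Multiset ℝ → k} (hg : IsTest g) : MemLp g 2 lam := by
  have : SecondCountableTopology k := UniformSpace.secondCountable_of_separable k
  borelize k
  have hgw : Measurable fun w : Words => g (points w) := by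
    intro s hs
    refine MeasurableSpace.measurableSet_iInf.2 fun n => ?_
    exact (hg.continuous.comp (continuous_word n)).measurable hs
  have hgm : Measurable g := fun s hs => hgw hs
  have hK : IsCompact (tsupport fun w : Words => g (points w)) := hg.hasCompactSupport
  have hKm := measurableSet_of_isClosed (isClosed_tsupport fun w : Words => g (points w))
  obtain ⟨C, hC⟩ := hg.hasCompactSupport.exists_bound_of_continuous hg.continuous
  have key : MemLp (fun w : Words => g (points w)) 2 wordMeasure := by
    have h1 : MemLp (indicator (tsupport fun w : Words => g (points w)) fun _ => C) 2
        wordMeasure :=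
      memLp_indicator_const 2 hKm C (Or.inr (wordMeasure_lt_top hK hKm).ne)
    refine h1.mono hgw.stronglyMeasurable.aestronglyMeasurable (Eventually.of_forall fun w => ?_)
    by_cases hw : w ∈ tsupport fun w : Words => g (points w)
    · rw [indicator_of_mem hw]
      exact (hC w).trans (le_abs_self C)
    · rw [image_eq_zero_of_notMem_tsupport hw]
      simp
  exact (memLp_map_measure_iff hgm.stronglyMeasurable.aestronglyMeasurable
    measurable_points.aemeasurable).2 key

/-! ## The time shift -/

/-- `ϑ(t) {t₁, …, tₙ} = {t₁ + t, …, tₙ + t}`. -/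
def shift (t : ℝ) (ω : Multiset ℝ) : Multiset ℝ := ω.map (· + t)

theorem measurePreserving_shift (t : ℝ) : MeasurePreserving (shift t) lam lam := by
  let S : Words → Words := fun w => ⟨w.1, fun i => w.2 i + t⟩
  have hcomm : ∀ w, shift t (points w) = points (S w) := by
    intro w
    simp only [shift, points, S, Multiset.map_map, Function.comp_def]
  have hS : Measurable S := by
    intro s hs
    refine MeasurableSpace.measurableSet_iInf.2 fun n => ?_
    have h := measurable_word n hs
    have hadd : Measurable fun x : Fin n → ℝ => fun i => x i + t := by fun_prop
    exact hadd h
  have hshift : Measurable (shift t) := by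
    intro s hs
    have : Measurable fun w => shift t (points w) := by
      simp only [hcomm]
      exact measurable_points.comp hS
    exact this hs
  have hSmp : ∀ s, MeasurableSet s → wordMeasure (S ⁻¹' s) = wordMeasure s := by
    intro s hs
    rw [wordMeasure, Measure.sum_apply _ (hS hs), Measure.sum_apply _ hs]
    congr 1
    ext n
    rw [Measure.smul_apply, Measure.smul_apply, Measure.map_apply (measurable_word n) (hS hs),
      Measure.map_apply (measurable_word n) hs]
    have h := (measurePreserving_add_right (volume : Measure (Fin n → ℝ))
      (fun _ => t)).measure_preimage (measurable_word n hs).nullMeasurableSet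
    rw [← h]
    rfl
  refine ⟨hshift, Measure.ext fun s hs => ?_⟩
  rw [Measure.map_apply hshift hs, lam, Measure.map_apply measurable_points (hshift hs),
    Measure.map_apply measurable_points hs, ← hSmp _ (measurable_points hs)]
  congr 1
  ext w
  simp only [mem_preimage, hcomm]

section Operators

variable {k : Type*} [NormedAddCommGroup k] [InnerProductSpace ℂ k]

/-- The operator `Θ(t)` on `Γ`, `(Θ(t) f)(w) = f(ϑ(t) w)`. -/
def Theta (t : ℝ) : Fock k →L[ℂ] Fock k :=
  (Lp.compMeasurePreservingₗᵢ ℂ (shift t) (measurePreserving_shift t)).toContinuousLinearMap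

/-! ## The kernel `u^t_s` -/

/-- The marked points `Ξ(σ, τ, υ) = {(s₁, i₁), …, (sₙ, iₙ)}`: points of `σ`, `τ`, `υ` carry the
mark `1`, `0`, `-1` respectively. -/
def marked (σ τ υ : Multiset ℝ) : Multiset (ℝ ×ₗ SignType) :=
  σ.map (fun r => toLex (r, 1)) + τ.map (fun r => toLex (r, 0)) + υ.map (fun r => toLex (r, -1))

/-- For a list `(s₁, i₁), …, (sₙ, iₙ)`, the product
`exp((t-sₙ)B) A_{iₙ} exp((sₙ-sₙ₋₁)B) ⋯ A_{i₁} exp((s₁-s)B)`. -/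
def orderedProduct (A : SignType → (k →L[ℂ] k)) (B : k →L[ℂ] k) (t : ℝ) :
    ℝ → List (ℝ ×ₗ SignType) → (k →L[ℂ] k)
  | s, [] => NormedSpace.exp (((t - s : ℝ) : ℂ) • B)
  | s, p :: l =>
      orderedProduct A B t (ofLex p).1 l * A (ofLex p).2 *
        NormedSpace.exp ((((ofLex p).1 - s : ℝ) : ℂ) • B)

open Classical in
/-- The kernel `u^t_s(A₁, A₀, A₋₁; B)(σ, τ, υ)`: with the marked points in increasing order,
`s₁ ≤ ⋯ ≤ sₙ`, it is `1{s < s₁ < ⋯ < sₙ < t}` times the time ordered product. -/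
def kernel (A : SignType → (k →L[ℂ] k)) (B : k →L[ℂ] k) (t s : ℝ) (σ τ υ : Multiset ℝ) :
    k →L[ℂ] k :=
  if (s :: (((marked σ τ υ).sort).map fun p => (ofLex p).1) ++ [t]).Pairwise (· < ·) then
    orderedProduct A B t s (marked σ τ υ).sort
  else 0

/-- The action of a kernel `F(σ, τ, υ)` on functions,
`(𝒪(F) g)(ω) = ∑_{α ⊆ ω} ∑_{β ⊆ ω∖α} ∫ λ(dυ) F(α, β, υ) g((ω∖α) + υ)`.
The antidiagonal of a multiset of `n` points lists its `2ⁿ` decompositions into two parts, one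
for each subset of the index set. -/
def kernelOp (F : Multiset ℝ → Multiset ℝ → Multiset ℝ → (k →L[ℂ] k)) (g : Multiset ℝ → k)
    (ω : Multiset ℝ) : k :=
  (ω.antidiagonal.map fun p =>
    (p.2.antidiagonal.map fun q => ∫ υ, F p.1 q.1 υ (g (p.2 + υ)) ∂lam).sum).sum

/-- The operators `W(t) = Θ(t) U^t_0`. -/
def groupW (U : ℝ → ℝ → (Fock k →L[ℂ] Fock k)) (t : ℝ) : Fock k →L[ℂ] Fock k :=
  Theta t * U t 0

variable [CompleteSpace k]

/-- The conditions on the coefficients for unitarity: there is a unitary `Υ` with `A₀ = Υ - 1`,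
`A₁ = -Υ A₋₁⁺` and `B + B⁺ = -A₁⁺ A₁ = -A₋₁ A₋₁⁺`. -/
def UnitarityConditions (A : SignType → (k →L[ℂ] k)) (B : k →L[ℂ] k) : Prop :=
  ∃ Y ∈ unitary (k →L[ℂ] k),
    A 0 = Y - 1 ∧ A 1 = -(Y * star (A (-1))) ∧
      B + star B = -(star (A 1) * A 1) ∧ B + star B = -(A (-1) * star (A (-1)))

/-- `U t s` stands for `U^t_s`. For `s < t` it is a bounded operator on `Γ` that extends
`𝒪(u^t_s) : 𝒦 → Γ`; moreover `U^s_s = 1`, and `U^t_s = (U^s_t)⁺` for `t < s`. -/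
structure IsEvolution [TopologicalSpace.SeparableSpace k]
    (A : SignType → (k →L[ℂ] k)) (B : k →L[ℂ] k) (U : ℝ → ℝ → (Fock k →L[ℂ] Fock k)) :
    Prop where
  extends_kernelOp : ∀ s t : ℝ, s < t → ∀ (g : Multiset ℝ → k) (hg : IsTest g),
    (U t s (hg.memLp.toLp g) : Multiset ℝ → k) =ᵐ[lam] kernelOp (kernel A B t s) g
  self : ∀ s : ℝ, U s s = 1
  backward : ∀ s t : ℝ, t < s → U t s = star (U s t)

end Operators

end

end WhiteNoise

namespace WhiteNoise

-- All analysis is done on functions dominated by an exponential vector, |g(ω)| ≤ D ∏_{x∈ω} q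
-- 1_{[-R,R]}(x) (`Dominated`). They are square integrable, include the test functions, and are
-- mapped to dominated functions by every 𝒪(u^t_s) (`dominated_kernelOp`). Hence all sums and
-- integrals converge absolutely and the operators can be composed, whereas 𝒦 itself need not be
-- preserved.
--
-- Splitting off the last factor of the time ordered product (`kernel_peel`) shows that X_t =
-- 𝒪(u^t_s)g solves, for every configuration ω, X_t(ω) = g(ω) + ∫_s^t (B X_r(ω) + A₋₁ Z_r(ω)) dr +
-- ∑_{x∈ω, s<x<t} (A₁ X_x(ω∖x) + A₀ Z_x(ω∖x)), with Z_r = 𝒪(u^r_s) g(r + ·)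
-- (`kernelOp_eq_integral`). For fixed ω this is a path with finitely many jumps, so ‖X_t(ω)‖² is
-- the initial value plus a drift integral plus the jumps of the square (`norm_sq_of_jumps`). The
-- evolution up to time x does not act on a point at x, that is, X_x(ω' + x) = Z_x(ω')
-- (`kernelOp_cons`). With it, the unitarity conditions say that the jump of the square at x is
-- minus the drift density at (x, ω∖x) (`IsometryConditions.cancel`). Integrating over ω, Mecke's
-- formula ∫ ∑_{x∈ω} F(x, ω∖x) dω = ∫∫ F(x, ω) dω dx (`lintegral_psum`, `integral_psum`) makes drift
-- and jumps cancel. So solutions have constant norm (`integral_norm_sq_eq`).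
--
-- Everything else follows from this conservation law. Applied to 𝒪(u^t_s)g it gives an isometry,
-- which extends to Γ because test functions are dense. Applied to the difference of two solutions
-- with the same value at an intermediate time it gives the composition law (`kernelOp_comp`). For
-- surjectivity, the sum-integral lemma (`integral_asum`) exchanges created and annihilated points
-- and identifies the adjoint of 𝒪(u^t_s) with the time reversal of the evolution with coefficients
-- A₋ᵢ⁺, B⁺. These satisfy the same isometry conditions with Υ⁺, so the adjoint is isometric too
-- (`norm_star_forwardOp`).
--
-- The kernel depends on differences of times only, which gives the cocycle property and, with the
-- composition law, the group law of W. Strong continuity reduces to right continuity at 0 on test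
-- functions, where dominated convergence applies.

universe u

/-! ### Configurations as words up to permutation; measurability -/

theorem word_injective (n : ℕ) : Function.Injective (word n) :=
  sigma_mk_injective (β := fun n : ℕ => Fin n → ℝ)

theorem measurableEmbedding_word (n : ℕ) : MeasurableEmbedding (word n) where
  injective := word_injective n
  measurable := measurable_word n
  measurableSet_image' := by
    intro s hs
    refine MeasurableSpace.measurableSet_iInf.2 fun m => ?_
    change MeasurableSet (word m ⁻¹' (word n '' s))
    rcases eq_or_ne m n with rfl | h
    · rwa [preimage_image_eq _ (word_injective m)]
    · convert MeasurableSet.empty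
      ext x
      simp only [mem_preimage, mem_image, mem_empty_iff_false, iff_false]
      rintro ⟨y, -, hy⟩
      exact h (congrArg Sigma.fst hy).symm

theorem exists_points_eq (ω : Multiset ℝ) : ∃ w : Words, points w = ω := by
  induction ω using Quotient.inductionOn with
  | h l =>
    refine ⟨⟨l.length, l.get⟩, ?_⟩
    simp only [points, Multiset.quot_mk_to_coe]
    rw [Fin.univ_val_map]
    simp

/-- Both words have the same increasing rearrangement, and composing the two sorting permutations
relates them. -/
theorem points_word_eq_iff {n : ℕ} {x y : Fin n → ℝ} :
    points (word n x) = points (word n y) ↔ ∃ σ : Equiv.Perm (Fin n), x = y ∘ σ := by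
  have hc : ∀ z : Fin n → ℝ, points (word n z) = List.ofFn z := fun z => Fin.univ_val_map z
  constructor
  · intro h
    rw [hc, hc, Multiset.coe_eq_coe] at h
    have h1 : x ∘ Tuple.sort x = y ∘ Tuple.sort y := by
      refine List.ofFn_injective ?_
      exact (((Tuple.sort x).ofFn_comp_perm x).trans
        (h.trans ((Tuple.sort y).ofFn_comp_perm y).symm)).eq_of_pairwise'
          (Tuple.monotone_sort x).sortedLE_ofFn.pairwise (Tuple.monotone_sort y).sortedLE_ofFn.pairwise
    refine ⟨(Tuple.sort x)⁻¹.trans (Tuple.sort y), ?_⟩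
    ext i
    have := congrFun h1 ((Tuple.sort x)⁻¹ i)
    simpa using this
  · rintro ⟨σ, rfl⟩
    rw [hc, hc, Multiset.coe_eq_coe]
    exact σ.ofFn_comp_perm y

theorem card_points (w : Words) : (points w).card = w.1 := by simp [points]

/-- A measurable section of `points`: the increasing arrangement. -/
noncomputable def sortWord (ω : Multiset ℝ) : Words :=
  let w := (exists_points_eq ω).choose
  ⟨w.1, w.2 ∘ Tuple.sort w.2⟩

/-- The representative picked by choice does not matter: any two differ by a permutation, which
sorting forgets. -/
theorem sortWord_points (n : ℕ) (x : Fin n → ℝ) :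
    sortWord (points (word n x)) = word n (x ∘ Tuple.sort x) := by
  have h := (exists_points_eq (points (word n x))).choose_spec
  simp only [sortWord]
  generalize (exists_points_eq (points (word n x))).choose = w at h
  obtain ⟨m, y⟩ := w
  have hm : m = n := by
    have := congrArg Multiset.card h
    simpa [card_points, word] using this
  subst hm
  obtain ⟨σ, rfl⟩ := points_word_eq_iff.1 h
  simp only [Tuple.comp_perm_comp_sort_eq_comp_sort]
  rfl

theorem points_sortWord (ω : Multiset ℝ) : points (sortWord ω) = ω := by
  obtain ⟨⟨n, x⟩, rfl⟩ := exists_points_eq ω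
  exact (congrArg points (sortWord_points n x)).trans (points_word_eq_iff.2 ⟨_, rfl⟩)

/-- Where x ∘ σ is monotone, sorting is the measurable map x ↦ x ∘ σ; finitely many permutations σ
cover the space. -/
theorem measurable_comp_sort (n : ℕ) :
    Measurable fun x : Fin n → ℝ => x ∘ Tuple.sort x := by
  intro s hs
  have : (fun x : Fin n → ℝ => x ∘ Tuple.sort x) ⁻¹' s =
      ⋃ σ : Equiv.Perm (Fin n), {x | Monotone (x ∘ σ)} ∩ {x | x ∘ σ ∈ s} := by
    ext x
    simp only [mem_preimage, mem_iUnion, mem_inter_iff, mem_ofPred_eq]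
    constructor
    · exact fun h => ⟨Tuple.sort x, Tuple.monotone_sort x, h⟩
    · rintro ⟨σ, h1, h2⟩
      rwa [← Tuple.comp_sort_eq_comp_iff_monotone.2 h1]
  rw [this]
  refine MeasurableSet.iUnion fun σ => MeasurableSet.inter ?_ ?_
  · have : {x : Fin n → ℝ | Monotone (x ∘ σ)} = ⋂ i, ⋂ j, ⋂ (_ : i ≤ j), {x | x (σ i) ≤ x (σ j)} := by
      ext x
      simp [Monotone]
    rw [this]
    refine MeasurableSet.iInter fun i => MeasurableSet.iInter fun j => MeasurableSet.iInter fun _ => ?_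
    exact measurableSet_le (measurable_pi_apply _) (measurable_pi_apply _)
  · exact (measurable_pi_lambda _ fun i => measurable_pi_apply _ : Measurable fun x : Fin n → ℝ => x ∘ σ) hs

theorem measurable_of_comp_word {E : Type*} [MeasurableSpace E] {f : Words → E}
    (h : ∀ n, Measurable fun x => f (word n x)) : Measurable f := fun _ hs =>
  MeasurableSpace.measurableSet_iInf.2 fun n => h n hs

theorem measurable_of_comp_points {E : Type*} [MeasurableSpace E] {f : Multiset ℝ → E}
    (h : ∀ n, Measurable fun x => f (points (word n x))) : Measurable f := by
  have h' : Measurable fun w => f (points w) :=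
    measurable_of_comp_word (f := fun w => f (points w)) h
  exact fun s hs => h' hs

theorem measurable_sortWord : Measurable sortWord := by
  refine measurable_of_comp_points fun n => ?_
  simp only [sortWord_points]
  exact (measurable_word n).comp (measurable_comp_sort n)

section
variable {Y E : Type*} [MeasurableSpace Y] [MeasurableSpace E]

/-- The σ-algebra of the product is not by definition the one generated by its slices, so the
preimage is assembled from images under the measurable embeddings of Y × ℝⁿ. -/
theorem measurable_prod_words {f : Y × Words → E}
    (h : ∀ n, Measurable fun p : Y × (Fin n → ℝ) => f (p.1, word n p.2)) : Measurable f := by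
  intro s hs
  have : f ⁻¹' s = ⋃ n, (Prod.map id (word n)) '' ((fun p : Y × (Fin n → ℝ) => f (p.1, word n p.2)) ⁻¹' s) := by
    ext ⟨y, n, x⟩
    simp only [mem_preimage, mem_iUnion, mem_image]
    constructor
    · exact fun hy => ⟨n, (y, x), hy, rfl⟩
    · rintro ⟨m, ⟨y', x'⟩, h1, h2⟩
      rw [← h2]
      exact h1
  rw [this]
  exact MeasurableSet.iUnion fun n =>
    ((MeasurableEmbedding.id.prodMap (measurableEmbedding_word n)).measurableSet_image).2 (h n hs)

/-- A function of a parameter and a configuration is measurable if it is measurable in the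
coordinates of the configuration, for each number of points. -/
theorem measurable_prod_multiset {f : Y × Multiset ℝ → E}
    (h : ∀ n, Measurable fun p : Y × (Fin n → ℝ) => f (p.1, points (word n p.2))) :
    Measurable f := by
  have h1 : Measurable fun p : Y × Words => f (p.1, points p.2) :=
    measurable_prod_words (f := fun p : Y × Words => f (p.1, points p.2)) h
  -- A product with a quotient σ-algebra need not be a quotient of the product; the measurable
  -- section `sortWord` lifts configurations to words instead.
  have h2 := h1.comp (measurable_id.prodMap measurable_sortWord)
  simpa only [Function.comp_def, Prod.map, points_sortWord, id] using h2

end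

theorem measurable_points_word (n : ℕ) : Measurable fun x : Fin n → ℝ => points (word n x) :=
  measurable_points.comp (measurable_word n)

theorem points_zero (x : Fin 0 → ℝ) : points (word 0 x) = 0 := by
  rw [← Multiset.card_eq_zero, card_points]; rfl

theorem points_succ {n : ℕ} (x : Fin (n + 1) → ℝ) (i : Fin (n + 1)) :
    points (word (n + 1) x) = x i ::ₘ points (word n fun j => x (i.succAbove j)) := by
  change Multiset.map x (Finset.univ : Finset (Fin (n + 1))).val =
    x i ::ₘ Multiset.map (fun j => x (i.succAbove j)) (Finset.univ : Finset (Fin n)).val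
  rw [Fin.univ_succAbove n i]
  simp [Function.comp_def]

theorem measurable_cons : Measurable fun p : ℝ × Multiset ℝ => p.1 ::ₘ p.2 := by
  refine measurable_prod_multiset fun n => ?_
  have : ∀ p : ℝ × (Fin n → ℝ), p.1 ::ₘ points (word n p.2) =
      points (word (n + 1) (Fin.cons p.1 p.2)) := by
    intro p
    rw [points_succ _ 0]
    simp
  simp only [this]
  refine (measurable_points_word (n + 1)).comp (measurable_pi_lambda _ fun i => ?_)
  refine Fin.cases ?_ (fun i => ?_) i
  · simpa using measurable_fst
  · simp only [Fin.cons_succ]; fun_prop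

theorem Measurable.multiset_cons {Y : Type*} [MeasurableSpace Y] {f : Y → ℝ} {g : Y → Multiset ℝ}
    (hf : Measurable f) (hg : Measurable g) : Measurable fun y => f y ::ₘ g y :=
  measurable_cons.comp (hf.prodMk hg)

theorem measurable_add_multiset : Measurable fun p : Multiset ℝ × Multiset ℝ => p.1 + p.2 := by
  refine measurable_prod_multiset fun n => ?_
  induction n with
  | zero => simpa only [points_zero, add_zero] using measurable_fst
  | succ n ih =>
    simp only [points_succ _ 0, Multiset.add_cons]
    refine Measurable.multiset_cons (by fun_prop) ?_
    exact ih.comp (g := fun p : Multiset ℝ × (Fin n → ℝ) => p.1 + points (word n p.2))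
      (f := fun p : Multiset ℝ × (Fin (n + 1) → ℝ) => (p.1, fun j => p.2 ((0 : Fin (n + 1)).succAbove j)))
      (by fun_prop)

theorem Measurable.multiset_add {Y : Type*} [MeasurableSpace Y] {f g : Y → Multiset ℝ}
    (hf : Measurable f) (hg : Measurable g) : Measurable fun y => f y + g y :=
  measurable_add_multiset.comp (hf.prodMk hg)

theorem measurable_card : Measurable fun ω : Multiset ℝ => ω.card := by
  refine measurable_of_comp_points fun n => ?_
  simp only [card_points]
  exact measurable_const

/-! ### Sums over points and over decompositions of a configuration -/

/-- The sum `∑_{x ∈ ω} F(x, ω ∖ x)`. -/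
noncomputable def psum {E : Type*} [AddCommMonoid E] (F : ℝ → Multiset ℝ → E) (ω : Multiset ℝ) : E :=
  (ω.map fun x => F x (ω.erase x)).sum

/-- The sum of `F(α, β)` over the decompositions `ω = α + β`. -/
noncomputable def asum {E : Type*} [AddCommMonoid E] (F : Multiset ℝ → Multiset ℝ → E) (ω : Multiset ℝ) : E :=
  (ω.antidiagonal.map fun p => F p.1 p.2).sum

section
variable {E : Type*} [AddCommMonoid E]

@[simp] theorem psum_zero (F : ℝ → Multiset ℝ → E) : psum F 0 = 0 := by simp [psum]

theorem psum_cons (F : ℝ → Multiset ℝ → E) (a : ℝ) (ω : Multiset ℝ) :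
    psum F (a ::ₘ ω) = F a ω + psum (fun x ω' => F x (a ::ₘ ω')) ω := by
  simp only [psum, Multiset.map_cons, Multiset.sum_cons, Multiset.erase_cons_head]
  congr 2
  refine Multiset.map_congr rfl fun x hx => ?_
  rcases eq_or_ne a x with rfl | h
  · rw [Multiset.erase_cons_head, Multiset.cons_erase hx]
  · rw [Multiset.erase_cons_tail _ h]

theorem psum_congr {F G : ℝ → Multiset ℝ → E} {ω : Multiset ℝ}
    (h : ∀ x ω', ω = x ::ₘ ω' → F x ω' = G x ω') : psum F ω = psum G ω := by
  simp only [psum]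
  exact congrArg _ (Multiset.map_congr rfl fun x hx => h x _ (Multiset.cons_erase hx).symm)

theorem psum_add (F G : ℝ → Multiset ℝ → E) (ω : Multiset ℝ) :
    psum (fun x ω' => F x ω' + G x ω') ω = psum F ω + psum G ω := by
  simp [psum, Multiset.sum_map_add]

@[simp] theorem asum_zero (F : Multiset ℝ → Multiset ℝ → E) : asum F 0 = F 0 0 := by simp [asum]

theorem asum_cons (F : Multiset ℝ → Multiset ℝ → E) (a : ℝ) (ω : Multiset ℝ) :
    asum F (a ::ₘ ω) = asum (fun α β => F α (a ::ₘ β)) ω + asum (fun α β => F (a ::ₘ α) β) ω := by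
  simp [asum, Multiset.antidiagonal_cons, Multiset.map_map]

theorem asum_congr {F G : Multiset ℝ → Multiset ℝ → E} {ω : Multiset ℝ}
    (h : ∀ α β, ω = α + β → F α β = G α β) : asum F ω = asum G ω := by
  simp only [asum]
  exact congrArg _ (Multiset.map_congr rfl fun p hp => h _ _ (Multiset.mem_antidiagonal.1 hp).symm)

theorem asum_add (F G : Multiset ℝ → Multiset ℝ → E) (ω : Multiset ℝ) :
    asum (fun α β => F α β + G α β) ω = asum F ω + asum G ω := by
  simp [asum, Multiset.sum_map_add]

/-- Decomposing ω and then choosing a point of the first part is the same as choosing a point of ω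
and then decomposing the rest. -/
theorem asum_psum_left (F : ℝ → Multiset ℝ → Multiset ℝ → E) (ω : Multiset ℝ) :
    asum (fun α β => psum (fun x α' => F x α' β) α) ω = psum (fun x => asum (F x)) ω := by
  induction ω using Multiset.induction_on generalizing F with
  | empty => simp
  | cons a ω ih =>
    simp only [asum_cons, psum_cons, asum_add, psum_add, ih]
    abel

theorem asum_psum_right (F : ℝ → Multiset ℝ → Multiset ℝ → E) (ω : Multiset ℝ) :
    asum (fun α β => psum (fun x β' => F x α β') β) ω = psum (fun x => asum (F x)) ω := by
  induction ω using Multiset.induction_on generalizing F with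
  | empty => simp
  | cons a ω ih =>
    simp only [asum_cons, psum_cons, asum_add, psum_add, ih]
    abel

/-- With multiplicities counted by index sets, exactly one decomposition has an empty first part. -/
theorem asum_ite_eq_zero (F : Multiset ℝ → Multiset ℝ → E) (ω : Multiset ℝ) :
    asum (fun α β => if α = 0 then F α β else 0) ω = F 0 ω := by
  induction ω using Multiset.induction_on generalizing F with
  | empty => simp
  | cons a ω ih =>
    rw [asum_cons]
    have := ih fun α β => F α (a ::ₘ β)
    simp only [Multiset.cons_ne_zero, if_false]
    rw [this]
    simp [asum]

theorem psum_points (F : ℝ → Multiset ℝ → E) {n : ℕ} (x : Fin (n + 1) → ℝ) :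
    psum F (points (word (n + 1) x)) =
      ∑ i, F (x i) (points (word n fun j => x (i.succAbove j))) := by
  have h : points (word (n + 1) x) = (Finset.univ : Finset (Fin (n + 1))).val.map x := rfl
  rw [psum, h, Multiset.map_map, ← h]
  refine Finset.sum_congr rfl fun i _ => ?_
  simp only [Function.comp]
  rw [points_succ x i, Multiset.erase_cons_head]

end

section
variable {Y : Type u} {E : Type*} [MeasurableSpace Y] [AddCommMonoid E] [MeasurableSpace E] [MeasurableAdd₂ E]

theorem measurable_psum {F : Y → ℝ → Multiset ℝ → E}
    (hF : Measurable fun p : Y × ℝ × Multiset ℝ => F p.1 p.2.1 p.2.2) :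
    Measurable fun p : Y × Multiset ℝ => psum (F p.1) p.2 := by
  refine measurable_prod_multiset fun n => ?_
  cases n with
  | zero => simp only [points_zero, psum_zero]; exact measurable_const
  | succ n =>
    simp only [psum_points]
    refine Finset.measurable_sum _ fun i _ => ?_
    have h : Measurable fun p : Y × (Fin (n + 1) → ℝ) =>
        (p.1, p.2 i, points (word n fun j => p.2 (i.succAbove j))) := by
      refine measurable_fst.prodMk (Measurable.prodMk (by fun_prop) ?_)
      exact (measurable_points_word n).comp
        (f := fun p : Y × (Fin (n + 1) → ℝ) => fun j => p.2 (i.succAbove j)) (by fun_prop)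
    exact hF.comp h

/-- The parameter space is quantified inside the induction: the step moves one coordinate of the
configuration into it. -/
theorem measurable_asum_points {E : Type*} [AddCommMonoid E] [MeasurableSpace E]
    [MeasurableAdd₂ E] (n : ℕ) : ∀ {Y : Type u} [MeasurableSpace Y]
    {F : Y → Multiset ℝ → Multiset ℝ → E},
    (Measurable fun p : Y × Multiset ℝ × Multiset ℝ => F p.1 p.2.1 p.2.2) →
    Measurable fun p : Y × (Fin n → ℝ) => asum (F p.1) (points (word n p.2)) := by
  induction n with
  | zero =>
    intro Y _ F hF
    simp only [points_zero, asum_zero]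
    exact hF.comp (g := fun p : Y × Multiset ℝ × Multiset ℝ => F p.1 p.2.1 p.2.2)
      (f := fun p : Y × (Fin 0 → ℝ) => (p.1, 0, 0)) (by fun_prop)
  | succ n ih =>
    intro Y _ F hF
    simp only [points_succ _ 0, asum_cons]
    have hm : Measurable fun p : Y × (Fin (n + 1) → ℝ) =>
        ((p.1, p.2 0), fun j => p.2 ((0 : Fin (n + 1)).succAbove j)) := by fun_prop
    refine Measurable.add ?_ ?_
    · refine (ih (Y := Y × ℝ) (F := fun y α β => F y.1 α (y.2 ::ₘ β)) ?_).comp hm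
      exact hF.comp (g := fun p : Y × Multiset ℝ × Multiset ℝ => F p.1 p.2.1 p.2.2)
        (f := fun p : (Y × ℝ) × Multiset ℝ × Multiset ℝ => (p.1.1, p.2.1, p.1.2 ::ₘ p.2.2))
        ((by fun_prop : Measurable fun p : (Y × ℝ) × Multiset ℝ × Multiset ℝ => p.1.1).prodMk
          (Measurable.prodMk (by fun_prop) (Measurable.multiset_cons (by fun_prop) (by fun_prop))))
    · refine (ih (Y := Y × ℝ) (F := fun y α β => F y.1 (y.2 ::ₘ α) β) ?_).comp hm
      exact hF.comp (g := fun p : Y × Multiset ℝ × Multiset ℝ => F p.1 p.2.1 p.2.2)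
        (f := fun p : (Y × ℝ) × Multiset ℝ × Multiset ℝ => (p.1.1, p.1.2 ::ₘ p.2.1, p.2.2))
        ((by fun_prop : Measurable fun p : (Y × ℝ) × Multiset ℝ × Multiset ℝ => p.1.1).prodMk
          (Measurable.prodMk (Measurable.multiset_cons (by fun_prop) (by fun_prop)) (by fun_prop)))

theorem measurable_asum {F : Y → Multiset ℝ → Multiset ℝ → E}
    (hF : Measurable fun p : Y × Multiset ℝ × Multiset ℝ => F p.1 p.2.1 p.2.2) :
    Measurable fun p : Y × Multiset ℝ => asum (F p.1) p.2 := by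
  refine measurable_prod_multiset fun n => ?_
  exact measurable_asum_points n hF

end
end WhiteNoise

namespace WhiteNoise

/-! ### Mecke's formula and the sum-integral lemma for nonnegative functions -/

instance : SFinite lam := by unfold lam wordMeasure; infer_instance

theorem lintegral_lam {F : Multiset ℝ → ℝ≥0∞} (hF : Measurable F) :
    ∫⁻ ω, F ω ∂lam = ∑' n, (n ! : ℝ≥0∞)⁻¹ * ∫⁻ x : Fin n → ℝ, F (points (word n x)) := by
  have h1 : Measurable fun w => F (points w) := hF.comp measurable_points
  rw [lam, lintegral_map hF measurable_points, wordMeasure, lintegral_sum_measure]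
  refine tsum_congr fun n => ?_
  rw [lintegral_smul_measure, lintegral_map h1 (measurable_word n), smul_eq_mul]

theorem lintegral_lam_ite_zero (F : Multiset ℝ → ℝ≥0∞) (hF : Measurable F) :
    ∫⁻ ω, (if ω.card = 0 then F ω else 0) ∂lam = F 0 := by
  have hm : Measurable fun ω : Multiset ℝ => if ω.card = 0 then F ω else 0 :=
    Measurable.ite (measurable_card (measurableSet_singleton 0)) hF measurable_const
  rw [lintegral_lam hm, tsum_eq_single 0]
  · simp [points_zero, volume_pi]
  · intro n hn
    simp [card_points, word, hn]

/-- The formula of Mecke and Campbell. -/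
theorem lintegral_psum {F : ℝ → Multiset ℝ → ℝ≥0∞}
    (hF : Measurable fun p : ℝ × Multiset ℝ => F p.1 p.2) :
    ∫⁻ ω, psum F ω ∂lam = ∫⁻ x, ∫⁻ ω, F x ω ∂lam := by
  have hp : Measurable (psum F) := by
    have := measurable_psum (Y := Unit) (F := fun _ => F) (hF.comp measurable_snd)
    exact this.comp (f := fun ω => ((), ω)) (by fun_prop)
  have hR : ∀ x, ∫⁻ ω, F x ω ∂lam =
      ∑' n, (n ! : ℝ≥0∞)⁻¹ * ∫⁻ y : Fin n → ℝ, F x (points (word n y)) := fun x =>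
    lintegral_lam (hF.comp measurable_prodMk_left)
  have hFn : ∀ n, Measurable fun p : ℝ × (Fin n → ℝ) => F p.1 (points (word n p.2)) := fun n =>
    hF.comp (measurable_fst.prodMk ((measurable_points_word n).comp measurable_snd))
  simp only [hR]
  rw [lintegral_tsum fun n => ((hFn n).lintegral_prod_right'.const_mul _).aemeasurable,
    lintegral_lam hp, tsum_eq_zero_add' ENNReal.summable]
  simp only [points_zero, psum_zero, lintegral_zero, mul_zero, zero_add]
  refine tsum_congr fun n => ?_
  -- By Fubini each of the n + 1 coordinates, taken as the marked point, contributes the same double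
  -- integral.
  have key : ∀ i : Fin (n + 1), ∫⁻ x : Fin (n + 1) → ℝ,
      F (x i) (points (word n fun j => x (i.succAbove j))) =
        ∫⁻ x, ∫⁻ y : Fin n → ℝ, F x (points (word n y)) := by
    intro i
    have h := volume_preserving_piFinSuccAbove (fun _ : Fin (n + 1) => ℝ) i
    rw [← lintegral_prod _ (hFn n).aemeasurable]
    exact h.lintegral_comp (hFn n)
  simp only [psum_points]
  rw [lintegral_finsetSum _ fun i _ => ?_]
  · simp only [key]
    rw [lintegral_const_mul _ (hFn n).lintegral_prod_right', Finset.sum_const, Finset.card_univ,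
      Fintype.card_fin, nsmul_eq_mul, ← mul_assoc]
    congr 1
    -- The weights of the measure are used here: (n + 1) · 1/(n + 1)! = 1/n!.
    rw [Nat.factorial_succ, Nat.cast_mul, ENNReal.mul_inv (Or.inr (ENNReal.natCast_ne_top _))
      (Or.inl (ENNReal.natCast_ne_top _)), mul_comm, ← mul_assoc, ENNReal.mul_inv_cancel, one_mul]
    · exact_mod_cast n.succ_ne_zero
    · exact ENNReal.natCast_ne_top _
  · refine (hFn n).comp (f := fun x : Fin (n + 1) → ℝ => (x i, fun j => x (i.succAbove j))) ?_
    fun_prop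

theorem measurable_asum' {E : Type*} [AddCommMonoid E] [MeasurableSpace E] [MeasurableAdd₂ E]
    {F : Multiset ℝ → Multiset ℝ → E}
    (hF : Measurable fun p : Multiset ℝ × Multiset ℝ => F p.1 p.2) : Measurable (asum F) := by
  have := measurable_asum (Y := Unit) (F := fun _ => F) (hF.comp measurable_snd)
  exact this.comp (f := fun ω => ((), ω)) (by fun_prop)

theorem measurable_psum' {E : Type*} [AddCommMonoid E] [MeasurableSpace E] [MeasurableAdd₂ E]
    {F : ℝ → Multiset ℝ → E}
    (hF : Measurable fun p : ℝ × Multiset ℝ => F p.1 p.2) : Measurable (psum F) := by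
  have := measurable_psum (Y := Unit) (F := fun _ => F) (hF.comp measurable_snd)
  exact this.comp (f := fun ω => ((), ω)) (by fun_prop)

theorem asum_const_mul {E : Type*} [NonUnitalNonAssocSemiring E] (c : E)
    (F : Multiset ℝ → Multiset ℝ → E)
    (ω : Multiset ℝ) : asum (fun x ω' => c * F x ω') ω = c * asum F ω := by
  simp [asum, Multiset.sum_map_mul_left]

/-- Marking one of `n + 1` points. -/
theorem psum_card_eq (n : ℕ) (f : Multiset ℝ → ℝ≥0∞) (α : Multiset ℝ) :
    psum (fun x α' => if α'.card = n then f (x ::ₘ α') else 0) α =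
      ((n + 1 : ℕ) : ℝ≥0∞) * if α.card = n + 1 then f α else 0 := by
  have : psum (fun x α' => if α'.card = n then f (x ::ₘ α') else 0) α =
      psum (fun _ _ => if α.card = n + 1 then f α else 0) α := by
    refine psum_congr ?_
    rintro x ω' rfl
    simp
  rw [this]
  simp only [psum, Multiset.map_const', Multiset.sum_replicate, nsmul_eq_mul]
  split_ifs with h <;> simp [h]

/-- Induction on the number of points of α. Multiplying by n + 1 marks one of them, Mecke's formula
turns the marked point into an integration variable on both sides, and the induction hypothesis
handles the remaining n. -/
theorem lintegral_asum_card (n : ℕ) : ∀ {F : Multiset ℝ → Multiset ℝ → ℝ≥0∞},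
    (Measurable fun p : Multiset ℝ × Multiset ℝ => F p.1 p.2) →
    ∫⁻ ω, asum (fun α β => if α.card = n then F α β else 0) ω ∂lam =
      ∫⁻ α, (if α.card = n then ∫⁻ β, F α β ∂lam else 0) ∂lam := by
  induction n with
  | zero =>
    intro F hF
    rw [lintegral_lam_ite_zero _ hF.lintegral_prod_right']
    simp only [Multiset.card_eq_zero, asum_ite_eq_zero]
  | succ n ih =>
    intro F hF
    have hn0 : ((n + 1 : ℕ) : ℝ≥0∞) ≠ 0 := by exact_mod_cast n.succ_ne_zero
    have hnt : ((n + 1 : ℕ) : ℝ≥0∞) ≠ ∞ := ENNReal.natCast_ne_top _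
    have hcons : Measurable fun p : (ℝ × Multiset ℝ) × Multiset ℝ => F (p.1.1 ::ₘ p.1.2) p.2 :=
      hF.comp ((Measurable.multiset_cons (by fun_prop) (by fun_prop)).prodMk measurable_snd)
    have hite : ∀ m : ℕ, MeasurableSet {α : Multiset ℝ | α.card = m} := fun m =>
      measurable_card (measurableSet_singleton m)
    have hG : Measurable fun p : ℝ × Multiset ℝ × Multiset ℝ =>
        if p.2.1.card = n then F (p.1 ::ₘ p.2.1) p.2.2 else 0 := by
      refine Measurable.ite ((hite n).preimage (by fun_prop : Measurable fun p : ℝ × Multiset ℝ × Multiset ℝ => p.2.1)) ?_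
        measurable_const
      exact hcons.comp (f := fun p : ℝ × Multiset ℝ × Multiset ℝ => ((p.1, p.2.1), p.2.2)) (by fun_prop)
    have hG2 : Measurable fun p : ℝ × Multiset ℝ =>
        if p.2.card = n then ∫⁻ β, F (p.1 ::ₘ p.2) β ∂lam else 0 :=
      Measurable.ite ((hite n).preimage measurable_snd) hcons.lintegral_prod_right' measurable_const
    have hI : Measurable fun p : Multiset ℝ × Multiset ℝ =>
        if p.1.card = n + 1 then F p.1 p.2 else 0 :=
      Measurable.ite ((hite (n + 1)).preimage measurable_fst) hF measurable_const
    refine (ENNReal.mul_right_inj hn0 hnt).1 ?_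
    rw [← lintegral_const_mul _ (measurable_asum' hI), ← lintegral_const_mul _
      (Measurable.ite (hite (n + 1)) hF.lintegral_prod_right' measurable_const)]
    simp only [← asum_const_mul, ← psum_card_eq n (fun α => ∫⁻ β, F α β ∂lam)]
    rw [lintegral_psum hG2]
    have : ∀ α β, ((n + 1 : ℕ) : ℝ≥0∞) * (if α.card = n + 1 then F α β else 0) =
        psum (fun x α' => if α'.card = n then F (x ::ₘ α') β else 0) α := fun α β =>
      (psum_card_eq n (fun α => F α β) α).symm
    simp only [this]
    simp only [asum_psum_left fun x α' β => if α'.card = n then F (x ::ₘ α') β else 0]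
    rw [lintegral_psum (F := fun x => asum fun α' β => if α'.card = n then F (x ::ₘ α') β else 0)
      (measurable_asum (F := fun x α' β => if α'.card = n then F (x ::ₘ α') β else 0) hG)]
    refine lintegral_congr fun x => ?_
    exact ih (F := fun α β => F (x ::ₘ α) β) (hcons.comp
      (f := fun p : Multiset ℝ × Multiset ℝ => ((x, p.1), p.2)) (by fun_prop))

/-- The sum-integral lemma. -/
theorem lintegral_asum {F : Multiset ℝ → Multiset ℝ → ℝ≥0∞}
    (hF : Measurable fun p : Multiset ℝ × Multiset ℝ => F p.1 p.2) :
    ∫⁻ ω, asum F ω ∂lam = ∫⁻ α, ∫⁻ β, F α β ∂lam ∂lam := by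
  have hite : ∀ m : ℕ, MeasurableSet {α : Multiset ℝ | α.card = m} := fun m =>
    measurable_card (measurableSet_singleton m)
  -- Decompositions are sorted by the number of points of α, one series term for each.
  have h1 : ∀ (α : Multiset ℝ) (c : ℝ≥0∞), c = ∑' n, if α.card = n then c else 0 := by
    intro α c
    rw [tsum_eq_single α.card]
    · simp
    · intro n hn; simp [hn.symm]
  have h2 : ∀ ω, asum F ω = ∑' n, asum (fun α β => if α.card = n then F α β else 0) ω := by
    intro ω
    have : asum F ω = asum (fun α β => ∑' n, if α.card = n then F α β else 0) ω :=
      asum_congr fun α β _ => h1 α _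
    rw [this]
    simp only [asum]
    generalize ω.antidiagonal = m
    induction m using Multiset.induction_on with
    | empty => simp
    | cons a m ih => simp only [Multiset.map_cons, Multiset.sum_cons, ih, ENNReal.tsum_add]
  simp only [h2]
  rw [lintegral_tsum, lintegral_congr fun α => h1 α (∫⁻ β, F α β ∂lam), lintegral_tsum]
  · exact tsum_congr fun n => lintegral_asum_card n hF
  · exact fun n => (Measurable.ite (hite n) hF.lintegral_prod_right' measurable_const).aemeasurable
  · exact fun n => (measurable_asum' (F := fun α β => if α.card = n then F α β else 0)
      (Measurable.ite ((hite n).preimage measurable_fst) hF measurable_const)).aemeasurable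

/-! ### The same formulas for Bochner integrals -/

section Bochner

open ProbabilityTheory

variable {X Z E : Type*} [MeasurableSpace X] [MeasurableSpace Z] [NormedAddCommGroup E]

theorem lintegral_sum_dirac (m : Multiset Z) {F : Z → ℝ≥0∞} (hF : Measurable F) :
    ∫⁻ z, F z ∂((m.map Measure.dirac).sum : Measure Z) = (m.map F).sum := by
  induction m using Multiset.induction_on with
  | empty => simp
  | cons a m ih => simp [lintegral_add_measure, ih, lintegral_dirac' a hF]

theorem integral_sum_dirac [NormedSpace ℝ E] [CompleteSpace E] (m : Multiset Z) {f : Z → E}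
    (hf : StronglyMeasurable f) :
    Integrable f ((m.map Measure.dirac).sum : Measure Z) ∧
    ∫ z, f z ∂((m.map Measure.dirac).sum : Measure Z) = (m.map f).sum := by
  induction m using Multiset.induction_on with
  | empty => simp
  | cons a m ih =>
    have ha : Integrable f (Measure.dirac a) := by
      refine ⟨hf.aestronglyMeasurable, ?_⟩
      rw [HasFiniteIntegral, lintegral_dirac' a hf.enorm]
      exact enorm_lt_top
    simp only [Multiset.map_cons, Multiset.sum_cons]
    exact ⟨ha.add_measure ih.1, by rw [integral_add_measure ha ih.1, integral_dirac' f a hf, ih.2]⟩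

/-- Integration against ∑_{z ∈ L ω} δ_z is summation over L ω, so Fubini's theorem for transition
kernels applies to such sums. The kernel is s-finite because its restriction to {card (L ω) = n} has
mass at most n. -/
theorem exists_kernel_sum_dirac (L : X → Multiset Z)
    (hL : ∀ F : Z → ℝ≥0∞, Measurable F → Measurable fun ω => ((L ω).map F).sum) :
    ∃ κ : Kernel X Z, (∀ ω, κ ω = ((L ω).map Measure.dirac).sum) ∧ IsSFiniteKernel κ := by
  classical
  let κ : Kernel X Z :=
    { toFun := fun ω => ((L ω).map Measure.dirac).sum
      measurable' := by
        refine Measure.measurable_of_measurable_coe _ fun s hs => ?_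
        have : ∀ ω, ((L ω).map Measure.dirac).sum s = ((L ω).map (s.indicator 1)).sum := by
          intro ω
          rw [← lintegral_sum_dirac (L ω) (measurable_one.indicator hs), lintegral_indicator_one hs]
        simp only [this]
        exact hL _ (measurable_one.indicator hs) }
  have hκ : ∀ ω, κ ω = ((L ω).map Measure.dirac).sum := fun _ => rfl
  refine ⟨κ, hκ, ?_⟩
  clear_value κ
  have huniv : ∀ ω, κ ω univ = ((L ω).card : ℝ≥0∞) := by
    intro ω
    rw [hκ, ← lintegral_one, lintegral_sum_dirac (L ω) measurable_const]
    simp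
  have hcard : ∀ n : ℕ, MeasurableSet {ω | κ ω univ = n} := fun n =>
    κ.measurable_coe MeasurableSet.univ (measurableSet_singleton _)
  refine ⟨⟨fun n => Kernel.piecewise (hcard n) κ 0, fun n => ⟨⟨n, ENNReal.natCast_lt_top n, ?_⟩⟩, ?_⟩⟩
  · intro ω
    rw [Kernel.piecewise_apply]
    split_ifs with hω
    · exact le_of_eq hω
    · simp
  · ext ω s hs
    rw [Kernel.sum_apply' _ _ hs, tsum_eq_single (L ω).card]
    · have hmem : ω ∈ {ω' | κ ω' univ = ((L ω).card : ℝ≥0∞)} := huniv ω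
      rw [Kernel.piecewise_apply, if_pos hmem]
    · intro n hn
      have hmem : ω ∉ {ω' | κ ω' univ = (n : ℝ≥0∞)} := by
        intro h'
        have h'' : κ ω univ = n := h'
        rw [huniv] at h''
        exact hn (by exact_mod_cast h''.symm)
      rw [Kernel.piecewise_apply, if_neg hmem]
      simp

/-- A formula for the integrals of the sums `∑_{z ∈ L ω} F(z)` extends from nonnegative to
integrable functions. -/
theorem integral_multiset_sum [NormedSpace ℝ E] [CompleteSpace E] {μ : Measure X} [SFinite μ]
    {ν : Measure Z} (L : X → Multiset Z)
    (hL : ∀ F : Z → ℝ≥0∞, Measurable F → Measurable fun ω => ((L ω).map F).sum)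
    (h : ∀ F : Z → ℝ≥0∞, Measurable F → ∫⁻ ω, ((L ω).map F).sum ∂μ = ∫⁻ z, F z ∂ν)
    {f : Z → E} (hf : StronglyMeasurable f) (hi : Integrable f ν) :
    Integrable (fun ω => ((L ω).map f).sum) μ ∧ ∫ ω, ((L ω).map f).sum ∂μ = ∫ z, f z ∂ν := by
  obtain ⟨κ, hκ, _⟩ := exists_kernel_sum_dirac L hL
  -- Tested on indicators, the formula for nonnegative functions says that ν is the image of μ under
  -- the kernel.
  have hb : κ ∘ₘ μ = ν := by
    ext s hs
    have hms : Measurable (s.indicator (1 : Z → ℝ≥0∞)) := measurable_one.indicator hs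
    rw [Measure.bind_apply hs κ.aemeasurable, ← lintegral_indicator_one hs, ← h _ hms]
    refine lintegral_congr fun ω => ?_
    rw [hκ, ← lintegral_indicator_one hs, lintegral_sum_dirac _ hms]
  rw [← hb] at hi ⊢
  have hL' : ∀ ω, ((L ω).map f).sum = ∫ z, f z ∂(κ ω) := fun ω =>
    by rw [hκ, (integral_sum_dirac (L ω) hf).2]
  simp only [hL']
  rw [Measure.comp_eq_comp_const_apply] at hi ⊢
  exact ⟨hi.integral_comp, (Kernel.integral_comp hi).symm⟩

variable [NormedSpace ℝ E] [CompleteSpace E]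

theorem integral_psum {f : ℝ → Multiset ℝ → E}
    (hf : StronglyMeasurable fun p : ℝ × Multiset ℝ => f p.1 p.2)
    (hi : Integrable (fun p : ℝ × Multiset ℝ => f p.1 p.2) (volume.prod lam)) :
    Integrable (psum f) lam ∧ ∫ ω, psum f ω ∂lam = ∫ x, ∫ ω, f x ω ∂lam := by
  have hL : ∀ (F : ℝ × Multiset ℝ → ℝ≥0∞) (ω : Multiset ℝ),
      ((ω.map fun x => (x, ω.erase x)).map F).sum = psum (fun x ω' => F (x, ω')) ω := by
    intro F ω
    simp [psum, Multiset.map_map]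
  have := integral_multiset_sum (μ := lam) (ν := volume.prod lam)
    (fun ω : Multiset ℝ => ω.map fun x => (x, ω.erase x))
    (fun F hF => by simpa only [hL] using measurable_psum' (F := fun x ω' => F (x, ω')) hF)
    (fun F hF => by
      simp only [hL]
      rw [lintegral_psum (F := fun x ω' => F (x, ω')) hF, lintegral_prod _ hF.aemeasurable]) hf hi
  have hL' : ∀ (ω : Multiset ℝ), ((ω.map fun x => (x, ω.erase x)).map
      (fun p : ℝ × Multiset ℝ => f p.1 p.2)).sum = psum f ω := by
    intro ω
    simp [psum, Multiset.map_map]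
  simp only [hL', integral_prod _ hi] at this
  exact this

theorem integral_asum {f : Multiset ℝ → Multiset ℝ → E}
    (hf : StronglyMeasurable fun p : Multiset ℝ × Multiset ℝ => f p.1 p.2)
    (hi : Integrable (fun p : Multiset ℝ × Multiset ℝ => f p.1 p.2) (lam.prod lam)) :
    Integrable (asum f) lam ∧ ∫ ω, asum f ω ∂lam = ∫ α, ∫ β, f α β ∂lam ∂lam := by
  have := integral_multiset_sum (μ := lam) (ν := lam.prod lam)
    (fun ω : Multiset ℝ => ω.antidiagonal)
    (fun F hF => measurable_asum' (F := fun α β => F (α, β)) hF)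
    (fun F hF => by
      rw [lintegral_prod _ hF.aemeasurable]
      exact lintegral_asum (F := fun α β => F (α, β)) hF) hf hi
  rw [integral_prod _ hi] at this
  exact this

end Bochner

/-! ### Almost every configuration is simple and avoids a given point -/

/-- Almost no configuration contains a given point. -/
theorem ae_notMem (r : ℝ) : ∀ᵐ ω ∂lam, r ∉ ω := by
  have hm : Measurable fun p : ℝ × Multiset ℝ => ({r} : Set ℝ).indicator (1 : ℝ → ℝ≥0∞) p.1 :=
    (measurable_one.indicator (measurableSet_singleton r)).comp measurable_fst
  -- Mecke's formula computes the mean number of points equal to r as the integral of 1_{r}, which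
  -- is 0.
  have h := lintegral_psum (F := fun x _ => ({r} : Set ℝ).indicator 1 x) hm
  have h0 : ∫⁻ x : ℝ, ∫⁻ ω, ({r} : Set ℝ).indicator (1 : ℝ → ℝ≥0∞) x ∂lam = 0 := by
    rw [lintegral_eq_zero_iff (by exact hm.lintegral_prod_right')]
    filter_upwards [compl_mem_ae_iff.2 (measure_singleton (μ := (volume : Measure ℝ)) r)] with x hx
    simp at hx
    simp [hx]
  rw [h0, lintegral_eq_zero_iff (measurable_psum' hm)] at h
  filter_upwards [h] with ω hω hr
  obtain ⟨ω', rfl⟩ := Multiset.exists_cons_of_mem hr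
  rw [psum_cons] at hω
  simp at hω

/-- Counting pairs of points at the same place and applying Mecke's formula leaves, for each x, the
number of points of ω equal to x, which vanishes almost everywhere. -/
theorem ae_nodup : ∀ᵐ ω ∂lam, Multiset.Nodup ω := by
  have hm : Measurable fun p : ℝ × Multiset ℝ =>
      psum (fun y _ => if y = p.1 then (1 : ℝ≥0∞) else 0) p.2 := by
    refine measurable_psum (F := fun x y _ => if y = x then (1 : ℝ≥0∞) else 0) ?_
    exact Measurable.ite (measurableSet_eq_fun (by fun_prop) (by fun_prop)) measurable_const
      measurable_const
  have h := lintegral_psum (F := fun x => psum fun y _ => if y = x then (1 : ℝ≥0∞) else 0) hm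
  have h0 : ∫⁻ x : ℝ, ∫⁻ ω, psum (fun y _ => if y = x then (1 : ℝ≥0∞) else 0) ω ∂lam = 0 := by
    refine (lintegral_congr fun x => ?_).trans lintegral_zero
    have hx : Measurable fun ω => psum (fun y _ => if y = x then (1 : ℝ≥0∞) else 0) ω :=
      hm.comp (f := fun ω => (x, ω)) measurable_prodMk_left
    rw [lintegral_eq_zero_iff hx]
    filter_upwards [ae_notMem x] with ω hω
    refine Multiset.sum_eq_zero ?_
    simp only [Multiset.mem_map]
    rintro _ ⟨y, hy, rfl⟩
    rw [if_neg]
    rintro rfl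
    exact hω hy
  rw [h0, lintegral_eq_zero_iff (measurable_psum' hm)] at h
  filter_upwards [h] with ω hω
  by_contra hd
  rw [Multiset.nodup_iff_le] at hd
  push Not at hd
  obtain ⟨a, ha⟩ := hd
  obtain ⟨ω', rfl⟩ := Multiset.le_iff_exists_add.1 ha
  simp [psum_cons] at hω

end WhiteNoise

namespace WhiteNoise

/-! ### Exponential weights -/

/-- The weight `∏_{x ∈ ω} q 1_{[-R, R]}(x)`. -/
noncomputable def wt (q R : ℝ) (ω : Multiset ℝ) : ℝ :=
  (ω.map ((Icc (-R) R).indicator fun _ => q)).prod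

@[simp] theorem wt_zero (q R : ℝ) : wt q R 0 = 1 := by simp [wt]

theorem wt_cons (q R x : ℝ) (ω : Multiset ℝ) :
    wt q R (x ::ₘ ω) = (Icc (-R) R).indicator (fun _ => q) x * wt q R ω := by simp [wt]

theorem wt_add (q R : ℝ) (α β : Multiset ℝ) : wt q R (α + β) = wt q R α * wt q R β := by
  simp [wt]

theorem wt_nonneg {q : ℝ} (hq : 0 ≤ q) (R : ℝ) (ω : Multiset ℝ) : 0 ≤ wt q R ω := by
  induction ω using Multiset.induction_on with
  | empty => simp
  | cons a ω ih => rw [wt_cons]; exact mul_nonneg (indicator_nonneg (fun _ _ => hq) _) ih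

theorem wt_mono {q q' R R' : ℝ} (hq : 0 ≤ q) (hqq : q ≤ q') (hR : R ≤ R') (ω : Multiset ℝ) :
    wt q R ω ≤ wt q' R' ω := by
  induction ω using Multiset.induction_on with
  | empty => simp
  | cons a ω ih =>
    rw [wt_cons, wt_cons]
    refine mul_le_mul ?_ ih (wt_nonneg hq _ _) (indicator_nonneg (fun _ _ => hq.trans hqq) _)
    refine (indicator_le_indicator_of_subset (Icc_subset_Icc (neg_le_neg hR) hR) (fun _ => hq) a).trans ?_
    exact indicator_le_indicator hqq

theorem wt_mul (q q' R : ℝ) (ω : Multiset ℝ) : wt q R ω * wt q' R ω = wt (q * q') R ω := by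
  induction ω using Multiset.induction_on with
  | empty => simp
  | cons a ω ih =>
    rw [wt_cons, wt_cons, wt_cons, ← ih]
    by_cases h : a ∈ Icc (-R) R
    · simp only [indicator_of_mem h]; ring
    · simp only [indicator_of_notMem h]; ring

/-- The binomial expansion of the product of (q + q') over the points of ω. It computes all
dominating constants below. -/
theorem asum_wt (q q' R : ℝ) (ω : Multiset ℝ) :
    asum (fun α β => wt q R α * wt q' R β) ω = wt (q + q') R ω := by
  induction ω using Multiset.induction_on with
  | empty => simp
  | cons a ω ih =>
    simp only [asum_cons, wt_cons, mul_assoc, asum_const_mul]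
    simp only [mul_left_comm _ ((Icc (-R) R).indicator (fun _ => q') a), asum_const_mul, ih]
    by_cases h : a ∈ Icc (-R) R
    · simp only [indicator_of_mem h]; ring
    · simp only [indicator_of_notMem h]; ring

theorem wt_points (q R : ℝ) {n : ℕ} (x : Fin n → ℝ) :
    wt q R (points (word n x)) = ∏ i, (Icc (-R) R).indicator (fun _ => q) (x i) := by
  simp only [wt, points, word, Multiset.map_map, Function.comp_def]
  rfl

theorem measurable_wt (q R : ℝ) : Measurable (wt q R) := by
  refine measurable_of_comp_points fun n => ?_
  simp only [wt_points]
  have h : Measurable ((Icc (-R) R).indicator fun _ => q) := measurable_const.indicator measurableSet_Icc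
  exact Finset.measurable_prod _ fun i _ => h.comp (measurable_pi_apply i)

/-- The n-point part contributes Iⁿ/n! with I the one-point integral, so the total is an exponential
series. -/
theorem integrable_wt {q : ℝ} (hq : 0 ≤ q) (R : ℝ) : Integrable (wt q R) lam := by
  refine ⟨(measurable_wt q R).stronglyMeasurable.aestronglyMeasurable, ?_⟩
  have h1 : ∀ ω, ‖wt q R ω‖ₑ = ENNReal.ofReal (wt q R ω) := fun ω =>
    Real.enorm_eq_ofReal (wt_nonneg hq R ω)
  rw [HasFiniteIntegral]
  simp only [h1]
  rw [lintegral_lam (measurable_wt q R).ennreal_ofReal]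
  have h2 : ∀ n, ∫⁻ x : Fin n → ℝ, ENNReal.ofReal (wt q R (points (word n x))) =
      ENNReal.ofReal ((∫ y : ℝ, (Icc (-R) R).indicator (fun _ => q) y) ^ n) := by
    intro n
    have hi : Integrable ((Icc (-R) R).indicator fun _ : ℝ => q) :=
      (integrable_indicator_iff measurableSet_Icc).2 (integrableOn_const (by simp))
    simp only [wt_points]
    rw [← ofReal_integral_eq_lintegral_ofReal]
    · rw [integral_fintype_prod_volume_eq_pow ((Icc (-R) R).indicator fun _ => q), Fintype.card_fin]
    · exact Integrable.fintype_prod (f := fun _ => (Icc (-R) R).indicator fun _ => q) fun _ => hi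
    · exact Eventually.of_forall fun x => Finset.prod_nonneg fun i _ =>
        indicator_nonneg (fun _ _ => hq) _
  simp only [h2]
  set I := ∫ y : ℝ, (Icc (-R) R).indicator (fun _ => q) y
  have hI : 0 ≤ I := integral_nonneg fun y => indicator_nonneg (fun _ _ => hq) _
  have h3 : ∀ n : ℕ, (n ! : ℝ≥0∞)⁻¹ * ENNReal.ofReal (I ^ n) = ENNReal.ofReal (I ^ n / n !) := by
    intro n
    have hn : (0 : ℝ) < n ! := by exact_mod_cast n.factorial_pos
    rw [ENNReal.ofReal_div_of_pos hn, ENNReal.ofReal_natCast, mul_comm, ENNReal.div_eq_inv_mul, mul_comm]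
  simp only [h3]
  rw [← ENNReal.ofReal_tsum_of_nonneg (fun n => by positivity) (Real.summable_pow_div_factorial I)]
  exact ENNReal.ofReal_lt_top

/-! ### The kernel and its last jump -/

section Kernel

variable {k : Type*} [NormedAddCommGroup k] [InnerProductSpace ℂ k]
  (A : SignType → (k →L[ℂ] k)) (B : k →L[ℂ] k)

/-- The semigroup `exp(t B)`. -/
noncomputable def expB (t : ℝ) : k →L[ℂ] k := NormedSpace.exp ((t : ℂ) • B)

/-- The recursive definition exposes the first jump; the evolution equation in the final time needs
the last one. -/
theorem orderedProduct_append (t s : ℝ) (l : List (ℝ ×ₗ SignType)) (p : ℝ ×ₗ SignType) :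
    orderedProduct A B t s (l ++ [p]) =
      expB B (t - (ofLex p).1) * A (ofLex p).2 * orderedProduct A B (ofLex p).1 s l := by
  induction l generalizing s with
  | nil => simp [orderedProduct, expB]
  | cons q l ih => 
    rw [List.cons_append, orderedProduct, ih, orderedProduct]
    simp only [mul_assoc]

open Classical in
/-- The kernel as a function of the marked configuration. -/
noncomputable def markedKernel (t s : ℝ) (m : Multiset (ℝ ×ₗ SignType)) : k →L[ℂ] k :=
  if (s :: (m.sort.map fun p => (ofLex p).1) ++ [t]).Pairwise (· < ·) then
    orderedProduct A B t s m.sort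
  else 0

theorem kernel_eq (t s : ℝ) (σ τ υ : Multiset ℝ) :
    kernel A B t s σ τ υ = markedKernel A B t s (marked σ τ υ) := rfl

theorem markedKernel_zero (t s : ℝ) :
    markedKernel A B t s 0 = if s < t then expB B (t - s) else 0 := by
  simp [markedKernel, orderedProduct, expB]

theorem markedKernel_eq_zero {t s : ℝ} {m : Multiset (ℝ ×ₗ SignType)} {p : ℝ ×ₗ SignType}
    (hp : p ∈ m) (h : ¬ (s < (ofLex p).1 ∧ (ofLex p).1 < t)) : markedKernel A B t s m = 0 := by
  rw [markedKernel, if_neg]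
  intro hc
  refine h ?_
  have hm : (ofLex p).1 ∈ m.sort.map fun p => (ofLex p).1 :=
    List.mem_map_of_mem (Multiset.mem_sort _ |>.2 hp)
  rw [List.pairwise_append, List.pairwise_cons] at hc
  exact ⟨hc.1.1 _ hm, hc.2.2 _ (List.mem_cons_of_mem _ hm) _ (List.mem_singleton_self t)⟩

/-- Splitting off the last point. -/
theorem markedKernel_peel (t s : ℝ) {m : Multiset (ℝ ×ₗ SignType)} (hm : m ≠ 0) :
    markedKernel A B t s m = (m.map fun p =>
      if s < (ofLex p).1 ∧ (ofLex p).1 < t then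
        expB B (t - (ofLex p).1) * A (ofLex p).2 * markedKernel A B (ofLex p).1 s (m.erase p)
      else 0).sum := by
  obtain ⟨l, p, hlp⟩ : ∃ l p, m.sort (· ≤ ·) = l ++ [p] := by
    rcases List.eq_nil_or_concat (m.sort (· ≤ ·)) with h | ⟨l, p, h⟩
    · exact absurd (by rw [← Multiset.sort_eq m (· ≤ ·), h]; rfl) hm
    · exact ⟨l, p, by simpa using h⟩
  have hsorted : (l ++ [p]).Pairwise (· ≤ ·) := hlp ▸ Multiset.pairwise_sort m (· ≤ ·)
  rw [List.pairwise_append] at hsorted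
  have hmp : m = p ::ₘ (l : Multiset (ℝ ×ₗ SignType)) := by
    rw [← Multiset.sort_eq m (· ≤ ·), hlp, Multiset.cons_coe, Multiset.coe_eq_coe]
    exact List.perm_append_singleton p l
  have hl : (l : Multiset (ℝ ×ₗ SignType)).sort (· ≤ ·) = l := by
    rw [Multiset.coe_sort]
    exact List.mergeSort_eq_self _ hsorted.1
  have hlast : ∀ q ∈ l, q ≤ p := fun q hq => hsorted.2.2 q hq p (List.mem_singleton_self p)
  -- Only the last point contributes to the sum: removing another q leaves p, whose time is not
  -- before that of q, so the kernel with final time q vanishes. Equal times are included, since the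
  -- kernel requires strict inequalities.
  have hrest : ∀ q ∈ (l : Multiset (ℝ ×ₗ SignType)), markedKernel A B (ofLex q).1 s (m.erase q) = 0 := by
    intro q hq
    have hpm : p ∈ m.erase q := by
      rw [hmp]
      rcases eq_or_ne p q with rfl | h
      · rwa [Multiset.erase_cons_head]
      · rw [Multiset.erase_cons_tail _ h]; exact Multiset.mem_cons_self _ _
    refine markedKernel_eq_zero A B hpm fun h => ?_
    have := hlast q (Multiset.mem_coe.1 hq)
    rw [Prod.Lex.le_iff] at this
    rcases this with h' | h'
    · exact lt_asymm h.2 h'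
    · exact h.2.ne' h'.1
  have hsum : ((l : Multiset (ℝ ×ₗ SignType)).map fun q =>
      if s < (ofLex q).1 ∧ (ofLex q).1 < t then
        expB B (t - (ofLex q).1) * A (ofLex q).2 * markedKernel A B (ofLex q).1 s (m.erase q)
      else 0).sum = 0 := by
    refine Multiset.sum_eq_zero fun x hx => ?_
    obtain ⟨q, hq, rfl⟩ := Multiset.mem_map.1 hx
    rw [hrest q hq, mul_zero, ite_self]
  have hstep : (m.map fun q =>
      if s < (ofLex q).1 ∧ (ofLex q).1 < t then
        expB B (t - (ofLex q).1) * A (ofLex q).2 * markedKernel A B (ofLex q).1 s (m.erase q)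
      else 0).sum = if s < (ofLex p).1 ∧ (ofLex p).1 < t then
        expB B (t - (ofLex p).1) * A (ofLex p).2 * markedKernel A B (ofLex p).1 s l
      else 0 := by
    conv_lhs => rw [hmp, Multiset.map_cons, Multiset.sum_cons, ← hmp, hsum, add_zero]
    rw [hmp, Multiset.erase_cons_head]
  rw [hstep, markedKernel, markedKernel, hlp, hl, orderedProduct_append]
  have hiff : (s :: ((l ++ [p]).map fun p => (ofLex p).1) ++ [t]).Pairwise (· < ·) ↔
      (s < (ofLex p).1 ∧ (ofLex p).1 < t) ∧
        (s :: (l.map fun p => (ofLex p).1) ++ [(ofLex p).1]).Pairwise (· < ·) := by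
    simp only [List.map_append, List.map_cons, List.map_nil, List.cons_append, List.pairwise_cons,
      List.pairwise_append, List.mem_append, List.mem_singleton, List.append_assoc]
    constructor
    · intro h; refine ⟨⟨?_, ?_⟩, ?_⟩ <;> grind
    · intro h; grind
  by_cases h1 : s < (ofLex p).1 ∧ (ofLex p).1 < t
  · rw [if_pos h1]
    by_cases h2 : (s :: (l.map fun p => (ofLex p).1) ++ [(ofLex p).1]).Pairwise (· < ·)
    · rw [if_pos h2, if_pos (hiff.2 ⟨h1, h2⟩)]
    · rw [if_neg h2, if_neg fun h => h2 (hiff.1 h).2, mul_zero]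
  · rw [if_neg h1, if_neg fun h => h1 (hiff.1 h).1]

end Kernel
end WhiteNoise

namespace WhiteNoise

section Kernel

variable {k : Type*} [NormedAddCommGroup k] [InnerProductSpace ℂ k]
  (A : SignType → (k →L[ℂ] k)) (B : k →L[ℂ] k)

theorem marked_cons_left (x : ℝ) (σ τ υ : Multiset ℝ) :
    marked (x ::ₘ σ) τ υ = toLex (x, 1) ::ₘ marked σ τ υ := by
  simp [marked, Multiset.cons_add]

theorem marked_cons_mid (x : ℝ) (σ τ υ : Multiset ℝ) :
    marked σ (x ::ₘ τ) υ = toLex (x, 0) ::ₘ marked σ τ υ := by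
  simp [marked, Multiset.cons_add, Multiset.add_cons]

theorem marked_cons_right (x : ℝ) (σ τ υ : Multiset ℝ) :
    marked σ τ (x ::ₘ υ) = toLex (x, -1) ::ₘ marked σ τ υ := by
  simp [marked, Multiset.add_cons]

theorem marked_eq_zero_iff (σ τ υ : Multiset ℝ) :
    marked σ τ υ = 0 ↔ σ = 0 ∧ τ = 0 ∧ υ = 0 := by
  simp [marked, and_assoc]

/-- The propagator after a jump at time `x`. -/
noncomputable def jump (t s x : ℝ) : k →L[ℂ] k :=
  if s < x ∧ x < t then expB B (t - x) else 0

/-- Splitting off the last point of the kernel. -/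
theorem kernel_peel (t s : ℝ) (σ τ υ : Multiset ℝ) :
    kernel A B t s σ τ υ =
      (if σ = 0 then if τ = 0 then if υ = 0 then if s < t then expB B (t - s) else 0
        else 0 else 0 else 0) +
      (psum (fun x σ' => jump B t s x * A 1 * kernel A B x s σ' τ υ) σ +
       psum (fun x τ' => jump B t s x * A 0 * kernel A B x s σ τ' υ) τ +
       psum (fun x υ' => jump B t s x * A (-1) * kernel A B x s σ τ υ') υ) := by
  by_cases h : marked σ τ υ = 0
  · obtain ⟨rfl, rfl, rfl⟩ := (marked_eq_zero_iff σ τ υ).1 h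
    rw [kernel_eq, h, markedKernel_zero]
    simp
  · have h' := h
    rw [marked_eq_zero_iff] at h'
    have h0 : (if σ = 0 then if τ = 0 then if υ = 0 then if s < t then expB B (t - s) else 0
        else 0 else 0 else 0) = (0 : k →L[ℂ] k) := by
      split_ifs <;> simp_all
    rw [h0, zero_add, kernel_eq, markedKernel_peel A B t s h]
    have hterm : ∀ (p : ℝ ×ₗ SignType), (if s < (ofLex p).1 ∧ (ofLex p).1 < t then
        expB B (t - (ofLex p).1) * A (ofLex p).2 *
          markedKernel A B (ofLex p).1 s ((marked σ τ υ).erase p) else 0) =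
        jump B t s (ofLex p).1 * A (ofLex p).2 *
          markedKernel A B (ofLex p).1 s ((marked σ τ υ).erase p) := by
      intro p
      rw [jump]
      split_ifs <;> simp
    simp only [hterm]
    conv_lhs => rw [marked]
    simp only [Multiset.map_add, Multiset.sum_add, Multiset.map_map, Function.comp_def, ofLex_toLex]
    have hσ : ∀ x ∈ σ, (marked σ τ υ).erase (toLex (x, 1)) = marked (σ.erase x) τ υ := by
      intro x hx
      conv_lhs => rw [← Multiset.cons_erase hx, marked_cons_left]
      rw [Multiset.erase_cons_head]
    have hτ : ∀ x ∈ τ, (marked σ τ υ).erase (toLex (x, 0)) = marked σ (τ.erase x) υ := by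
      intro x hx
      conv_lhs => rw [← Multiset.cons_erase hx, marked_cons_mid]
      rw [Multiset.erase_cons_head]
    have hυ : ∀ x ∈ υ, (marked σ τ υ).erase (toLex (x, -1)) = marked σ τ (υ.erase x) := by
      intro x hx
      conv_lhs => rw [← Multiset.cons_erase hx, marked_cons_right]
      rw [Multiset.erase_cons_head]
    simp only [psum, kernel_eq]
    congr 1
    · congr 1
      · refine congrArg _ (Multiset.map_congr rfl fun x hx => ?_)
        rw [← marked, hσ x hx]
      · refine congrArg _ (Multiset.map_congr rfl fun x hx => ?_)
        rw [← marked, hτ x hx]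
    · refine congrArg _ (Multiset.map_congr rfl fun x hx => ?_)
      rw [← marked, hυ x hx]

theorem mem_marked_left {x : ℝ} {σ τ υ : Multiset ℝ} (h : x ∈ σ) :
    toLex (x, (1 : SignType)) ∈ marked σ τ υ := by
  obtain ⟨σ', rfl⟩ := Multiset.exists_cons_of_mem h
  rw [marked_cons_left]; exact Multiset.mem_cons_self _ _

theorem mem_marked_mid {x : ℝ} {σ τ υ : Multiset ℝ} (h : x ∈ τ) :
    toLex (x, (0 : SignType)) ∈ marked σ τ υ := by
  obtain ⟨σ', rfl⟩ := Multiset.exists_cons_of_mem h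
  rw [marked_cons_mid]; exact Multiset.mem_cons_self _ _

theorem mem_marked_right {x : ℝ} {σ τ υ : Multiset ℝ} (h : x ∈ υ) :
    toLex (x, (-1 : SignType)) ∈ marked σ τ υ := by
  obtain ⟨σ', rfl⟩ := Multiset.exists_cons_of_mem h
  rw [marked_cons_right]; exact Multiset.mem_cons_self _ _

theorem kernel_cons_left {t s x : ℝ} (h : ¬ (s < x ∧ x < t)) (σ τ υ : Multiset ℝ) :
    kernel A B t s (x ::ₘ σ) τ υ = 0 :=
  markedKernel_eq_zero A B (mem_marked_left (Multiset.mem_cons_self x σ)) h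

theorem kernel_cons_mid {t s x : ℝ} (h : ¬ (s < x ∧ x < t)) (σ τ υ : Multiset ℝ) :
    kernel A B t s σ (x ::ₘ τ) υ = 0 :=
  markedKernel_eq_zero A B (mem_marked_mid (Multiset.mem_cons_self x τ)) h

theorem clm_mul_mul_apply (S T U : k →L[ℂ] k) (v : k) : (S * T * U) v = S (T (U v)) := rfl

theorem psum_apply (F : ℝ → Multiset ℝ → (k →L[ℂ] k)) (ω : Multiset ℝ) (v : k) :
    psum F ω v = psum (fun x ω' => F x ω' v) ω := by
  induction ω using Multiset.induction_on generalizing F with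
  | empty => simp
  | cons a ω ih => simp only [psum_cons, add_apply, ih]

/-! ### Translation covariance of the kernel -/

section Maps

theorem psum_map {E : Type*} [AddCommMonoid E] (e : ℝ → ℝ) (F : ℝ → Multiset ℝ → E)
    (ω : Multiset ℝ) : psum F (ω.map e) = psum (fun x ω' => F (e x) (ω'.map e)) ω := by
  induction ω using Multiset.induction_on generalizing F with
  | empty => simp
  | cons a ω ih => simp only [Multiset.map_cons, psum_cons, ih]

theorem asum_map {E : Type*} [AddCommMonoid E] (e : ℝ → ℝ) (F : Multiset ℝ → Multiset ℝ → E)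
    (ω : Multiset ℝ) : asum F (ω.map e) = asum (fun α β => F (α.map e) (β.map e)) ω := by
  induction ω using Multiset.induction_on generalizing F with
  | empty => simp
  | cons a ω ih => simp only [Multiset.map_cons, asum_cons, ih]

/-- Induction on the total number of points by splitting off the last one; the final time varies
because the remaining kernel ends at the removed point. -/
theorem kernel_shift_aux (r s : ℝ) (n : ℕ) : ∀ (t : ℝ) (σ τ υ : Multiset ℝ),
    σ.card + τ.card + υ.card = n →
    kernel A B t s (shift r σ) (shift r τ) (shift r υ) = kernel A B (t - r) (s - r) σ τ υ := by
  induction n using Nat.strong_induction_on with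
  | _ n ih =>
    intro t σ τ υ hn
    have hj : ∀ x, jump B t s (x + r) = jump B (t - r) (s - r) x := by
      intro x
      have h1 : s < x + r ∧ x + r < t ↔ s - r < x ∧ x < t - r := by
        constructor <;> rintro ⟨h1, h2⟩ <;> constructor <;> linarith
      simp only [jump, h1, sub_add_eq_sub_sub_swap]
    have hts : s < t ↔ s - r < t - r := by simp
    rw [kernel_peel, kernel_peel A B (t - r)]
    simp only [shift, psum_map, Multiset.map_eq_zero, hj, sub_sub_sub_cancel_right,
      sub_lt_sub_iff_right]
    congr 1
    congr 1
    · congr 1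
      · refine psum_congr ?_
        rintro x σ' rfl
        have := ih _ (by simp at hn; omega) (x + r) σ' τ υ rfl
        rw [add_sub_cancel_right] at this
        rw [← this]; rfl
      · refine psum_congr ?_
        rintro x τ' rfl
        have := ih _ (by simp at hn; omega) (x + r) σ τ' υ rfl
        rw [add_sub_cancel_right] at this
        rw [← this]; rfl
    · refine psum_congr ?_
      rintro x υ' rfl
      have := ih _ (by simp at hn; omega) (x + r) σ τ υ' rfl
      rw [add_sub_cancel_right] at this
      rw [← this]; rfl

theorem kernel_shift (r t s : ℝ) (σ τ υ : Multiset ℝ) :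
    kernel A B t s (shift r σ) (shift r τ) (shift r υ) = kernel A B (t - r) (s - r) σ τ υ :=
  kernel_shift_aux A B r s _ t σ τ υ rfl

end Maps

/-! ### Bounds and joint measurability of the kernel -/

section Complete

variable [CompleteSpace k]

theorem continuous_expB : Continuous (expB B) := by
  unfold expB
  have : NormedAlgebra ℚ (k →L[ℂ] k) := NormedAlgebra.restrictScalars ℚ ℂ (k →L[ℂ] k)
  have h : Continuous fun t : ℝ => (t : ℂ) • B := by fun_prop
  exact NormedSpace.exp_continuous.comp h

theorem norm_exp_clm_le (T : k →L[ℂ] k) : ‖NormedSpace.exp T‖ ≤ Real.exp ‖T‖ := by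
  rw [NormedSpace.exp_eq_tsum (𝕂 := ℂ)]
  refine tsum_of_norm_bounded (g := fun n : ℕ => ‖T‖ ^ n / n !) ?_ fun n => ?_
  · rw [Real.exp_eq_exp_ℝ]
    exact NormedSpace.expSeries_div_hasSum_exp ‖T‖
  · rw [norm_smul, norm_inv, div_eq_inv_mul]
    simp only [Complex.norm_natCast]
    refine mul_le_mul_of_nonneg_left ?_ (by positivity)
    -- The zeroth power is separate: only ‖1‖ ≤ 1 holds, since the space may be trivial.
    cases n with
    | zero =>
      have h : ‖(1 : k →L[ℂ] k)‖ ≤ 1 := ContinuousLinearMap.norm_id_le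
      simpa using h
    | succ n => exact norm_pow_le' T n.succ_pos

theorem norm_expB_le {t : ℝ} (ht : 0 ≤ t) : ‖expB B t‖ ≤ Real.exp (t * ‖B‖) := by
  refine (norm_exp_clm_le _).trans (Real.exp_le_exp.2 ?_)
  rw [norm_smul, Complex.norm_real, Real.norm_of_nonneg ht]

theorem norm_orderedProduct_le {C : ℝ} (hC : ∀ i, ‖A i‖ ≤ C) {t : ℝ} (l : List (ℝ ×ₗ SignType)) :
    ∀ s : ℝ, (s :: (l.map fun p => (ofLex p).1) ++ [t]).Pairwise (· < ·) →
      ‖orderedProduct A B t s l‖ ≤ Real.exp ((t - s) * ‖B‖) * C ^ l.length := by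
  have hC0 : 0 ≤ C := (norm_nonneg _).trans (hC 0)
  induction l with
  | nil =>
    intro s h
    have : s < t := by simpa using h
    rw [List.length_nil, pow_zero, mul_one]
    exact norm_expB_le B (sub_nonneg.2 this.le)
  | cons p l ih =>
    intro s h
    rw [List.map_cons, List.cons_append, List.pairwise_cons] at h
    have h1 := ih _ h.2
    have hsp : s < (ofLex p).1 := h.1 _ (by simp)
    have h2 := norm_expB_le B (sub_nonneg.2 hsp.le)
    rw [orderedProduct]
    calc _ ≤ ‖orderedProduct A B t (ofLex p).1 l‖ * ‖A (ofLex p).2‖ * ‖expB B ((ofLex p).1 - s)‖ :=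
          (norm_mul_le _ _).trans (mul_le_mul_of_nonneg_right (norm_mul_le _ _) (norm_nonneg _))
      _ ≤ (Real.exp ((t - (ofLex p).1) * ‖B‖) * C ^ l.length) * C * Real.exp (((ofLex p).1 - s) * ‖B‖) := by
          gcongr
          exact hC _
      _ = Real.exp ((t - s) * ‖B‖) * C ^ (p :: l).length := by
          rw [List.length_cons, pow_succ, show (t - s) * ‖B‖ =
            (t - (ofLex p).1) * ‖B‖ + ((ofLex p).1 - s) * ‖B‖ by ring, Real.exp_add]
          ring

theorem wt_eq_pow {q R : ℝ} {ω : Multiset ℝ} (h : ∀ x ∈ ω, x ∈ Icc (-R) R) :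
    wt q R ω = q ^ ω.card := by
  induction ω using Multiset.induction_on with
  | empty => simp
  | cons a ω ih =>
    rw [wt_cons, ih fun x hx => h x (Multiset.mem_cons_of_mem hx),
      indicator_of_mem (h a (Multiset.mem_cons_self _ _)), Multiset.card_cons, pow_succ, mul_comm]

/-- The kernel vanishes unless all points lie in ]s, t[ ⊆ [-R, R]. There each point costs one factor
C, and the exponential bounds multiply to exp((t - s)‖B‖), with t - s ≤ 2R. -/
theorem norm_kernel_le {C : ℝ} (hC : ∀ i, ‖A i‖ ≤ C) {R t s : ℝ} (hs : -R ≤ s) (ht : t ≤ R)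
    (σ τ υ : Multiset ℝ) :
    ‖kernel A B t s σ τ υ‖ ≤ Real.exp (2 * R * ‖B‖) * (wt C R σ * wt C R τ * wt C R υ) := by
  have hC0 : 0 ≤ C := (norm_nonneg _).trans (hC 0)
  rw [kernel_eq]
  by_cases h : (s :: ((marked σ τ υ).sort.map fun p => (ofLex p).1) ++ [t]).Pairwise (· < ·)
  · have hI : ∀ p ∈ marked σ τ υ, (ofLex p).1 ∈ Icc (-R) R := by
      intro p hp
      have hm : (ofLex p).1 ∈ (marked σ τ υ).sort.map fun p => (ofLex p).1 :=
        List.mem_map_of_mem (Multiset.mem_sort _ |>.2 hp)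
      rw [List.pairwise_append, List.pairwise_cons] at h
      exact ⟨hs.trans (h.1.1 _ hm).le,
        (h.2.2 _ (List.mem_cons_of_mem _ hm) _ (List.mem_singleton_self t)).le.trans ht⟩
    rw [wt_eq_pow fun x hx => hI _ (mem_marked_left hx), wt_eq_pow fun x hx => hI _ (mem_marked_mid hx),
      wt_eq_pow fun x hx => hI _ (mem_marked_right hx), ← pow_add, ← pow_add]
    have hst : s < t := by
      rw [List.pairwise_append] at h
      exact h.2.2 _ List.mem_cons_self _ (List.mem_singleton_self t)
    rw [markedKernel, if_pos h]
    refine (norm_orderedProduct_le A B hC _ _ h).trans ?_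
    rw [Multiset.length_sort]
    have hcard : (marked σ τ υ).card = σ.card + τ.card + υ.card := by simp [marked]
    rw [hcard]
    gcongr
    linarith
  · rw [markedKernel, if_neg h, norm_zero]
    have := fun ω => wt_nonneg hC0 R ω
    exact mul_nonneg (Real.exp_pos _).le (mul_nonneg (mul_nonneg (this _) (this _)) (this _))

section Measurability

variable [MeasurableSpace k] [BorelSpace k] [SecondCountableTopology k]

theorem measurable_expB_apply : Measurable fun p : ℝ × k => expB B p.1 p.2 :=
  (((continuous_expB B).comp continuous_fst).clm_apply continuous_snd).measurable

theorem measurable_jump_apply (s : ℝ) :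
    Measurable fun p : (ℝ × ℝ) × k => jump B p.1.1 s p.1.2 p.2 := by
  have : ∀ p : (ℝ × ℝ) × k, jump B p.1.1 s p.1.2 p.2 =
      if s < p.1.2 ∧ p.1.2 < p.1.1 then expB B (p.1.1 - p.1.2) p.2 else 0 := by
    intro p
    rw [jump]
    split_ifs <;> simp
  simp only [this]
  refine Measurable.ite ?_ ?_ measurable_const
  · exact (measurableSet_lt (measurable_const (a := s))
        (by fun_prop : Measurable fun p : (ℝ × ℝ) × k => p.1.2)).inter
      (measurableSet_lt (by fun_prop : Measurable fun p : (ℝ × ℝ) × k => p.1.2)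
        (by fun_prop : Measurable fun p : (ℝ × ℝ) × k => p.1.1))
  · exact (measurable_expB_apply B).comp
      (f := fun p : (ℝ × ℝ) × k => (p.1.1 - p.1.2, p.2)) (by fun_prop)

/-- Recursion on the number of points through `kernel_peel`, which avoids the measurability of
sorting marked points. Measurability must be joint in the final time, because the recursion
evaluates the shorter kernel at the last jump time. -/
theorem exists_measurable_kernel (s : ℝ) (n : ℕ) :
    ∃ G : (ℝ × Multiset ℝ × Multiset ℝ × Multiset ℝ) × k → k, Measurable G ∧
      ∀ t σ τ υ v, σ.card + τ.card + υ.card = n →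
        kernel A B t s σ τ υ v = G ((t, σ, τ, υ), v) := by
  induction n with
  | zero =>
    refine ⟨fun p => if s < p.1.1 then expB B (p.1.1 - s) p.2 else 0, ?_, ?_⟩
    · refine Measurable.ite (measurableSet_lt (by fun_prop) (by fun_prop)) ?_ measurable_const
      exact (measurable_expB_apply B).comp
        (f := fun p : (ℝ × Multiset ℝ × Multiset ℝ × Multiset ℝ) × k => (p.1.1 - s, p.2)) (by fun_prop)
    · intro t σ τ υ v h
      obtain rfl : σ = 0 := Multiset.card_eq_zero.1 (by omega)
      obtain rfl : τ = 0 := Multiset.card_eq_zero.1 (by omega)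
      obtain rfl : υ = 0 := Multiset.card_eq_zero.1 (by omega)
      rw [kernel_peel]
      simp only [if_true, psum_zero, add_zero]
      split_ifs <;> simp
  | succ n ih =>
    obtain ⟨G, hG, hGk⟩ := ih
    have hj : ∀ i : SignType, Measurable fun p : (ℝ × ℝ) × k => jump B p.1.1 s p.1.2 (A i p.2) :=
      fun i => (measurable_jump_apply B s).comp
        (f := fun p : (ℝ × ℝ) × k => (p.1, A i p.2)) (by fun_prop)
    refine ⟨fun p =>
      psum (fun x σ' => jump B p.1.1 s x (A 1 (G ((x, σ', p.1.2.2.1, p.1.2.2.2), p.2)))) p.1.2.1 +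
      psum (fun x τ' => jump B p.1.1 s x (A 0 (G ((x, p.1.2.1, τ', p.1.2.2.2), p.2)))) p.1.2.2.1 +
      psum (fun x υ' => jump B p.1.1 s x (A (-1) (G ((x, p.1.2.1, p.1.2.2.1, υ'), p.2)))) p.1.2.2.2,
      ?_, ?_⟩
    · have hmeas : ∀ (i : SignType)
          (a b c : (((ℝ × Multiset ℝ × Multiset ℝ × Multiset ℝ) × k) × ℝ × Multiset ℝ) → Multiset ℝ),
          Measurable a → Measurable b → Measurable c →
          ∀ d : (ℝ × Multiset ℝ × Multiset ℝ × Multiset ℝ) × k → Multiset ℝ, Measurable d →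
          Measurable fun p : (ℝ × Multiset ℝ × Multiset ℝ × Multiset ℝ) × k =>
            psum (fun x ω => jump B p.1.1 s x
              (A i (G ((x, a (p, x, ω), b (p, x, ω), c (p, x, ω)), p.2)))) (d p) := by
        intro i a b c ha hb hc d hd
        refine (measurable_psum (F := fun (p : (ℝ × Multiset ℝ × Multiset ℝ × Multiset ℝ) × k) x ω =>
          jump B p.1.1 s x (A i (G ((x, a (p, x, ω), b (p, x, ω), c (p, x, ω)), p.2)))) ?_).comp
          (measurable_id.prodMk hd)
        refine (hj i).comp (f := fun p : ((ℝ × Multiset ℝ × Multiset ℝ × Multiset ℝ) × k) × ℝ × Multiset ℝ =>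
          ((p.1.1.1, p.2.1), G ((p.2.1, a p, b p, c p), p.1.2))) ?_
        refine Measurable.prodMk (by fun_prop) (hG.comp ?_)
        exact Measurable.prodMk (Measurable.prodMk (by fun_prop) (ha.prodMk (hb.prodMk hc))) (by fun_prop)
      refine Measurable.add (Measurable.add ?_ ?_) ?_
      · exact hmeas 1 (fun p => p.2.2) (fun p => p.1.1.2.2.1) (fun p => p.1.1.2.2.2) (by fun_prop)
          (by fun_prop) (by fun_prop) (fun p => p.1.2.1) (by fun_prop)
      · exact hmeas 0 (fun p => p.1.1.2.1) (fun p => p.2.2) (fun p => p.1.1.2.2.2) (by fun_prop)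
          (by fun_prop) (by fun_prop) (fun p => p.1.2.2.1) (by fun_prop)
      · exact hmeas (-1) (fun p => p.1.1.2.1) (fun p => p.1.1.2.2.1) (fun p => p.2.2) (by fun_prop)
          (by fun_prop) (by fun_prop) (fun p => p.1.2.2.2) (by fun_prop)
    · intro t σ τ υ v h
      have h0 : (if σ = 0 then if τ = 0 then if υ = 0 then if s < t then expB B (t - s) else 0
          else 0 else 0 else 0) = (0 : k →L[ℂ] k) := by
        split_ifs <;> simp_all
      rw [kernel_peel, h0, zero_add]
      simp only [add_apply, psum_apply, clm_mul_mul_apply]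
      congr 1
      · congr 1
        · refine psum_congr ?_
          rintro x σ' rfl
          rw [hGk x σ' τ υ v (by simp at h; omega)]
        · refine psum_congr ?_
          rintro x τ' rfl
          rw [hGk x σ τ' υ v (by simp at h; omega)]
      · refine psum_congr ?_
        rintro x υ' rfl
        rw [hGk x σ τ υ' v (by simp at h; omega)]

/-- The measurable versions for the different numbers of points are glued along the countable value
of the total number. -/
theorem measurable_kernel_apply (s : ℝ) :
    Measurable fun p : (ℝ × Multiset ℝ × Multiset ℝ × Multiset ℝ) × k =>
      kernel A B p.1.1 s p.1.2.1 p.1.2.2.1 p.1.2.2.2 p.2 := by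
  choose G hG hGk using exists_measurable_kernel A B s
  have h1 : Measurable fun q : ((ℝ × Multiset ℝ × Multiset ℝ × Multiset ℝ) × k) × ℕ => G q.2 q.1 :=
    measurable_from_prod_countable_left hG
  have hN : Measurable fun p : (ℝ × Multiset ℝ × Multiset ℝ × Multiset ℝ) × k =>
      p.1.2.1.card + p.1.2.2.1.card + p.1.2.2.2.card := by
    have h := measurable_card
    exact ((h.comp (by fun_prop)).add (h.comp (by fun_prop))).add (h.comp (by fun_prop))
  have := h1.comp (measurable_id.prodMk hN)
  simp only [hGk _ _ _ _ _ _ rfl]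
  exact this

end Measurability

end Complete

end Kernel
end WhiteNoise

namespace WhiteNoise

/-! ### Adjoint and time reversal of the kernel -/

section Reversal

variable {k : Type*} [NormedAddCommGroup k] [InnerProductSpace ℂ k] [CompleteSpace k]
  (A : SignType → (k →L[ℂ] k)) (B : k →L[ℂ] k)

/-- The coefficients of the adjoint evolution. -/
noncomputable def adjCoeff : SignType → (k →L[ℂ] k) := fun i => star (A (-i))

/-- Time reversal of marked points. -/
def revMark (p : ℝ ×ₗ SignType) : ℝ ×ₗ SignType := toLex (-(ofLex p).1, -(ofLex p).2)

theorem revMark_le {p q : ℝ ×ₗ SignType} (h : p ≤ q) : revMark q ≤ revMark p := by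
  rw [Prod.Lex.le_iff] at h ⊢
  rcases h with h | ⟨h1, h2⟩
  · exact Or.inl (neg_lt_neg h)
  · refine Or.inr ⟨congrArg Neg.neg h1.symm, ?_⟩
    simp only [revMark, ofLex_toLex]
    revert h2
    generalize (ofLex p).2 = a
    generalize (ofLex q).2 = b
    revert a b
    decide

theorem sort_map_revMark (m : Multiset (ℝ ×ₗ SignType)) :
    (m.map revMark).sort (· ≤ ·) = (m.sort (· ≤ ·)).reverse.map revMark := by
  refine List.Perm.eq_of_pairwise' (r := (· ≤ ·)) (Multiset.pairwise_sort _ _) ?_ ?_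
  · rw [List.pairwise_map, List.pairwise_reverse]
    exact (Multiset.pairwise_sort m (· ≤ ·)).imp revMark_le
  · rw [← Multiset.coe_eq_coe, Multiset.sort_eq, ← Multiset.map_coe, Multiset.coe_reverse,
      Multiset.sort_eq]

theorem star_expB (t : ℝ) : star (expB B t) = expB (star B) t := by
  rw [expB, expB, NormedSpace.star_exp, star_smul]
  simp

/-- Taking adjoints reverses the factors; reflecting time restores the increasing order, and the
marks change sign since adjoints exchange creation and annihilation. -/
theorem star_orderedProduct (t s : ℝ) (l : List (ℝ ×ₗ SignType)) :
    star (orderedProduct A B t s l) =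
      orderedProduct (adjCoeff A) (star B) (-s) (-t) (l.reverse.map revMark) := by
  induction l generalizing s with
  | nil =>
    simp only [orderedProduct, List.reverse_nil, List.map_nil]
    rw [sub_neg_eq_add, neg_add_eq_sub]
    exact star_expB B (t - s)
  | cons p l ih =>
    rw [List.reverse_cons, List.map_append, List.map_cons, List.map_nil, orderedProduct_append,
      orderedProduct, star_mul, star_mul, ih, ← mul_assoc]
    have h : -s - (ofLex (revMark p)).1 = (ofLex p).1 - s := by
      simp [revMark]; ring
    rw [h]
    congr 1
    congr 1
    · exact star_expB B _
    · simp [adjCoeff, revMark]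

theorem star_markedKernel (t s : ℝ) (m : Multiset (ℝ ×ₗ SignType)) :
    star (markedKernel A B t s m) =
      markedKernel (adjCoeff A) (star B) (-s) (-t) (m.map revMark) := by
  rw [markedKernel, markedKernel, sort_map_revMark]
  have h : (-t :: ((m.sort.reverse.map revMark).map fun p => (ofLex p).1) ++ [-s]).Pairwise (· < ·) ↔
      (s :: (m.sort.map fun p => (ofLex p).1) ++ [t]).Pairwise (· < ·) := by
    have : -t :: ((m.sort.reverse.map revMark).map fun p => (ofLex p).1) ++ [-s] =
        (s :: (m.sort.map fun p => (ofLex p).1) ++ [t]).reverse.map Neg.neg := by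
      simp [revMark, Function.comp_def]
    rw [this, List.pairwise_map, List.pairwise_reverse]
    simp only [neg_lt_neg_iff]
  by_cases h1 : (s :: (m.sort.map fun p => (ofLex p).1) ++ [t]).Pairwise (· < ·)
  · rw [if_pos h1, if_pos (h.2 h1), star_orderedProduct]
  · rw [if_neg h1, if_neg (mt h.1 h1), star_zero]

/-- The adjoint of a kernel is the time reversed kernel of the adjoint coefficients. -/
theorem star_kernel (t s : ℝ) (σ τ υ : Multiset ℝ) :
    star (kernel A B t s σ τ υ) = kernel (adjCoeff A) (star B) (-s) (-t)
      (υ.map Neg.neg) (τ.map Neg.neg) (σ.map Neg.neg) := by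
  rw [kernel_eq, kernel_eq, star_markedKernel]
  congr 1
  simp only [marked, Multiset.map_add, Multiset.map_map, Function.comp_def, revMark, ofLex_toLex]
  have h1 : -(1 : SignType) = -1 := rfl
  have h0 : -(0 : SignType) = 0 := rfl
  have hm : -(-1 : SignType) = 1 := rfl
  rw [h1, h0, hm]
  abel

end Reversal

/-! ### The kernel as a solution of an integral equation in its final time -/

section IntegralEquation

variable {k : Type*} [NormedAddCommGroup k] [InnerProductSpace ℂ k]
  (A : SignType → (k →L[ℂ] k)) (B : k →L[ℂ] k)

/-- `f t = j + ∫_s^t B f(r) dr`. -/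
structure IntegralSolution (s t : ℝ) (f : ℝ → k) (j : k) : Prop where
  integrableOn : IntegrableOn (fun r => B (f r)) (Ioo s t)
  eq : f t = j + ∫ r in Ioo s t, B (f r)

variable {B}

theorem IntegralSolution.add {s t : ℝ} {f g : ℝ → k} {i j : k} (hf : IntegralSolution B s t f i)
    (hg : IntegralSolution B s t g j) : IntegralSolution B s t (fun r => f r + g r) (i + j) := by
  refine ⟨?_, ?_⟩
  · simp only [map_add]
    exact hf.integrableOn.add hg.integrableOn
  · simp only [map_add]
    rw [integral_add hf.integrableOn hg.integrableOn, hf.eq, hg.eq]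
    abel

theorem IntegralSolution.zero (s t : ℝ) : IntegralSolution B s t (fun _ => 0) 0 :=
  ⟨by simp, by simp⟩

theorem IntegralSolution.psum {s t : ℝ} {f : ℝ → ℝ → Multiset ℝ → k} {j : ℝ → Multiset ℝ → k}
    (h : ∀ x ω, IntegralSolution B s t (fun r => f r x ω) (j x ω)) (ω : Multiset ℝ) :
    IntegralSolution B s t (fun r => psum (f r) ω) (psum j ω) := by
  induction ω using Multiset.induction_on generalizing f j with
  | empty => simpa using IntegralSolution.zero s t
  | cons a ω ih =>
    simp only [psum_cons]
    exact (h a ω).add (ih fun x ω' => h x _)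

variable [CompleteSpace k] (B)

theorem hasDerivAt_expB (x r : ℝ) (v : k) :
    HasDerivAt (fun r => expB B (r - x) v) (B (expB B (r - x) v)) r := by
  have h1 : HasDerivAt (fun r : ℝ => ((r - x : ℝ) : ℂ)) 1 r :=
    ((hasDerivAt_id r).sub_const x).ofReal_comp
  have h2 := (hasDerivAt_exp_smul_const' (𝕂 := ℂ) B ((r - x : ℝ) : ℂ)).scomp r h1
  rw [one_smul] at h2
  have h3 := ((ContinuousLinearMap.apply ℂ k v).restrictScalars ℝ).hasFDerivAt.comp_hasDerivAt r h2
  exact h3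

/-- The fundamental theorem of calculus for a solution of f' = B f that starts at time x with value
v and is zero before. -/
theorem integralSolution_exp {s t x : ℝ} (hx : s ≤ x) (v : k) :
    IntegralSolution B s t (fun r => if x < r then expB B (r - x) v else 0)
      (if x < t then v else 0) := by
  have hB : ∀ r, B (if x < r then expB B (r - x) v else 0) =
      (Ioi x).indicator (fun r => B (expB B (r - x) v)) r := by
    intro r
    by_cases h : x < r
    · rw [if_pos h, indicator_of_mem (mem_Ioi.2 h)]
    · rw [if_neg h, indicator_of_notMem (by simpa using h), map_zero]
  have hcont : Continuous fun r => B (expB B (r - x) v) :=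
    B.continuous.comp (((continuous_expB B).comp (by fun_prop)).clm_apply continuous_const)
  have hint : IntegrableOn (fun r => B (expB B (r - x) v)) (Ioo s t) :=
    (hcont.continuousOn.integrableOn_Icc (a := s) (b := t)).mono_set Ioo_subset_Icc_self
  refine ⟨?_, ?_⟩
  · simp only [hB]
    exact hint.indicator measurableSet_Ioi
  · simp only [hB]
    rw [setIntegral_indicator measurableSet_Ioi]
    have hset : Ioo s t ∩ Ioi x = Ioo x t := by
      ext r; simp only [mem_inter_iff, mem_Ioo, mem_Ioi]
      constructor
      · rintro ⟨⟨_, h2⟩, h3⟩; exact ⟨h3, h2⟩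
      · rintro ⟨h1, h2⟩; exact ⟨⟨hx.trans_lt h1, h2⟩, h1⟩
    rw [hset]
    by_cases h : x < t
    · rw [if_pos h, if_pos h, ← integral_Ioc_eq_integral_Ioo, ← intervalIntegral.integral_of_le h.le,
        intervalIntegral.integral_eq_sub_of_hasDerivAt (f := fun r => expB B (r - x) v)
          (fun r _ => hasDerivAt_expB B x r v) (hcont.intervalIntegrable _ _)]
      have : expB B (x - x) v = v := by simp [expB]
      rw [this]
      abel
    · rw [if_neg h, if_neg h, Ioo_eq_empty h]
      simp

theorem integralSolution_jump (s t x : ℝ) (v : k) :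
    IntegralSolution B s t (fun r => jump B r s x v) (if s < x ∧ x < t then v else 0) := by
  by_cases hx : s < x
  · have := integralSolution_exp B (t := t) hx.le v
    convert this using 2
    · rw [jump]; split_ifs <;> simp_all
    · simp [hx]
  · convert IntegralSolution.zero s t using 2
    · rw [jump, if_neg fun h => hx h.1]; simp
    · rw [if_neg fun h => hx h.1]

/-- The integral equation for the kernel. -/
theorem integralSolution_kernel {s t : ℝ} (hst : s < t) (σ τ υ : Multiset ℝ) (v : k) :
    IntegralSolution B s t (fun r => kernel A B r s σ τ υ v)
      ((if σ = 0 then if τ = 0 then if υ = 0 then v else 0 else 0 else 0) +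
      (psum (fun x σ' => if s < x ∧ x < t then A 1 (kernel A B x s σ' τ υ v) else 0) σ +
       psum (fun x τ' => if s < x ∧ x < t then A 0 (kernel A B x s σ τ' υ v) else 0) τ +
       psum (fun x υ' => if s < x ∧ x < t then A (-1) (kernel A B x s σ τ υ' v) else 0) υ)) := by
  -- After peeling, each summand depends on the final time only through a propagator started at its
  -- last jump; the equation is linear, so the summands are treated separately. The term without
  -- jumps starts at s.
  simp only [kernel_peel A B _ s σ τ υ, add_apply, psum_apply, clm_mul_mul_apply]
  refine IntegralSolution.add ?_ (IntegralSolution.add (IntegralSolution.add ?_ ?_) ?_)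
  · by_cases h : σ = 0 ∧ τ = 0 ∧ υ = 0
    · obtain ⟨rfl, rfl, rfl⟩ := h
      have h := integralSolution_exp B (t := t) (le_refl s) v
      rw [if_pos hst] at h
      simp only [if_true]
      convert h using 2
      split_ifs <;> simp
    · have h1 : ∀ a b : k →L[ℂ] k, (if σ = 0 then if τ = 0 then if υ = 0 then a else 0 else 0 else 0) =
          (0 : k →L[ℂ] k) := by
        intro a b; split_ifs <;> simp_all
      have h2 : (if σ = 0 then if τ = 0 then if υ = 0 then v else 0 else 0 else 0) = 0 := by
        split_ifs <;> simp_all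
      simp only [h1 _ 0, h2]
      simpa using IntegralSolution.zero s t
  · exact IntegralSolution.psum (fun x σ' => integralSolution_jump B s t x _) σ
  · exact IntegralSolution.psum (fun x σ' => integralSolution_jump B s t x _) τ
  · exact IntegralSolution.psum (fun x σ' => integralSolution_jump B s t x _) υ

end IntegralEquation

end WhiteNoise

namespace WhiteNoise

universe u

/-! ### Interchange rules for sums and integrals -/

section Sums

variable {E : Type*} [AddCommMonoid E]

theorem asum_psum_comm (F : Multiset ℝ → Multiset ℝ → ℝ → Multiset ℝ → E) (α ρ : Multiset ℝ) :
    asum (fun β γ => psum (F β γ) α) ρ = psum (fun x α' => asum (fun β γ => F β γ x α') ρ) α := by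
  induction α using Multiset.induction_on generalizing F with
  | empty => simp [asum]
  | cons a α ih => simp only [psum_cons, asum_add, ih]

theorem map_asum {E' G : Type*} [AddCommMonoid E'] [FunLike G E E'] [AddMonoidHomClass G E E']
    (L : G) (F : Multiset ℝ → Multiset ℝ → E) (ω : Multiset ℝ) :
    L (asum F ω) = asum (fun α β => L (F α β)) ω := by
  induction ω using Multiset.induction_on generalizing F with
  | empty => simp
  | cons a ω ih => simp only [asum_cons, map_add, ih]

theorem asum_ite (c : Prop) [Decidable c] (F : Multiset ℝ → Multiset ℝ → E) (ω : Multiset ℝ) :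
    asum (fun α β => if c then F α β else 0) ω = if c then asum F ω else 0 := by
  split_ifs
  · rfl
  · simp [asum]

theorem asum_mono {F G : Multiset ℝ → Multiset ℝ → ℝ} (h : ∀ α β, F α β ≤ G α β) (ω : Multiset ℝ) :
    asum F ω ≤ asum G ω := by
  induction ω using Multiset.induction_on generalizing F G with
  | empty => simpa using h 0 0
  | cons a ω ih => simp only [asum_cons]; exact add_le_add (ih fun _ _ => h _ _) (ih fun _ _ => h _ _)

theorem norm_asum_le {E : Type*} [SeminormedAddCommGroup E] (F : Multiset ℝ → Multiset ℝ → E)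
    (ω : Multiset ℝ) : ‖asum F ω‖ ≤ asum (fun α β => ‖F α β‖) ω := by
  induction ω using Multiset.induction_on generalizing F with
  | empty => simp
  | cons a ω ih => simp only [asum_cons]; exact (norm_add_le _ _).trans (add_le_add (ih _) (ih _))

variable {E : Type*} [NormedAddCommGroup E] [NormedSpace ℝ E] {X : Type*} [MeasurableSpace X]
  {μ : Measure X}

theorem integral_asum_comm {F : X → Multiset ℝ → Multiset ℝ → E}
    (hF : ∀ α β, Integrable (fun x => F x α β) μ) (ω : Multiset ℝ) :
    Integrable (fun x => asum (F x) ω) μ ∧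
      ∫ x, asum (F x) ω ∂μ = asum (fun α β => ∫ x, F x α β ∂μ) ω := by
  induction ω using Multiset.induction_on generalizing F with
  | empty => simpa using hF 0 0
  | cons a ω ih =>
    have h1 := ih (F := fun x α β => F x α (a ::ₘ β)) fun _ _ => hF _ _
    have h2 := ih (F := fun x α β => F x (a ::ₘ α) β) fun _ _ => hF _ _
    simp only [asum_cons]
    exact ⟨h1.1.add h2.1, by rw [integral_add h1.1 h2.1, h1.2, h2.2]⟩

theorem integral_psum_comm {F : X → ℝ → Multiset ℝ → E}
    (hF : ∀ α β, Integrable (fun x => F x α β) μ) (ω : Multiset ℝ) :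
    Integrable (fun x => psum (F x) ω) μ ∧
      ∫ x, psum (F x) ω ∂μ = psum (fun α β => ∫ x, F x α β ∂μ) ω := by
  induction ω using Multiset.induction_on generalizing F with
  | empty => simp
  | cons a ω ih =>
    have h1 := ih (F := fun x α β => F x α (a ::ₘ β)) fun _ _ => hF _ _
    simp only [psum_cons]
    exact ⟨(hF a ω).add h1.1, by rw [integral_add (hF a ω) h1.1, h1.2]⟩

end Sums

/-! ### Dominated functions and the bound for the evolution -/

section Dominated

variable {k : Type*} [NormedAddCommGroup k] [MeasurableSpace k]

/-- Measurable functions dominated by a multiple of a weight. -/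
structure Dominated (D q R : ℝ) (g : Multiset ℝ → k) : Prop where
  measurable : Measurable g
  D_nonneg : 0 ≤ D
  q_nonneg : 0 ≤ q
  bound : ∀ ω, ‖g ω‖ ≤ D * wt q R ω

theorem Dominated.mono {D q R D' q' R' : ℝ} {g : Multiset ℝ → k} (hg : Dominated D q R g)
    (hD : D ≤ D') (hq : q ≤ q') (hR : R ≤ R') : Dominated D' q' R' g :=
  ⟨hg.measurable, hg.D_nonneg.trans hD, hg.q_nonneg.trans hq, fun ω => (hg.bound ω).trans
    (mul_le_mul hD (wt_mono hg.q_nonneg hq hR ω) (wt_nonneg hg.q_nonneg R ω)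
      (hg.D_nonneg.trans hD))⟩

theorem Dominated.cons {D q R : ℝ} {g : Multiset ℝ → k} (hg : Dominated D q R g) (x : ℝ) :
    Dominated (D * q) q R fun ω => g (x ::ₘ ω) := by
  refine ⟨hg.measurable.comp (Measurable.multiset_cons measurable_const measurable_id),
    mul_nonneg hg.D_nonneg hg.q_nonneg, hg.q_nonneg, fun ω => (hg.bound _).trans ?_⟩
  rw [wt_cons, ← mul_assoc]
  refine mul_le_mul_of_nonneg_right ?_ (wt_nonneg hg.q_nonneg R ω)
  refine mul_le_mul_of_nonneg_left ?_ hg.D_nonneg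
  exact indicator_le_self' (fun _ _ => hg.q_nonneg) x

end Dominated

variable {k : Type*} [NormedAddCommGroup k] [InnerProductSpace ℂ k]

theorem kernelOp_eq (F : Multiset ℝ → Multiset ℝ → Multiset ℝ → (k →L[ℂ] k)) (g : Multiset ℝ → k)
    (ω : Multiset ℝ) : kernelOp F g ω =
      asum (fun α ρ => asum (fun β _ => ∫ υ, F α β υ (g (ρ + υ)) ∂lam) ρ) ω := rfl

variable (A : SignType → (k →L[ℂ] k)) (B : k →L[ℂ] k)

theorem exists_forall_norm_le : ∃ C, ∀ i, ‖A i‖ ≤ C :=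
  (Set.finite_range fun i => ‖A i‖).bddAbove.imp fun _ hC i => hC ⟨i, rfl⟩

/-- The inner integral in the action of the kernel. -/
noncomputable def innerInt (s t : ℝ) (g : Multiset ℝ → k) (α β ρ : Multiset ℝ) : k :=
  ∫ υ, kernel A B t s α β υ (g (ρ + υ)) ∂lam

theorem kernelOp_kernel (s t : ℝ) (g : Multiset ℝ → k) (ω : Multiset ℝ) :
    kernelOp (kernel A B t s) g ω =
      asum (fun α ρ => asum (fun β _ => innerInt A B s t g α β ρ) ρ) ω := rfl

theorem innerInt_cons (s t x : ℝ) (g : Multiset ℝ → k) (α β ρ : Multiset ℝ) :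
    innerInt A B s t g α β (x ::ₘ ρ) = innerInt A B s t (fun ω => g (x ::ₘ ω)) α β ρ := by
  simp only [innerInt, Multiset.cons_add]

/-- A point outside ]s, t[ is neither created nor scattered, because the kernel would vanish, so it
is a spectator in the argument of g. Used with final time x, this is the adaptedness of the
evolution. -/
theorem kernelOp_cons {s t x : ℝ} (hx : ¬ (s < x ∧ x < t)) (g : Multiset ℝ → k) (ω : Multiset ℝ) :
    kernelOp (kernel A B t s) g (x ::ₘ ω) =
      kernelOp (kernel A B t s) (fun ω => g (x ::ₘ ω)) ω := by
  have h1 : ∀ g α β ρ, innerInt A B s t g (x ::ₘ α) β ρ = 0 := fun g α β ρ => by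
    simp [innerInt, kernel_cons_left A B hx]
  have h2 : ∀ g α β ρ, innerInt A B s t g α (x ::ₘ β) ρ = 0 := fun g α β ρ => by
    simp [innerInt, kernel_cons_mid A B hx]
  simp only [kernelOp_kernel, asum_cons, h1, h2, innerInt_cons]
  simp [asum]

variable [CompleteSpace k] [MeasurableSpace k] [BorelSpace k] [SecondCountableTopology k]

/-- The final time and the function are allowed to depend on the parameter, because the integral
equation contains the evolution up to time r of g(r + ·). -/
theorem measurable_innerInt {Y : Type u} [MeasurableSpace Y] (s : ℝ) {T : Y → ℝ} (hT : Measurable T)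
    {G : Y → Multiset ℝ → k} (hG : Measurable fun p : Y × Multiset ℝ => G p.1 p.2)
    {a b c : Y → Multiset ℝ} (ha : Measurable a) (hb : Measurable b) (hc : Measurable c) :
    Measurable fun y => innerInt A B s (T y) (G y) (a y) (b y) (c y) := by
  have h : Measurable fun p : Y × Multiset ℝ =>
      kernel A B (T p.1) s (a p.1) (b p.1) p.2 (G p.1 (c p.1 + p.2)) := by
    refine (measurable_kernel_apply A B s).comp
      (f := fun p : Y × Multiset ℝ => ((T p.1, a p.1, b p.1, p.2), G p.1 (c p.1 + p.2))) ?_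
    refine Measurable.prodMk (by fun_prop) (hG.comp (f := fun p : Y × Multiset ℝ => (p.1, c p.1 + p.2)) ?_)
    exact measurable_fst.prodMk (Measurable.multiset_add (by fun_prop) measurable_snd)
  exact h.stronglyMeasurable.integral_prod_right.measurable

theorem measurable_kernelOp {Y : Type u} [MeasurableSpace Y] (s : ℝ) {T : Y → ℝ} (hT : Measurable T)
    {G : Y → Multiset ℝ → k} (hG : Measurable fun p : Y × Multiset ℝ => G p.1 p.2) :
    Measurable fun p : Y × Multiset ℝ => kernelOp (kernel A B (T p.1) s) (G p.1) p.2 := by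
  simp only [kernelOp_kernel]
  refine measurable_asum (F := fun y α ρ => asum (fun β _ => innerInt A B s (T y) (G y) α β ρ) ρ) ?_
  have h := measurable_asum (Y := Y × Multiset ℝ × Multiset ℝ)
    (F := fun p β _ => innerInt A B s (T p.1) (G p.1) p.2.1 β p.2.2)
    (measurable_innerInt A B (Y := (Y × Multiset ℝ × Multiset ℝ) × Multiset ℝ × Multiset ℝ) s
      (T := fun p => T p.1.1) (by fun_prop) (G := fun p => G p.1.1)
      (hG.comp (f := fun p : ((Y × Multiset ℝ × Multiset ℝ) × Multiset ℝ × Multiset ℝ) × Multiset ℝ =>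
        (p.1.1.1, p.2)) (by fun_prop))
      (a := fun p => p.1.2.1) (b := fun p => p.2.1) (c := fun p => p.1.2.2)
      (by fun_prop) (by fun_prop) (by fun_prop))
  exact h.comp (f := fun p : Y × Multiset ℝ × Multiset ℝ => (p, p.2.2)) (by fun_prop)

section Bounds

variable {A} {C D q R s t : ℝ} (hC : ∀ i, ‖A i‖ ≤ C) (hs : -R ≤ s) (ht : t ≤ R)
  {g : Multiset ℝ → k} (hg : Dominated D q R g)

include hC hs ht hg

omit [BorelSpace k] [SecondCountableTopology k] in
theorem norm_kernel_apply_le (α β ρ υ : Multiset ℝ) :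
    ‖kernel A B t s α β υ (g (ρ + υ))‖ ≤
      Real.exp (2 * R * ‖B‖) * D * (wt C R α * wt C R β * wt q R ρ) * wt (C * q) R υ := by
  refine (ContinuousLinearMap.le_opNorm _ _).trans ?_
  refine (mul_le_mul (norm_kernel_le A B hC hs ht α β υ) (hg.bound _) (norm_nonneg _) ?_).trans ?_
  · have := fun ω => wt_nonneg ((norm_nonneg _).trans (hC 0)) R ω
    exact mul_nonneg (Real.exp_pos _).le (mul_nonneg (mul_nonneg (this _) (this _)) (this _))
  · rw [wt_add, ← wt_mul]
    exact le_of_eq (by ring)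

theorem integrable_kernel_apply (α β ρ : Multiset ℝ) :
    Integrable (fun υ => kernel A B t s α β υ (g (ρ + υ))) lam := by
  have hq : 0 ≤ C * q := mul_nonneg ((norm_nonneg _).trans (hC 0)) hg.q_nonneg
  refine ((integrable_wt hq R).const_mul _).mono' ?_
    (Eventually.of_forall (norm_kernel_apply_le B hC hs ht hg α β ρ))
  refine Measurable.aestronglyMeasurable ?_
  refine (measurable_kernel_apply A B s).comp
    (f := fun υ => ((t, α, β, υ), g (ρ + υ))) ?_
  exact Measurable.prodMk (by fun_prop)
    (hg.measurable.comp (Measurable.multiset_add measurable_const measurable_id))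

omit [BorelSpace k] [SecondCountableTopology k] in
theorem norm_innerInt_le (α β ρ : Multiset ℝ) :
    ‖innerInt A B s t g α β ρ‖ ≤
      Real.exp (2 * R * ‖B‖) * D * (∫ υ, wt (C * q) R υ ∂lam) * (wt C R α * wt C R β * wt q R ρ) := by
  have hq : 0 ≤ C * q := mul_nonneg ((norm_nonneg _).trans (hC 0)) hg.q_nonneg
  refine (norm_integral_le_of_norm_le ((integrable_wt hq R).const_mul _)
    (Eventually.of_forall (norm_kernel_apply_le B hC hs ht hg α β ρ))).trans (le_of_eq ?_)
  rw [integral_const_mul]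
  ring

/-- A point of ω carries C if it is created (in α), C·q if it is scattered (in β, but still an
argument of g), and q otherwise; `asum_wt` adds the three cases. The annihilated points υ contribute
the integral of the weight with base C·q. -/
theorem dominated_kernelOp :
    Dominated (Real.exp (2 * R * ‖B‖) * D * (∫ υ, wt (C * q) R υ ∂lam)) (C + (C * q + q)) R
      (kernelOp (kernel A B t s) g) := by
  have hC0 : 0 ≤ C := (norm_nonneg _).trans (hC 0)
  have hq : 0 ≤ C * q := mul_nonneg hC0 hg.q_nonneg
  refine ⟨?_, ?_, add_nonneg hC0 (add_nonneg hq hg.q_nonneg), fun ω => ?_⟩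
  · exact (measurable_kernelOp A B s (Y := Unit) (T := fun _ => t) measurable_const
      (G := fun _ => g) (hg.measurable.comp measurable_snd)).comp
      (f := fun ω => ((), ω)) (by fun_prop)
  · exact mul_nonneg (mul_nonneg (Real.exp_pos _).le hg.D_nonneg)
      (integral_nonneg fun υ => wt_nonneg hq R υ)
  · set M := Real.exp (2 * R * ‖B‖) * D * (∫ υ, wt (C * q) R υ ∂lam)
    rw [kernelOp_kernel, ← asum_wt, ← asum_const_mul]
    refine (norm_asum_le _ _).trans (asum_mono (fun α ρ => ?_) ω)
    have : M * (wt C R α * wt (C * q + q) R ρ) =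
        asum (fun β γ => M * (wt C R α * wt C R β * wt q R ρ)) ρ := by
      rw [← asum_wt, ← asum_const_mul, ← asum_const_mul]
      refine asum_congr fun β γ h => ?_
      rw [h, wt_add, ← wt_mul]
      ring
    rw [this]
    exact (norm_asum_le _ _).trans (asum_mono (fun β γ => norm_innerInt_le B hC hs ht hg α β ρ) ρ)

end Bounds

end WhiteNoise

namespace WhiteNoise

/-! ### The integral equation for the evolution -/

theorem measurableSet_singleton_zero : MeasurableSet ({0} : Set (Multiset ℝ)) := by
  have : ({0} : Set (Multiset ℝ)) = (fun ω : Multiset ℝ => ω.card) ⁻¹' {0} := by ext; simp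
  rw [this]
  exact measurable_card (measurableSet_singleton 0)

theorem lam_singleton_zero : lam {0} = 1 := by
  rw [← lintegral_indicator_one measurableSet_singleton_zero,
    ← lintegral_lam_ite_zero (fun _ => 1) measurable_const]
  refine lintegral_congr fun ω => ?_
  simp [indicator]

theorem integral_add_eq {X E : Type*} [MeasurableSpace X] {μ : Measure X} [NormedAddCommGroup E]
    [NormedSpace ℝ E] {f g : X → E} {a b : E} (hf : Integrable f μ ∧ ∫ x, f x ∂μ = a)
    (hg : Integrable g μ ∧ ∫ x, g x ∂μ = b) :
    Integrable (fun x => f x + g x) μ ∧ ∫ x, f x + g x ∂μ = a + b :=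
  ⟨hf.1.add hg.1, by rw [integral_add hf.1 hg.1, hf.2, hg.2]⟩

variable {k : Type*} [NormedAddCommGroup k] [InnerProductSpace ℂ k]
  [CompleteSpace k] [MeasurableSpace k] [BorelSpace k] [SecondCountableTopology k]
  {A : SignType → (k →L[ℂ] k)} (B : k →L[ℂ] k)

section

variable {C D q R s t : ℝ} (hC : ∀ i, ‖A i‖ ≤ C) (hs : -R ≤ s) (ht : t ≤ R)
  {g : Multiset ℝ → k} (hg : Dominated D q R g)

include hC hs ht hg

theorem integrableOn_innerInt (α β ρ : Multiset ℝ) :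
    IntegrableOn (fun r => innerInt A B s r g α β ρ) (Ioo s t) := by
  refine Measure.integrableOn_of_bounded
    (M := Real.exp (2 * R * ‖B‖) * D * (∫ υ, wt (C * q) R υ ∂lam) * (wt C R α * wt C R β * wt q R ρ))
    (by simp) ?_ ?_
  · exact (measurable_innerInt A B s measurable_id (G := fun _ => g) (hg.measurable.comp measurable_snd)
      measurable_const measurable_const measurable_const).aestronglyMeasurable
  · refine (ae_restrict_iff' measurableSet_Ioo).2 (Eventually.of_forall fun r hr => ?_)
    exact norm_innerInt_le B hC hs (hr.2.le.trans ht) hg α β ρ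

theorem integrableOn_innerInt_cons (α β ρ : Multiset ℝ) :
    IntegrableOn (fun r => innerInt A B s r (fun ω => g (r ::ₘ ω)) α β ρ) (Ioo s t) := by
  refine Measure.integrableOn_of_bounded
    (M := Real.exp (2 * R * ‖B‖) * (D * q) * (∫ υ, wt (C * q) R υ ∂lam) *
      (wt C R α * wt C R β * wt q R ρ))
    (by simp) ?_ ?_
  · exact (measurable_innerInt A B s measurable_id (G := fun r ω => g (r ::ₘ ω))
      (hg.measurable.comp measurable_cons)
      measurable_const measurable_const measurable_const).aestronglyMeasurable
  · refine (ae_restrict_iff' measurableSet_Ioo).2 (Eventually.of_forall fun r hr => ?_)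
    exact norm_innerInt_le B hC hs (hr.2.le.trans ht) (hg.cons r) α β ρ

/-- If the last jump is an annihilation, its point x is one of the integrated points υ. Mecke's
formula turns it into the time variable r, which remains as an extra argument of g. -/
theorem integral_annihilation (α β ρ : Multiset ℝ) :
    Integrable (fun υ => psum (fun x υ' => if s < x ∧ x < t then
      A (-1) (kernel A B x s α β υ' (g (ρ + υ))) else 0) υ) lam ∧
    ∫ υ, psum (fun x υ' => if s < x ∧ x < t then
      A (-1) (kernel A B x s α β υ' (g (ρ + υ))) else 0) υ ∂lam =
      ∫ r in Ioo s t, A (-1) (innerInt A B s r (fun ω => g (r ::ₘ ω)) α β ρ) := by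
  have hC0 : 0 ≤ C := (norm_nonneg _).trans (hC 0)
  have hq : 0 ≤ C * q := mul_nonneg hC0 hg.q_nonneg
  set f : ℝ → Multiset ℝ → k := fun x υ' => if s < x ∧ x < t then
    A (-1) (kernel A B x s α β υ' (g (x ::ₘ (ρ + υ')))) else 0 with hf
  have hp : ∀ υ, psum (fun x υ' => if s < x ∧ x < t then
      A (-1) (kernel A B x s α β υ' (g (ρ + υ))) else 0) υ = psum f υ := by
    intro υ
    refine psum_congr ?_
    rintro x υ' rfl
    rw [hf, Multiset.add_cons]
  have hfm : Measurable fun p : ℝ × Multiset ℝ => f p.1 p.2 := by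
    refine Measurable.ite ?_ ?_ measurable_const
    · exact (measurableSet_lt measurable_const measurable_fst).inter
        (measurableSet_lt measurable_fst measurable_const)
    · refine (A (-1)).measurable.comp ((measurable_kernel_apply A B s).comp
        (f := fun p : ℝ × Multiset ℝ => ((p.1, α, β, p.2), g (p.1 ::ₘ (ρ + p.2)))) ?_)
      refine Measurable.prodMk (by fun_prop) (hg.measurable.comp ?_)
      exact Measurable.multiset_cons measurable_fst (Measurable.multiset_add measurable_const measurable_snd)
  have hbound : ∀ x υ, ‖f x υ‖ ≤ (Ioo s t).indicator (fun _ => C * (Real.exp (2 * R * ‖B‖) * (D * q) *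
      (wt C R α * wt C R β * wt q R ρ))) x * wt (C * q) R υ := by
    intro x υ
    by_cases hx : x ∈ Ioo s t
    · rw [indicator_of_mem hx, hf]
      simp only [if_pos (show s < x ∧ x < t from hx)]
      refine ((A (-1)).le_opNorm _).trans ?_
      rw [mul_assoc]
      exact mul_le_mul (hC _) (norm_kernel_apply_le B hC hs (hx.2.le.trans ht) (hg.cons x) α β ρ υ)
        (norm_nonneg _) hC0
    · rw [indicator_of_notMem hx, hf]
      simp only [if_neg (show ¬ (s < x ∧ x < t) from hx)]
      simp
  have hint : Integrable (fun p : ℝ × Multiset ℝ => f p.1 p.2) (volume.prod lam) := by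
    refine Integrable.mono' (Integrable.mul_prod (f := (Ioo s t).indicator fun _ =>
      C * (Real.exp (2 * R * ‖B‖) * (D * q) * (wt C R α * wt C R β * wt q R ρ)))
      ((integrable_indicator_iff measurableSet_Ioo).2 (integrableOn_const (by simp)))
      (integrable_wt hq R)) hfm.aestronglyMeasurable (Eventually.of_forall fun p => hbound p.1 p.2)
  have := integral_psum hfm.stronglyMeasurable hint
  simp only [hp]
  refine ⟨this.1, this.2.trans ?_⟩
  rw [← integral_indicator measurableSet_Ioo]
  refine integral_congr_ae (Eventually.of_forall fun x => ?_)
  by_cases hx : x ∈ Ioo s t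
  · simp only [hf, if_pos (show s < x ∧ x < t from hx), indicator_of_mem hx, innerInt]
    exact (A (-1)).integral_comp_comm
      (integrable_kernel_apply B hC hs (hx.2.le.trans ht) (hg.cons x) α β ρ)
  · simp only [hf, if_neg (show ¬ (s < x ∧ x < t) from hx), indicator_of_notMem hx, integral_zero]

/-- The integral equation of the kernel, applied to the vector g(ρ + υ) and integrated over υ. The
term without jumps is supported on υ = 0, an atom of mass 1, and Fubini exchanges υ with the time in
the drift term. -/
theorem innerInt_eq (hst : s < t) (α β ρ : Multiset ℝ) :
    innerInt A B s t g α β ρ =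
      (if α = 0 then if β = 0 then g ρ else 0 else 0) +
      (psum (fun x α' => if s < x ∧ x < t then A 1 (innerInt A B s x g α' β ρ) else 0) α +
       psum (fun x β' => if s < x ∧ x < t then A 0 (innerInt A B s x g α β' ρ) else 0) β +
       ∫ r in Ioo s t, A (-1) (innerInt A B s r (fun ω => g (r ::ₘ ω)) α β ρ)) +
      ∫ r in Ioo s t, B (innerInt A B s r g α β ρ) := by
  have hC0 : 0 ≤ C := (norm_nonneg _).trans (hC 0)
  have hq : 0 ≤ C * q := mul_nonneg hC0 hg.q_nonneg
  have hcase : ∀ x (P : k →L[ℂ] k) (α β : Multiset ℝ), Integrable (fun υ => if s < x ∧ x < t then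
      P (kernel A B x s α β υ (g (ρ + υ))) else 0) lam ∧
      ∫ υ, (if s < x ∧ x < t then P (kernel A B x s α β υ (g (ρ + υ))) else 0) ∂lam =
        if s < x ∧ x < t then P (innerInt A B s x g α β ρ) else 0 := by
    intro x P α β
    by_cases hx : s < x ∧ x < t
    · simp only [if_pos hx]
      have := integrable_kernel_apply B hC hs (hx.2.le.trans ht) hg α β ρ
      exact ⟨P.integrable_comp this, P.integral_comp_comm this⟩
    · simp only [if_neg hx]
      simp
  have h1 := integral_psum_comm (μ := lam) (F := fun υ x α' => if s < x ∧ x < t then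
    A 1 (kernel A B x s α' β υ (g (ρ + υ))) else 0) (fun x α' => (hcase x (A 1) α' β).1) α
  have h2 := integral_psum_comm (μ := lam) (F := fun υ x β' => if s < x ∧ x < t then
    A 0 (kernel A B x s α β' υ (g (ρ + υ))) else 0) (fun x β' => (hcase x (A 0) α β').1) β
  have h3 := integral_annihilation B hC hs ht hg α β ρ
  have h0m : Measurable fun υ : Multiset ℝ => if υ.card = 0 then g ρ else 0 :=
    Measurable.ite (measurable_card (measurableSet_singleton 0)) measurable_const measurable_const
  have h0 : Integrable (fun υ : Multiset ℝ => if υ.card = 0 then g ρ else 0) lam ∧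
      ∫ υ : Multiset ℝ, (if υ.card = 0 then g ρ else 0) ∂lam = g ρ := by
    have hind : (fun υ : Multiset ℝ => if υ.card = 0 then g ρ else 0) =
        ({0} : Set (Multiset ℝ)).indicator fun _ => g ρ := by
      ext υ; simp [indicator]
    rw [hind, integrable_indicator_iff measurableSet_singleton_zero,
      integral_indicator measurableSet_singleton_zero, setIntegral_const]
    refine ⟨integrableOn_const (by simp [lam_singleton_zero]), ?_⟩
    simp [measureReal_def, lam_singleton_zero]
  have h0' : Integrable (fun υ : Multiset ℝ => if α = 0 then if β = 0 then if υ = 0 then g (ρ + υ)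
        else 0 else 0 else 0) lam ∧
      ∫ υ : Multiset ℝ, (if α = 0 then if β = 0 then if υ = 0 then g (ρ + υ) else 0 else 0 else 0) ∂lam =
        if α = 0 then if β = 0 then g ρ else 0 else 0 := by
    have he : ∀ υ : Multiset ℝ, (if υ = 0 then g (ρ + υ) else 0) = if υ.card = 0 then g ρ else 0 := by
      intro υ
      simp only [Multiset.card_eq_zero]
      split_ifs with h
      · rw [h, add_zero]
      · rfl
    simp only [he]
    split_ifs
    · exact h0
    · simp
    · simp
  have h4int : Integrable (fun p : Multiset ℝ × ℝ => B (kernel A B p.2 s α β p.1 (g (ρ + p.1))))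
      (lam.prod (volume.restrict (Ioo s t))) := by
    refine B.integrable_comp ?_
    refine Integrable.mono' (g := fun p : Multiset ℝ × ℝ => wt (C * q) R p.1 *
      (Real.exp (2 * R * ‖B‖) * D * (wt C R α * wt C R β * wt q R ρ)))
      ((integrable_wt hq R).mul_prod (integrableOn_const (by simp))) ?_ ?_
    · refine Measurable.aestronglyMeasurable ((measurable_kernel_apply A B s).comp
        (f := fun p : Multiset ℝ × ℝ => ((p.2, α, β, p.1), g (ρ + p.1))) ?_)
      exact Measurable.prodMk (by fun_prop)
        (hg.measurable.comp (Measurable.multiset_add measurable_const measurable_fst))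
    · have hae : ∀ᵐ p : Multiset ℝ × ℝ ∂(lam.prod (volume.restrict (Ioo s t))), p.2 ∈ Ioo s t := by
        refine Measure.quasiMeasurePreserving_snd.ae (ae_restrict_mem measurableSet_Ioo)
      filter_upwards [hae] with p hp
      rw [mul_comm (wt _ _ _)]
      exact norm_kernel_apply_le B hC hs (hp.2.le.trans ht) hg α β ρ p.1
  have h4 := integral_integral_swap
    (f := fun υ r => B (kernel A B r s α β υ (g (ρ + υ)))) h4int
  have h4' := h4int.integral_prod_left
  have heq : ∀ υ, kernel A B t s α β υ (g (ρ + υ)) = _ := fun υ =>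
    (integralSolution_kernel A B hst α β υ (g (ρ + υ))).eq
  rw [innerInt]
  simp only [heq]
  refine (integral_add_eq (integral_add_eq h0' (integral_add_eq (integral_add_eq h1 h2) h3))
    ⟨h4', h4⟩).2.trans ?_
  simp only [(hcase _ _ _ _).2]
  congr 1
  refine setIntegral_congr_fun measurableSet_Ioo fun r hr => ?_
  exact B.integral_comp_comm (integrable_kernel_apply B hC hs (hr.2.le.trans ht) hg α β ρ)

/-- The integral equation for the evolution of a dominated function. -/
theorem kernelOp_eq_integral (hst : s < t) (ω : Multiset ℝ) :
    kernelOp (kernel A B t s) g ω = g ω +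
      (∫ r in Ioo s t, (B (kernelOp (kernel A B r s) g ω) +
        A (-1) (kernelOp (kernel A B r s) (fun ω' => g (r ::ₘ ω')) ω))) +
      psum (fun x ω' => if s < x ∧ x < t then
        A 1 (kernelOp (kernel A B x s) g ω') +
        A 0 (kernelOp (kernel A B x s) (fun ω'' => g (x ::ₘ ω'')) ω') else 0) ω := by
  have h0 : asum (fun α ρ => asum (fun β _ => if α = 0 then if β = 0 then g ρ else 0 else 0) ρ) ω = g ω := by
    simp only [asum_ite, asum_ite_eq_zero]
  have h1 : asum (fun α ρ => asum (fun β _ =>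
      psum (fun x α' => if s < x ∧ x < t then A 1 (innerInt A B s x g α' β ρ) else 0) α) ρ) ω =
      psum (fun x ω' => if s < x ∧ x < t then A 1 (kernelOp (kernel A B x s) g ω') else 0) ω := by
    simp only [asum_psum_comm]
    rw [asum_psum_left (fun x α' ρ => asum (fun β _ =>
      if s < x ∧ x < t then A 1 (innerInt A B s x g α' β ρ) else 0) ρ)]
    refine psum_congr fun x ω' _ => ?_
    simp only [asum_ite, kernelOp_kernel, map_asum]
  have h2 : asum (fun α ρ => asum (fun β _ =>
      psum (fun x β' => if s < x ∧ x < t then A 0 (innerInt A B s x g α β' ρ) else 0) β) ρ) ω =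
      psum (fun x ω' => if s < x ∧ x < t then
        A 0 (kernelOp (kernel A B x s) (fun ω'' => g (x ::ₘ ω'')) ω') else 0) ω := by
    -- A scattered point lies in β and also in ρ, so after its removal from β it survives as an
    -- argument of g. Writing ρ as β + γ lets the marking rule for decompositions remove it from
    -- both at once.
    have hin : ∀ α ρ, asum (fun β _ =>
        psum (fun x β' => if s < x ∧ x < t then A 0 (innerInt A B s x g α β' ρ) else 0) β) ρ =
        psum (fun x ρ' => asum (fun β' _ => if s < x ∧ x < t then
          A 0 (innerInt A B s x (fun ω'' => g (x ::ₘ ω'')) α β' ρ') else 0) ρ') ρ := by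
      intro α ρ
      have hl : asum (fun β γ => psum (fun x β' => if s < x ∧ x < t then
          A 0 (innerInt A B s x (fun ω'' => g (x ::ₘ ω'')) α β' (β' + γ)) else 0) β) ρ =
          psum (fun x ρ' => asum (fun β' γ => if s < x ∧ x < t then
            A 0 (innerInt A B s x (fun ω'' => g (x ::ₘ ω'')) α β' (β' + γ)) else 0) ρ') ρ :=
        asum_psum_left (fun x β' γ => if s < x ∧ x < t then
          A 0 (innerInt A B s x (fun ω'' => g (x ::ₘ ω'')) α β' (β' + γ)) else 0) ρ
      have hr : ∀ x ρ', asum (fun β' γ => if s < x ∧ x < t then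
            A 0 (innerInt A B s x (fun ω'' => g (x ::ₘ ω'')) α β' (β' + γ)) else 0) ρ' =
          asum (fun β' _ => if s < x ∧ x < t then
            A 0 (innerInt A B s x (fun ω'' => g (x ::ₘ ω'')) α β' ρ') else 0) ρ' := fun x ρ' =>
        asum_congr fun β γ h => by rw [h]
      simp only [hr] at hl
      rw [← hl]
      refine asum_congr fun β γ h => psum_congr fun x β' hβ => ?_
      rw [h, hβ, Multiset.cons_add, innerInt_cons]
    simp only [hin]
    rw [asum_psum_right (fun x α ρ' => asum (fun β' _ => if s < x ∧ x < t then
          A 0 (innerInt A B s x (fun ω'' => g (x ::ₘ ω'')) α β' ρ') else 0) ρ')]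
    refine psum_congr fun x ω' _ => ?_
    simp only [asum_ite, kernelOp_kernel, map_asum]
  have h3i := fun α ρ => integral_asum_comm (F := fun r β _ => A (-1) (innerInt A B s r (fun ω => g (r ::ₘ ω)) α β ρ))
    (fun β _ => (A (-1)).integrable_comp (integrableOn_innerInt_cons B hC hs ht hg α β ρ)) ρ
  have h3 := integral_asum_comm (F := fun r α ρ => asum (fun β _ =>
    A (-1) (innerInt A B s r (fun ω => g (r ::ₘ ω)) α β ρ)) ρ) (fun α ρ => (h3i α ρ).1) ω
  have h4i := fun α ρ => integral_asum_comm (F := fun r β _ => B (innerInt A B s r g α β ρ))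
    (fun β _ => B.integrable_comp (integrableOn_innerInt B hC hs ht hg α β ρ)) ρ
  have h4 := integral_asum_comm (F := fun r α ρ => asum (fun β _ =>
    B (innerInt A B s r g α β ρ)) ρ) (fun α ρ => (h4i α ρ).1) ω
  rw [kernelOp_kernel]
  simp only [innerInt_eq B hC hs ht hg hst, asum_add, h0, h1, h2, ← (h3i _ _).2, ← (h4i _ _).2,
    ← h3.2, ← h4.2]
  have h5 : ∀ r, B (kernelOp (kernel A B r s) g ω) +
        A (-1) (kernelOp (kernel A B r s) (fun ω' => g (r ::ₘ ω')) ω) =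
      asum (fun α ρ => asum (fun β _ => B (innerInt A B s r g α β ρ)) ρ) ω +
      asum (fun α ρ => asum (fun β _ =>
        A (-1) (innerInt A B s r (fun ω => g (r ::ₘ ω)) α β ρ)) ρ) ω := by
    intro r
    simp only [kernelOp_kernel, map_asum]
  simp only [h5]
  rw [integral_add h4.1 h3.1]
  have h6 : psum (fun x ω' => if s < x ∧ x < t then
        A 1 (kernelOp (kernel A B x s) g ω') +
        A 0 (kernelOp (kernel A B x s) (fun ω'' => g (x ::ₘ ω'')) ω') else 0) ω =
      psum (fun x ω' => if s < x ∧ x < t then A 1 (kernelOp (kernel A B x s) g ω') else 0) ω +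
      psum (fun x ω' => if s < x ∧ x < t then
        A 0 (kernelOp (kernel A B x s) (fun ω'' => g (x ::ₘ ω'')) ω') else 0) ω := by
    rw [← psum_add]
    congr 1
    ext x ω'
    split_ifs <;> simp
  rw [h6]
  abel

end

end WhiteNoise

namespace WhiteNoise

/-! ### The square of the norm along a path with finitely many jumps -/

section NormSq

variable {k : Type*} [NormedAddCommGroup k] [InnerProductSpace ℂ k]

/-- The real part of the inner product, as a real linear functional. -/
noncomputable def reInner (v : k) : k →L[ℝ] ℝ := Complex.reCLM ∘L (innerSL ℂ v).restrictScalars ℝ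

theorem reInner_apply (v w : k) : reInner v w = (inner ℂ v w).re := rfl

theorem reInner_self (v : k) : reInner v v = ‖v‖ ^ 2 := by
  rw [reInner_apply, inner_self_eq_norm_sq_to_K]
  norm_cast

theorem reInner_comm (v w : k) : reInner v w = reInner w v := by
  rw [reInner_apply, reInner_apply, ← inner_conj_symm, Complex.conj_re]

theorem abs_reInner_le (v w : k) : ‖reInner v w‖ ≤ ‖v‖ * ‖w‖ :=
  (Complex.abs_re_le_norm _).trans (norm_inner_le_norm v w)

theorem norm_add_sq_reInner (v w : k) : ‖v + w‖ ^ 2 = ‖v‖ ^ 2 + 2 * reInner v w + ‖w‖ ^ 2 := by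
  rw [reInner_apply]
  exact norm_add_sq (𝕜 := ℂ) v w

variable [CompleteSpace k]

/-- The square of the integral is a double integral of a symmetric function; the diagonal is null
and the two triangles contribute equally. This replaces the product rule, since f is only
integrable. -/
theorem two_integral_reInner {μ : Measure ℝ} [SFinite μ] [NullSingletonClass μ] {f : ℝ → k}
    (hf : Integrable f μ) :
    2 * ∫ r, reInner (f r) (∫ r' in Iio r, f r' ∂μ) ∂μ = ‖∫ r, f r ∂μ‖ ^ 2 := by
  set F : ℝ × ℝ → ℝ := fun p => reInner (f p.2) (f p.1) with hF
  have hFi : Integrable F (μ.prod μ) := by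
    refine Integrable.mono' (hf.norm.mul_prod hf.norm) ?_ (Eventually.of_forall fun p => ?_)
    · have h := hf.aestronglyMeasurable
      exact (Complex.continuous_re.comp_aestronglyMeasurable
        (AEStronglyMeasurable.inner (𝕜 := ℂ) h.comp_snd h.comp_fst))
    · exact (abs_reInner_le _ _).trans_eq (mul_comm _ _)
  set S : Set (ℝ × ℝ) := {p | p.1 < p.2}
  have hS : MeasurableSet S := measurableSet_lt measurable_fst measurable_snd
  have hG : Integrable (S.indicator F) (μ.prod μ) := hFi.indicator hS
  have hdiag : ∀ᵐ p ∂(μ.prod μ), p.1 ≠ p.2 := by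
    have hm : MeasurableSet {p : ℝ × ℝ | p.1 ≠ p.2} :=
      (measurableSet_eq_fun measurable_fst measurable_snd).compl
    refine Measure.ae_prod_iff_ae_ae hm |>.2 (Eventually.of_forall fun x => ?_)
    have : ∀ᵐ y ∂μ, y ≠ x := by simp [ae_iff]
    filter_upwards [this] with y hy using hy.symm
  have hsum : ∫ p, F p ∂(μ.prod μ) = ∫ p, S.indicator F p + S.indicator F p.swap ∂(μ.prod μ) := by
    refine integral_congr_ae ?_
    filter_upwards [hdiag] with p hp
    rcases lt_or_gt_of_ne hp with h | h
    · rw [indicator_of_mem (show p ∈ S from h), indicator_of_notMem (show p.swap ∉ S from not_lt.2 h.le),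
        add_zero]
    · rw [indicator_of_notMem (show p ∉ S from not_lt.2 h.le), indicator_of_mem (show p.swap ∈ S from h),
        zero_add, hF]
      exact reInner_comm _ _
  have hadd : ∫ p, S.indicator F p + S.indicator F p.swap ∂(μ.prod μ) =
      ∫ p, S.indicator F p ∂(μ.prod μ) + ∫ p, S.indicator F p.swap ∂(μ.prod μ) :=
    integral_add hG hG.swap
  rw [hadd, integral_prod_swap (S.indicator F), ← two_mul, integral_prod_symm _ hFi,
    integral_prod_symm _ hG] at hsum
  have h1 : ∫ y, ∫ x, F (x, y) ∂μ ∂μ = ‖∫ r, f r ∂μ‖ ^ 2 := by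
    simp only [hF]
    have : ∀ y, ∫ x, reInner (f y) (f x) ∂μ = reInner (∫ x, f x ∂μ) (f y) := fun y => by
      rw [(reInner (f y)).integral_comp_comm hf, reInner_comm]
    simp only [this]
    rw [(reInner (∫ x, f x ∂μ)).integral_comp_comm hf, reInner_self]
  rw [← h1, hsum]
  congr 1
  refine integral_congr_ae (Eventually.of_forall fun y => ?_)
  simp only
  have : ∀ x, S.indicator F (x, y) = (Iio y).indicator (fun x => reInner (f y) (f x)) x := by
    intro x
    by_cases h : x < y
    · rw [indicator_of_mem (show (x, y) ∈ S from h), indicator_of_mem (mem_Iio.2 h)]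
    · rw [indicator_of_notMem (show (x, y) ∉ S from h), indicator_of_notMem (by simpa using h)]
  simp only [this]
  rw [integral_indicator measurableSet_Iio, (reInner (f y)).integral_comp_comm hf.integrableOn]

theorem setIntegral_Ioo_split {E : Type*} [NormedAddCommGroup E] [NormedSpace ℝ E] {f : ℝ → E}
    {a b c : ℝ} (hab : a < b) (hbc : b < c) (hf : IntegrableOn f (Ioo a c)) :
    ∫ r in Ioo a c, f r = (∫ r in Ioo a b, f r) + ∫ r in Ioo b c, f r := by
  rw [← integral_Ioc_eq_integral_Ioo (x := a) (y := b), ← Ioc_union_Ioo_eq_Ioo hab.le hbc,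
    setIntegral_union]
  · exact Set.disjoint_left.2 fun x hx hx' => not_lt.2 hx.2 hx'.1
  · exact measurableSet_Ioo
  · exact hf.mono_set fun x hx => ⟨hx.1, hx.2.trans_lt hbc⟩
  · exact hf.mono_set fun x hx => ⟨hab.trans hx.1, hx.2⟩

/-- Expanding ‖c + ∫f‖², the square of the integral is rewritten by `two_integral_reInner`, and the
terms with c and with the partial integral of f combine into X. -/
theorem norm_sq_of_integral {a t : ℝ} (hat : a < t) {X f : ℝ → k} {c : k}
    (hf : IntegrableOn f (Ioo a t)) (hX : ∀ r ∈ Ioc a t, X r = c + ∫ r' in Ioo a r, f r') :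
    ‖X t‖ ^ 2 = ‖c‖ ^ 2 + ∫ r in Ioo a t, 2 * reInner (f r) (X r) := by
  have h1 := two_integral_reInner hf
  have hIio : ∀ r ∈ Ioo a t, ∫ r' in Iio r, f r' ∂(volume.restrict (Ioo a t)) = ∫ r' in Ioo a r, f r' := by
    intro r hr
    rw [Measure.restrict_restrict measurableSet_Iio]
    congr 2
    ext x; simp only [mem_inter_iff, mem_Iio, mem_Ioo]
    constructor
    · rintro ⟨h1, h2, h3⟩; exact ⟨h2, h1⟩
    · rintro ⟨h1, h2⟩; exact ⟨h2, h1, h2.trans hr.2⟩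
  rw [setIntegral_congr_fun measurableSet_Ioo (fun r hr => by
    rw [hIio r hr] : EqOn _ (fun r => reInner (f r) (∫ r' in Ioo a r, f r')) _)] at h1
  have hcong : EqOn (fun r => 2 * reInner (f r) (X r))
      (fun r => 2 * reInner c (f r) + 2 * reInner (f r) (∫ r' in Ioo a r, f r')) (Ioo a t) := by
    intro r hr
    simp only
    rw [hX r ⟨hr.1, hr.2.le⟩, map_add, reInner_comm c]
    ring
  have hi1 : IntegrableOn (fun r => 2 * reInner c (f r)) (Ioo a t) :=
    ((reInner c).integrable_comp hf).const_mul 2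
  have hprim : ContinuousOn (fun r => ∫ r' in a..r, f r') (uIcc a t) :=
    intervalIntegral.continuousOn_primitive_interval (by
      rw [uIcc_of_le hat.le, integrableOn_Icc_iff_integrableOn_Ioo]; exact hf)
  have hi2 : IntegrableOn (fun r => 2 * reInner (f r) (∫ r' in Ioo a r, f r')) (Ioo a t) := by
    refine Integrable.const_mul ?_ 2
    obtain ⟨M, hM⟩ := isCompact_uIcc.exists_bound_of_continuousOn hprim
    have hEq : ∀ r ∈ Ioo a t, ∫ r' in Ioo a r, f r' = ∫ r' in a..r, f r' := fun r hr => by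
      rw [intervalIntegral.integral_of_le hr.1.le, integral_Ioc_eq_integral_Ioo]
    have hsub : Ioo a t ⊆ uIcc a t := by rw [uIcc_of_le hat.le]; exact Ioo_subset_Icc_self
    have hmeas : AEStronglyMeasurable (fun r => ∫ r' in Ioo a r, f r') (volume.restrict (Ioo a t)) := by
      refine ((hprim.mono hsub).aestronglyMeasurable measurableSet_Ioo).congr ?_
      exact (ae_restrict_iff' measurableSet_Ioo).2 (Eventually.of_forall fun r hr => (hEq r hr).symm)
    refine Integrable.mono' (hf.norm.mul_const M)
      (Complex.continuous_re.comp_aestronglyMeasurable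
        (AEStronglyMeasurable.inner (𝕜 := ℂ) hf.aestronglyMeasurable hmeas))
      ((ae_restrict_iff' measurableSet_Ioo).2 (Eventually.of_forall fun r hr => ?_))
    refine (abs_reInner_le _ _).trans (mul_le_mul_of_nonneg_left ?_ (norm_nonneg _))
    rw [hEq r hr]
    exact hM r (hsub hr)
  rw [hX t ⟨hat, le_rfl⟩, norm_add_sq_reInner, setIntegral_congr_fun measurableSet_Ioo hcong,
    integral_add hi1 hi2, integral_const_mul, integral_const_mul, h1,
    (reInner c).integral_comp_comm hf]
  ring

/-- The square of the norm of a function with finitely many jumps. -/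
theorem norm_sq_of_jumps {s : ℝ} {X f J : ℝ → k} {c : k} (F : Finset ℝ) :
    ∀ t : ℝ, s < t → IntegrableOn f (Ioo s t) → IntegrableOn (fun r => 2 * reInner (f r) (X r)) (Ioo s t) →
    (∀ r ∈ Ioc s t, X r = c + (∫ r' in Ioo s r, f r') + ∑ x ∈ F, if s < x ∧ x < r then J x else 0) →
    ‖X t‖ ^ 2 = ‖c‖ ^ 2 + (∫ r in Ioo s t, 2 * reInner (f r) (X r)) +
      ∑ x ∈ F, if s < x ∧ x < t then ‖X x + J x‖ ^ 2 - ‖X x‖ ^ 2 else 0 := by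
  induction F using Finset.induction_on_max with
  | empty =>
    intro t hst hf _ hX
    simpa using norm_sq_of_integral hst hf (by simpa using hX)
  | insert y F hy ih =>
    intro t hst hf hXi hX
    have hyF : y ∉ F := fun h => lt_irrefl _ (hy y h)
    simp only [Finset.sum_insert hyF] at hX ⊢
    -- The path is left continuous at jumps, so X y is the value before the jump. If the largest
    -- jump time y lies in ]s, t[, the induction hypothesis is used up to y and the path restarts
    -- there from X y + J y; otherwise y has no effect.
    by_cases hyt : s < y ∧ y < t
    · have h1 := ih y hyt.1 (hf.mono_set (Ioo_subset_Ioo_right hyt.2.le))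
        (hXi.mono_set (Ioo_subset_Ioo_right hyt.2.le)) (fun r hr => by
          rw [hX r ⟨hr.1, hr.2.trans hyt.2.le⟩, if_neg fun h => not_lt.2 hr.2 h.2, zero_add])
      have hXy : X y = c + (∫ r' in Ioo s y, f r') + ∑ x ∈ F, if s < x ∧ x < y then J x else 0 := by
        rw [hX y ⟨hyt.1, hyt.2.le⟩, if_neg fun h => lt_irrefl _ h.2, zero_add]
      have hFr : ∀ (G : ℝ → k) r, y < r → (∑ x ∈ F, if s < x ∧ x < r then G x else 0) =
          ∑ x ∈ F, if s < x ∧ x < y then G x else 0 := fun G r hr =>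
        Finset.sum_congr rfl fun x hx => by
          simp only [(hy x hx), (hy x hx).trans hr]
      have h2 := norm_sq_of_integral (X := X) (c := X y + J y) hyt.2
        (hf.mono_set (Ioo_subset_Ioo_left hyt.1.le)) (fun r hr => by
          rw [hX r ⟨hyt.1.trans hr.1, hr.2⟩, if_pos ⟨hyt.1, hr.1⟩, hFr J r hr.1, hXy,
            setIntegral_Ioo_split hyt.1 hr.1 (hf.mono_set (Ioo_subset_Ioo_right hr.2))]
          abel)
      have hFt : (∑ x ∈ F, if s < x ∧ x < t then ‖X x + J x‖ ^ 2 - ‖X x‖ ^ 2 else 0) =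
          ∑ x ∈ F, if s < x ∧ x < y then ‖X x + J x‖ ^ 2 - ‖X x‖ ^ 2 else 0 :=
        Finset.sum_congr rfl fun x hx => by
          simp only [(hy x hx), (hy x hx).trans hyt.2]
      rw [h2, if_pos hyt, hFt, setIntegral_Ioo_split hyt.1 hyt.2 hXi]
      linarith
    · rw [if_neg hyt, zero_add]
      refine ih t hst hf hXi fun r hr => ?_
      rw [hX r hr, if_neg fun h => hyt ⟨h.1, h.2.trans_le hr.2⟩, zero_add]

theorem psum_eq_sum {E : Type*} [AddCommMonoid E] {ω : Multiset ℝ} (hω : ω.Nodup)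
    (F : ℝ → Multiset ℝ → E) : psum F ω = ∑ x ∈ ω.toFinset, F x (ω.erase x) := by
  rw [psum, Finset.sum, Multiset.toFinset_val, hω.dedup]

end NormSq

/-! ### The algebraic form of norm conservation -/

section Unitarity

variable {k : Type*} [NormedAddCommGroup k] [InnerProductSpace ℂ k] [CompleteSpace k]

/-- The part of the unitarity conditions that makes the evolution isometric. -/
structure IsometryConditions (A : SignType → (k →L[ℂ] k)) (B Y : k →L[ℂ] k) : Prop where
  isometry : star Y * Y = 1
  zero : A 0 = Y - 1
  one : A 1 = -(Y * star (A (-1)))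
  diss : B + star B = -(star (A 1) * A 1)

/-- The vector after the jump is A₁v + Υw. Its squared norm consists of ‖Υw‖² = ‖w‖², a cross term
that cancels the A₋₁ part of the drift because A₁ = -ΥA₋₁⁺, and ‖A₁v‖², which cancels the B part
because B + B⁺ = -A₁⁺A₁. -/
theorem IsometryConditions.cancel {A : SignType → (k →L[ℂ] k)} {B Y : k →L[ℂ] k}
    (h : IsometryConditions A B Y) (v w : k) :
    2 * reInner (B v + A (-1) w) v + (‖w + (A 1 v + A 0 w)‖ ^ 2 - ‖w‖ ^ 2) = 0 := by
  have hadj : ∀ (T : k →L[ℂ] k) (x y : k), reInner (T x) y = reInner x (star T y) := fun T x y => by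
    rw [reInner_apply, reInner_apply, ContinuousLinearMap.star_eq_adjoint,
      ContinuousLinearMap.adjoint_inner_right]
  have h0 : w + (A 1 v + A 0 w) = A 1 v + Y w := by
    rw [h.zero, sub_apply, one_apply_eq_self]
    abel
  have hY : ∀ x y, reInner (Y x) (Y y) = reInner x y := fun x y => by
    rw [hadj]
    change reInner x ((star Y * Y) y) = _
    rw [h.isometry]; rfl
  have h1 : reInner (A 1 v) (Y w) = -reInner (A (-1) w) v := by
    rw [h.one]
    change reInner (-(Y (star (A (-1)) v))) (Y w) = _
    rw [reInner_comm, map_neg, reInner_comm, hY, reInner_comm, ← hadj]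
  have h2 : ‖A 1 v‖ ^ 2 = -(2 * reInner (B v) v) := by
    have h3 : star (A 1) (A 1 v) = -(B v + star B v) := by
      have := congrArg (fun T : k →L[ℂ] k => T v) h.diss
      simp only [add_apply] at this
      rw [this]
      change _ = -(-(star (A 1) (A 1 v)))
      rw [neg_neg]
    rw [← reInner_self, hadj, h3, map_neg, map_add, ← hadj, reInner_comm v]
    ring
  have h4 : ‖Y w‖ ^ 2 = ‖w‖ ^ 2 := by rw [← reInner_self, hY, reInner_self]
  have h5 : reInner (B v + A (-1) w) v = reInner (B v) v + reInner (A (-1) w) v := by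
    rw [reInner_comm, map_add, reInner_comm v, reInner_comm v]
  rw [h0, norm_add_sq_reInner, h1, h2, h4, h5]
  ring

end Unitarity
end WhiteNoise

namespace WhiteNoise

/-! ### Norm conservation and its consequences on dominated functions -/

section
variable {k : Type*} [NormedAddCommGroup k] [MeasurableSpace k] [BorelSpace k] [SecondCountableTopology k]

theorem Dominated.memLp {D q R : ℝ} {g : Multiset ℝ → k} (hg : Dominated D q R g) :
    MemLp g 2 lam := by
  rw [memLp_two_iff_integrable_sq_norm hg.measurable.aestronglyMeasurable]
  refine ((integrable_wt (mul_nonneg hg.q_nonneg hg.q_nonneg) R).const_mul (D * D)).mono'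
    (hg.measurable.norm.pow_const 2).aestronglyMeasurable (Eventually.of_forall fun ω => ?_)
  rw [Real.norm_of_nonneg (by positivity), ← wt_mul, sq, mul_mul_mul_comm]
  exact mul_self_le_mul_self (norm_nonneg _) (hg.bound ω)

theorem Dominated.add {D₁ q₁ D₂ q₂ R : ℝ} {f g : Multiset ℝ → k} (hf : Dominated D₁ q₁ R f)
    (hg : Dominated D₂ q₂ R g) : Dominated (D₁ + D₂) (q₁ + q₂) R (f + g) := by
  refine ⟨hf.measurable.add hg.measurable, add_nonneg hf.D_nonneg hg.D_nonneg,
    add_nonneg hf.q_nonneg hg.q_nonneg, fun ω => (norm_add_le _ _).trans ?_⟩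
  rw [add_mul]
  refine add_le_add ((hf.bound ω).trans (mul_le_mul_of_nonneg_left ?_ hf.D_nonneg))
    ((hg.bound ω).trans (mul_le_mul_of_nonneg_left ?_ hg.D_nonneg))
  · exact wt_mono hf.q_nonneg (le_add_of_nonneg_right hg.q_nonneg) le_rfl ω
  · exact wt_mono hg.q_nonneg (le_add_of_nonneg_left hf.q_nonneg) le_rfl ω

omit [SecondCountableTopology k] in
theorem Dominated.neg {D q R : ℝ} {g : Multiset ℝ → k} (hg : Dominated D q R g) :
    Dominated D q R fun ω => -g ω :=
  ⟨hg.measurable.neg, hg.D_nonneg, hg.q_nonneg, fun ω => (norm_neg _).trans_le (hg.bound ω)⟩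

theorem Dominated.sub {D₁ q₁ D₂ q₂ R : ℝ} {f g : Multiset ℝ → k} (hf : Dominated D₁ q₁ R f)
    (hg : Dominated D₂ q₂ R g) : Dominated (D₁ + D₂) (q₁ + q₂) R fun ω => f ω - g ω := by
  simp only [sub_eq_add_neg]
  exact hf.add hg.neg

theorem integrableOn_of_dominated {s t D q R : ℝ} {g : ℝ → Multiset ℝ → k}
    (hm : Measurable fun p : ℝ × Multiset ℝ => g p.1 p.2)
    (hg : ∀ r ∈ Ioo s t, Dominated D q R (g r)) (ω : Multiset ℝ) :
    IntegrableOn (fun r => g r ω) (Ioo s t) := by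
  have hm' : Measurable fun r => g r ω := hm.comp measurable_prodMk_right
  exact Measure.integrableOn_of_bounded (M := D * wt q R ω) (by simp) hm'.aestronglyMeasurable
    ((ae_restrict_iff' measurableSet_Ioo).2 (Eventually.of_forall fun r hr => (hg r hr).bound ω))

variable [InnerProductSpace ℂ k] [CompleteSpace k] {A : SignType → (k →L[ℂ] k)} {B Y : k →L[ℂ] k}

/-- A solution of the integral equation has constant norm. -/
theorem integral_norm_sq_eq (hI : IsometryConditions A B Y) {s t D₀ D₁ D₂ q₀ q R : ℝ} (hst : s < t)
    {X Z : ℝ → Multiset ℝ → k} {c : Multiset ℝ → k} (hc : Dominated D₀ q₀ R c)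
    (hXm : Measurable fun p : ℝ × Multiset ℝ => X p.1 p.2)
    (hZm : Measurable fun p : ℝ × Multiset ℝ => Z p.1 p.2)
    (hX : ∀ r ∈ Ioc s t, Dominated D₁ q R (X r)) (hZ : ∀ r ∈ Ioc s t, Dominated D₂ q R (Z r))
    (heq : ∀ᵐ ω ∂lam, ∀ r ∈ Ioc s t, X r ω = c ω +
      (∫ τ in Ioo s r, (B (X τ ω) + A (-1) (Z τ ω))) +
      psum (fun x ω' => if s < x ∧ x < r then A 1 (X x ω') + A 0 (Z x ω') else 0) ω)
    (hadapt : ∀ x ∈ Ioo s t, ∀ ω, X x (x ::ₘ ω) = Z x ω) :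
    ∫ ω, ‖X t ω‖ ^ 2 ∂lam = ∫ ω, ‖c ω‖ ^ 2 ∂lam := by
  have htt : t ∈ Ioc s t := ⟨hst, le_rfl⟩
  have hD₁ := (hX t htt).D_nonneg
  have hD₂ := (hZ t htt).D_nonneg
  have hq := (hX t htt).q_nonneg
  set f : ℝ → Multiset ℝ → k := fun r ω => B (X r ω) + A (-1) (Z r ω) with hf
  have hfm : Measurable fun p : ℝ × Multiset ℝ => f p.1 p.2 :=
    (B.measurable.comp hXm).add ((A (-1)).measurable.comp hZm)
  have hfb : ∀ r ∈ Ioc s t, ∀ ω, ‖f r ω‖ ≤ (‖B‖ * D₁ + ‖A (-1)‖ * D₂) * wt q R ω := by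
    intro r hr ω
    refine (norm_add_le _ _).trans ?_
    rw [add_mul, mul_assoc, mul_assoc]
    exact add_le_add ((B.le_opNorm _).trans (mul_le_mul_of_nonneg_left ((hX r hr).bound ω) (norm_nonneg _)))
      (((A (-1)).le_opNorm _).trans (mul_le_mul_of_nonneg_left ((hZ r hr).bound ω) (norm_nonneg _)))
  -- The drift density of the squared norm, extended by zero outside ]s, t[ so that Mecke's formula
  -- over all of ℝ applies to it.
  set P : ℝ → Multiset ℝ → ℝ := fun r ω => if s < r ∧ r < t then 2 * reInner (f r ω) (X r ω) else 0 with hP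
  have hPm : Measurable fun p : ℝ × Multiset ℝ => P p.1 p.2 := by
    refine Measurable.ite ((measurableSet_lt measurable_const measurable_fst).inter
      (measurableSet_lt measurable_fst measurable_const)) ?_ measurable_const
    exact (Complex.measurable_re.comp (Measurable.inner (𝕜 := ℂ) hfm hXm)).const_mul 2
  set K := 2 * ((‖B‖ * D₁ + ‖A (-1)‖ * D₂) * D₁) with hK
  have hPb : ∀ r ω, ‖P r ω‖ ≤ (Ioo s t).indicator (fun _ => K) r * wt (q * q) R ω := by
    intro r ω
    by_cases hr : r ∈ Ioo s t
    · have hr' : r ∈ Ioc s t := ⟨hr.1, hr.2.le⟩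
      rw [indicator_of_mem hr, hP]
      simp only [if_pos (show s < r ∧ r < t from hr)]
      rw [norm_mul, Real.norm_two, ← wt_mul, hK, mul_assoc, mul_assoc]
      refine mul_le_mul_of_nonneg_left ?_ zero_le_two
      refine (abs_reInner_le _ _).trans ((mul_le_mul (hfb r hr' ω) ((hX r hr').bound ω)
        (norm_nonneg _) ?_).trans_eq (by ring))
      exact (norm_nonneg _).trans (hfb r hr' ω)
    · rw [indicator_of_notMem hr, hP]
      simp only [if_neg (show ¬ (s < r ∧ r < t) from hr)]
      simp
  have hPi : Integrable (fun p : ℝ × Multiset ℝ => P p.1 p.2) (volume.prod lam) :=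
    Integrable.mono' (Integrable.mul_prod (f := (Ioo s t).indicator fun _ => K)
      ((integrable_indicator_iff measurableSet_Ioo).2 (integrableOn_const (by simp)))
      (integrable_wt (mul_nonneg hq hq) R)) hPm.aestronglyMeasurable
      (Eventually.of_forall fun p => hPb p.1 p.2)
  -- By adaptedness the value before the jump at x is Z x (ω∖x), so `cancel` makes the jump of the
  -- square at x equal to -P at (x, ω∖x). Simplicity of ω makes the jump times distinct.
  have hpt : ∀ᵐ ω ∂lam, ‖X t ω‖ ^ 2 = ‖c ω‖ ^ 2 + (∫ r, P r ω) + psum (fun x ω' => -P x ω') ω := by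
    filter_upwards [heq, ae_nodup] with ω hω hnd
    have hfi : IntegrableOn (fun r => f r ω) (Ioo s t) := by
      refine Measure.integrableOn_of_bounded (M := (‖B‖ * D₁ + ‖A (-1)‖ * D₂) * wt q R ω) (by simp)
        (hfm.comp measurable_prodMk_right).aestronglyMeasurable
        ((ae_restrict_iff' measurableSet_Ioo).2 (Eventually.of_forall fun r hr => ?_))
      exact hfb r ⟨hr.1, hr.2.le⟩ ω
    have hPeq : ∀ r, P r ω = (Ioo s t).indicator (fun r => 2 * reInner (f r ω) (X r ω)) r := by
      intro r
      by_cases hr : r ∈ Ioo s t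
      · rw [indicator_of_mem hr]; exact if_pos hr
      · rw [indicator_of_notMem hr]; exact if_neg hr
    have hXi : IntegrableOn (fun r => 2 * reInner (f r ω) (X r ω)) (Ioo s t) := by
      rw [← integrable_indicator_iff measurableSet_Ioo]
      refine Integrable.mono' (g := (Ioo s t).indicator fun _ => K * wt (q * q) R ω)
        ((integrable_indicator_iff measurableSet_Ioo).2 (integrableOn_const (by simp))) ?_
        (Eventually.of_forall fun r => ?_)
      · have h : Measurable fun r => P r ω := hPm.comp measurable_prodMk_right
        simp only [hPeq] at h
        exact h.aestronglyMeasurable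
      · rw [← hPeq]
        refine (hPb r ω).trans_eq ?_
        by_cases hr : r ∈ Ioo s t
        · simp only [indicator_of_mem hr]
        · simp only [indicator_of_notMem hr, zero_mul]
    have hj := norm_sq_of_jumps (X := fun r => X r ω) (f := fun r => f r ω) (c := c ω)
      (J := fun x => A 1 (X x (ω.erase x)) + A 0 (Z x (ω.erase x))) ω.toFinset t hst hfi hXi
      (fun r hr => by rw [hω r hr, psum_eq_sum hnd])
    rw [hj, psum_eq_sum hnd]
    simp only [hPeq]
    rw [integral_indicator measurableSet_Ioo]
    congr 1
    refine Finset.sum_congr rfl fun x hx => ?_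
    by_cases hxt : s < x ∧ x < t
    · have hXZ : X x ω = Z x (ω.erase x) := by
        conv_lhs => rw [← Multiset.cons_erase (Multiset.mem_toFinset.1 hx)]
        exact hadapt x hxt _
      rw [if_pos hxt, hXZ]
      have := hI.cancel (X x (ω.erase x)) (Z x (ω.erase x))
      simp only [hP, hf, if_pos hxt]
      linarith
    · rw [if_neg hxt]
      simp only [hP, if_neg hxt, neg_zero]
  -- Mecke's formula gives the integrated jumps as -∬P, the opposite of the integrated drift.
  have hsum := integral_psum (f := fun x ω => -P x ω) hPm.neg.stronglyMeasurable hPi.neg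
  have hPr := hPi.integral_prod_right
  have hswap := integral_integral_swap (f := P) hPi
  have hcm : Integrable (fun ω => ‖c ω‖ ^ 2) lam :=
    (memLp_two_iff_integrable_sq_norm hc.measurable.aestronglyMeasurable).1 hc.memLp
  rw [integral_congr_ae hpt, (integral_add_eq (integral_add_eq ⟨hcm, rfl⟩ ⟨hPr, hswap.symm⟩) hsum).2]
  simp only [integral_neg]
  ring

variable {D q R : ℝ}

/-- The evolution is isometric on dominated functions. -/
theorem integral_norm_sq_kernelOp (hI : IsometryConditions A B Y) {s t : ℝ} (hst : s < t)
    (hs : -R ≤ s) (ht : t ≤ R) {g : Multiset ℝ → k} (hg : Dominated D q R g) :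
    ∫ ω, ‖kernelOp (kernel A B t s) g ω‖ ^ 2 ∂lam = ∫ ω, ‖g ω‖ ^ 2 ∂lam := by
  obtain ⟨C, hC⟩ := exists_forall_norm_le A
  refine integral_norm_sq_eq hI hst hg (X := fun r => kernelOp (kernel A B r s) g)
    (Z := fun r => kernelOp (kernel A B r s) fun ω => g (r ::ₘ ω))
    (measurable_kernelOp A B s measurable_id (G := fun _ => g) (hg.measurable.comp measurable_snd))
    (measurable_kernelOp A B s measurable_id (G := fun r ω => g (r ::ₘ ω))
      (hg.measurable.comp measurable_cons))
    (fun r hr => dominated_kernelOp B hC hs (hr.2.trans ht) hg)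
    (fun r hr => dominated_kernelOp B hC hs (hr.2.trans ht) (hg.cons r))
    (Eventually.of_forall fun ω r hr => kernelOp_eq_integral B hC hs (hr.2.trans ht) hg hr.1 ω)
    fun x _ ω => kernelOp_cons A B (fun h => lt_irrefl _ h.2) g ω

theorem integrableOn_drift {s t : ℝ} (hs : -R ≤ s) (ht : t ≤ R) {g : Multiset ℝ → k}
    (hg : Dominated D q R g) (ω : Multiset ℝ) :
    IntegrableOn (fun r => B (kernelOp (kernel A B r s) g ω) +
      A (-1) (kernelOp (kernel A B r s) (fun ω' => g (r ::ₘ ω')) ω)) (Ioo s t) := by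
  obtain ⟨C, hC⟩ := exists_forall_norm_le A
  have i1 := integrableOn_of_dominated (s := s) (g := fun r => kernelOp (kernel A B r s) g)
    (measurable_kernelOp A B s measurable_id (G := fun _ => g)
      (hg.measurable.comp measurable_snd))
    (fun r hr => dominated_kernelOp B hC hs (hr.2.le.trans ht) hg) ω
  have i2 := integrableOn_of_dominated (s := s)
    (g := fun r => kernelOp (kernel A B r s) fun ω' => g (r ::ₘ ω'))
    (measurable_kernelOp A B s measurable_id (G := fun r ω => g (r ::ₘ ω))
      (hg.measurable.comp measurable_cons))
    (fun r hr => dominated_kernelOp B hC hs (hr.2.le.trans ht) (hg.cons r)) ω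
  exact (B.integrable_comp i1).add ((A (-1)).integrable_comp i2)

/-- The equation between the times m and r, obtained by subtraction. A point of ω at m itself would
be counted in neither ]s, m[ nor ]m, r[, hence m ∉ ω. -/
theorem kernelOp_eq_integral_from {s m r : ℝ} (hsm : s < m) (hmr : m < r) (hs : -R ≤ s) (hr : r ≤ R)
    {g : Multiset ℝ → k} (hg : Dominated D q R g) {ω : Multiset ℝ} (hm : m ∉ ω) :
    kernelOp (kernel A B r s) g ω = kernelOp (kernel A B m s) g ω +
      (∫ τ in Ioo m r, (B (kernelOp (kernel A B τ s) g ω) +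
        A (-1) (kernelOp (kernel A B τ s) (fun ω' => g (τ ::ₘ ω')) ω))) +
      psum (fun x ω' => if m < x ∧ x < r then
        A 1 (kernelOp (kernel A B x s) g ω') +
        A 0 (kernelOp (kernel A B x s) (fun ω'' => g (x ::ₘ ω'')) ω') else 0) ω := by
  obtain ⟨C, hC⟩ := exists_forall_norm_le A
  rw [kernelOp_eq_integral B hC hs hr hg (hsm.trans hmr),
    kernelOp_eq_integral B hC hs (hmr.le.trans hr) hg hsm,
    setIntegral_Ioo_split hsm hmr (integrableOn_drift hs hr hg ω)]
  have : psum (fun x ω' => if s < x ∧ x < r then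
        A 1 (kernelOp (kernel A B x s) g ω') +
        A 0 (kernelOp (kernel A B x s) (fun ω'' => g (x ::ₘ ω'')) ω') else 0) ω =
      psum (fun x ω' => if s < x ∧ x < m then
        A 1 (kernelOp (kernel A B x s) g ω') +
        A 0 (kernelOp (kernel A B x s) (fun ω'' => g (x ::ₘ ω'')) ω') else 0) ω +
      psum (fun x ω' => if m < x ∧ x < r then
        A 1 (kernelOp (kernel A B x s) g ω') +
        A 0 (kernelOp (kernel A B x s) (fun ω'' => g (x ::ₘ ω'')) ω') else 0) ω := by
    rw [← psum_add]
    refine psum_congr fun x ω' hx => ?_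
    have hxm : x ≠ m := by
      rintro rfl
      exact hm (hx ▸ Multiset.mem_cons_self _ _)
    rcases lt_or_gt_of_ne hxm with h | h
    · simp only [h, h.trans hmr, and_true, not_lt.2 h.le, if_false, add_zero]
    · simp only [h, hsm.trans h, true_and, not_lt.2 h.le, if_false, and_false, zero_add]
  rw [this]
  abel

/-- The composition law on dominated functions. -/
theorem kernelOp_comp (hI : IsometryConditions A B Y) {s m t : ℝ} (hsm : s < m) (hmt : m < t)
    (hs : -R ≤ s) (ht : t ≤ R) {g : Multiset ℝ → k} (hg : Dominated D q R g) :
    kernelOp (kernel A B t m) (kernelOp (kernel A B m s) g) =ᵐ[lam] kernelOp (kernel A B t s) g := by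
  obtain ⟨C, hC⟩ := exists_forall_norm_le A
  have hm : -R ≤ m := hs.trans hsm.le
  have hmR : m ≤ R := hmt.le.trans ht
  set h := kernelOp (kernel A B m s) g with hh
  have hhd := dominated_kernelOp B hC hs hmR hg
  rw [← hh] at hhd
  have hX : ∀ r ∈ Ioc m t, Dominated _ _ R fun ω =>
      kernelOp (kernel A B r m) h ω - kernelOp (kernel A B r s) g ω := fun r hr =>
    (dominated_kernelOp B hC hm (hr.2.trans ht) hhd).sub
      (dominated_kernelOp B hC hs (hr.2.trans ht) hg)
  -- The difference of the restarted and the original evolution solves the same linear equation on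
  -- [m, t] with initial value 0, so its norm stays 0.
  have key := integral_norm_sq_eq hI hmt (c := fun _ => (0 : k)) (R := R) (D₀ := 0) (q₀ := 0)
    ⟨measurable_const, le_rfl, le_rfl, fun ω => by simp⟩
    (X := fun r ω => kernelOp (kernel A B r m) h ω - kernelOp (kernel A B r s) g ω)
    (Z := fun r ω => kernelOp (kernel A B r m) (fun ω => h (r ::ₘ ω)) ω -
      kernelOp (kernel A B r s) (fun ω => g (r ::ₘ ω)) ω)
    ((measurable_kernelOp A B m measurable_id (G := fun _ => h) (hhd.measurable.comp measurable_snd)).sub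
      (measurable_kernelOp A B s measurable_id (G := fun _ => g) (hg.measurable.comp measurable_snd)))
    ((measurable_kernelOp A B m measurable_id (G := fun r ω => h (r ::ₘ ω))
      (hhd.measurable.comp measurable_cons)).sub
      (measurable_kernelOp A B s measurable_id (G := fun r ω => g (r ::ₘ ω))
      (hg.measurable.comp measurable_cons)))
    hX
    (fun r hr => (dominated_kernelOp B hC hm (hr.2.trans ht) (hhd.cons r)).sub
      (dominated_kernelOp B hC hs (hr.2.trans ht) (hg.cons r)))
    (by
      filter_upwards [ae_notMem m] with ω hω r hr
      rw [kernelOp_eq_integral B hC hm (hr.2.trans ht) hhd hr.1,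
        kernelOp_eq_integral_from hsm hr.1 hs (hr.2.trans ht) hg hω, ← hh]
      have hi1 := integrableOn_drift (A := A) (B := B) hm (hr.2.trans ht) hhd ω
      have hi2 := (integrableOn_drift (A := A) (B := B) hs (hr.2.trans ht) hg ω).mono_set
        (Ioo_subset_Ioo_left hsm.le)
      have e1 : ∀ τ, B (kernelOp (kernel A B τ m) h ω - kernelOp (kernel A B τ s) g ω) +
          A (-1) (kernelOp (kernel A B τ m) (fun ω => h (τ ::ₘ ω)) ω -
            kernelOp (kernel A B τ s) (fun ω => g (τ ::ₘ ω)) ω) =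
          (B (kernelOp (kernel A B τ m) h ω) +
            A (-1) (kernelOp (kernel A B τ m) (fun ω => h (τ ::ₘ ω)) ω)) -
          (B (kernelOp (kernel A B τ s) g ω) +
            A (-1) (kernelOp (kernel A B τ s) (fun ω => g (τ ::ₘ ω)) ω)) := fun τ => by
        simp only [map_sub]; abel
      simp only [e1]
      rw [integral_sub hi1 hi2]
      have e2 : psum (fun x ω' => if m < x ∧ x < r then
          A 1 (kernelOp (kernel A B x m) h ω') +
            A 0 (kernelOp (kernel A B x m) (fun ω'' => h (x ::ₘ ω'')) ω') else 0) ω =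
          psum (fun x ω' => if m < x ∧ x < r then
            A 1 (kernelOp (kernel A B x m) h ω' - kernelOp (kernel A B x s) g ω') +
            A 0 (kernelOp (kernel A B x m) (fun ω'' => h (x ::ₘ ω'')) ω' -
              kernelOp (kernel A B x s) (fun ω'' => g (x ::ₘ ω'')) ω') else 0) ω +
          psum (fun x ω' => if m < x ∧ x < r then
            A 1 (kernelOp (kernel A B x s) g ω') +
            A 0 (kernelOp (kernel A B x s) (fun ω'' => g (x ::ₘ ω'')) ω') else 0) ω := by
        rw [← psum_add]
        refine psum_congr fun x ω' _ => ?_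
        split_ifs
        · simp only [map_sub]; abel
        · simp
      rw [e2]
      abel)
    (fun x hx ω => by
      rw [kernelOp_cons A B (fun h => lt_irrefl _ h.2), kernelOp_cons A B (fun h => lt_irrefl _ h.2)])
  simp only [norm_zero, ne_eq, OfNat.ofNat_ne_zero, not_false_eq_true, zero_pow, integral_zero] at key
  have hXt := hX t ⟨hmt, le_rfl⟩
  have hint := (memLp_two_iff_integrable_sq_norm hXt.measurable.aestronglyMeasurable).1 hXt.memLp
  rw [integral_eq_zero_iff_of_nonneg (fun ω => by positivity) hint] at key
  filter_upwards [key] with ω hω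
  have : ‖kernelOp (kernel A B t m) h ω - kernelOp (kernel A B t s) g ω‖ ^ 2 = 0 := hω
  exact sub_eq_zero.1 (norm_eq_zero.1 (pow_eq_zero_iff two_ne_zero |>.1 this))

/-- The evolution is continuous at the initial time, pointwise. -/
theorem tendsto_kernelOp {s : ℝ} (hs : -R ≤ s) (hsR : s < R) {g : Multiset ℝ → k}
    (hg : Dominated D q R g) (ω : Multiset ℝ) :
    Tendsto (fun t => kernelOp (kernel A B t s) g ω) (𝓝[>] s) (𝓝 (g ω)) := by
  obtain ⟨C, hC⟩ := exists_forall_norm_le A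
  have hmem : ∀ᶠ t in 𝓝[>] s, t ∈ Ioo s R := Ioo_mem_nhdsGT hsR
  -- A configuration is finite, so for t close enough to s it has no point in ]s, t[ and only the
  -- drift remains.
  have hjump : ∀ᶠ t in 𝓝[>] s, ∀ x ∈ ω.toFinset, ¬ (s < x ∧ x < t) := by
    refine (Finset.eventually_all ω.toFinset).2 fun x _ => ?_
    by_cases hx : s < x
    · filter_upwards [Ioo_mem_nhdsGT hx] with t ht h
      exact lt_asymm h.2 ht.2
    · exact Eventually.of_forall fun t h => hx h.1
  have hint := integrableOn_drift (A := A) (B := B) hs le_rfl hg ω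
  set f := fun r => B (kernelOp (kernel A B r s) g ω) +
      A (-1) (kernelOp (kernel A B r s) (fun ω' => g (r ::ₘ ω')) ω)
  have hlim : Tendsto (fun t => ∫ r in Ioo s t, f r) (𝓝[>] s) (𝓝 0) := by
    have hcont : ContinuousOn (fun t => ∫ r in s..t, f r) (uIcc s R) :=
      intervalIntegral.continuousOn_primitive_interval (by
        rw [uIcc_of_le hsR.le, integrableOn_Icc_iff_integrableOn_Ioo]; exact hint)
    have h1 := (hcont s left_mem_uIcc).mono_left (nhdsWithin_mono s (s := Ioo s R)
      (by rw [uIcc_of_le hsR.le]; exact Ioo_subset_Icc_self))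
    simp only [intervalIntegral.integral_same] at h1
    rw [nhdsWithin_Ioo_eq_nhdsGT hsR] at h1
    refine h1.congr' ?_
    filter_upwards [hmem] with t ht
    rw [intervalIntegral.integral_of_le ht.1.le, integral_Ioc_eq_integral_Ioo]
  have : Tendsto (fun t => g ω + ∫ r in Ioo s t, f r) (𝓝[>] s) (𝓝 (g ω)) := by
    simpa using hlim.const_add (g ω)
  refine this.congr' ?_
  filter_upwards [hmem, hjump] with t ht hj
  rw [kernelOp_eq_integral B hC hs ht.2.le hg ht.1, psum_congr (G := fun _ _ => (0 : k))]
  · simp [psum, f]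
  · intro x ω' hx
    exact if_neg (hj x (Multiset.mem_toFinset.2 (hx ▸ Multiset.mem_cons_self _ _)))

/-- The evolution is strongly continuous at the initial time. -/
theorem tendsto_integral_norm_sq_kernelOp {s : ℝ} (hs : -R ≤ s) (hsR : s < R) {g : Multiset ℝ → k}
    (hg : Dominated D q R g) :
    Tendsto (fun t => ∫ ω, ‖kernelOp (kernel A B t s) g ω - g ω‖ ^ 2 ∂lam) (𝓝[>] s) (𝓝 0) := by
  obtain ⟨C, hC⟩ := exists_forall_norm_le A
  have hC0 : 0 ≤ C := (norm_nonneg _).trans (hC 0)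
  set M := Real.exp (2 * R * ‖B‖) * D * ∫ υ, wt (C * q) R υ ∂lam
  set q' := C + (C * q + q) with hq'
  have hq'0 : 0 ≤ q' := add_nonneg hC0 (add_nonneg (mul_nonneg hC0 hg.q_nonneg) hg.q_nonneg)
  have hqq : q ≤ q' := by
    have := mul_nonneg hC0 hg.q_nonneg
    linarith
  have hmem : ∀ᶠ t in 𝓝[>] s, t ∈ Ioo s R := Ioo_mem_nhdsGT hsR
  have h0 : ∫ ω : Multiset ℝ, (0 : ℝ) ∂lam = 0 := integral_zero _ _
  rw [← h0]
  refine tendsto_integral_filter_of_dominated_convergence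
    (fun ω => ((M + D) * (M + D)) * wt (q' * q') R ω) ?_ ?_
    ((integrable_wt (mul_nonneg hq'0 hq'0) R).const_mul _) ?_
  · filter_upwards [hmem] with t ht
    exact (((dominated_kernelOp B hC hs ht.2.le hg).measurable.sub hg.measurable).norm.pow_const 2).aestronglyMeasurable
  · filter_upwards [hmem] with t ht
    refine Eventually.of_forall fun ω => ?_
    rw [Real.norm_of_nonneg (by positivity), ← wt_mul, sq, mul_mul_mul_comm]
    refine mul_self_le_mul_self (norm_nonneg _) ((norm_sub_le _ _).trans ?_)
    rw [add_mul]
    exact add_le_add ((dominated_kernelOp B hC hs ht.2.le hg).bound ω)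
      ((hg.bound ω).trans (mul_le_mul_of_nonneg_left (wt_mono hg.q_nonneg hqq le_rfl ω) hg.D_nonneg))
  · refine Eventually.of_forall fun ω => ?_
    have h1 := (((tendsto_kernelOp (A := A) (B := B) hs hsR hg ω).sub_const (g ω)).norm).pow 2
    simpa using h1

end
end WhiteNoise

namespace WhiteNoise

/-! ### The adjoint of the evolution on dominated functions -/

/-- Time reversal of configurations. -/
def reflect (ω : Multiset ℝ) : Multiset ℝ := ω.map Neg.neg

@[simp] theorem reflect_reflect (ω : Multiset ℝ) : reflect (reflect ω) = ω := by
  simp [reflect]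

theorem reflect_add (α β : Multiset ℝ) : reflect (α + β) = reflect α + reflect β :=
  Multiset.map_add _ _ _

theorem measurePreserving_reflect : MeasurePreserving reflect lam lam := by
  let S : Words → Words := fun w => ⟨w.1, -w.2⟩
  have hcomm : ∀ w, reflect (points w) = points (S w) := by
    intro w
    simp only [reflect, points, S, Multiset.map_map, Function.comp_def, Pi.neg_apply]
  have hS : Measurable S := by
    intro s hs
    refine MeasurableSpace.measurableSet_iInf.2 fun n => ?_
    exact measurable_neg (measurable_word n hs)
  have hrefl : Measurable reflect := by
    intro s hs
    have : Measurable fun w => reflect (points w) := by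
      simp only [hcomm]
      exact measurable_points.comp hS
    exact this hs
  have hSmp : ∀ s, MeasurableSet s → wordMeasure (S ⁻¹' s) = wordMeasure s := by
    intro s hs
    rw [wordMeasure, Measure.sum_apply _ (hS hs), Measure.sum_apply _ hs]
    congr 1
    ext n
    rw [Measure.smul_apply, Measure.smul_apply, Measure.map_apply (measurable_word n) (hS hs),
      Measure.map_apply (measurable_word n) hs]
    have h := (Measure.measurePreserving_neg (volume : Measure (Fin n → ℝ))).measure_preimage
      (measurable_word n hs).nullMeasurableSet
    rw [← h]
    rfl
  refine ⟨hrefl, Measure.ext fun s hs => ?_⟩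
  rw [Measure.map_apply hrefl hs, lam, Measure.map_apply measurable_points (hrefl hs),
    Measure.map_apply measurable_points hs, ← hSmp _ (measurable_points hs)]
  congr 1
  ext w
  simp only [mem_preimage, hcomm]

theorem integral_reflect {E : Type*} [NormedAddCommGroup E] [NormedSpace ℝ E] (f : Multiset ℝ → E) :
    ∫ ω, f (reflect ω) ∂lam = ∫ ω, f ω ∂lam := by
  let e : Multiset ℝ ≃ᵐ Multiset ℝ :=
    ⟨⟨reflect, reflect, reflect_reflect, reflect_reflect⟩, measurePreserving_reflect.measurable,
      measurePreserving_reflect.measurable⟩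
  exact measurePreserving_reflect.integral_comp e.measurableEmbedding f

theorem wt_reflect (q R : ℝ) (ω : Multiset ℝ) : wt q R (reflect ω) = wt q R ω := by
  induction ω using Multiset.induction_on with
  | empty => rfl
  | cons a ω ih =>
    have : reflect (a ::ₘ ω) = (-a) ::ₘ reflect ω := by simp [reflect]
    rw [this, wt_cons, wt_cons, ih]
    congr 1
    by_cases h : a ∈ Icc (-R) R
    · rw [indicator_of_mem h, indicator_of_mem (show -a ∈ Icc (-R) R from
        ⟨neg_le_neg h.2, neg_le.1 h.1⟩)]
    · rw [indicator_of_notMem h, indicator_of_notMem (show -a ∉ Icc (-R) R from fun h' =>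
        h ⟨neg_le.1 h'.2, neg_le_neg_iff.1 h'.1⟩)]

section

variable {E : Type*} [NormedAddCommGroup E] [NormedSpace ℝ E] [MeasurableSpace E] [BorelSpace E]
  [SecondCountableTopology E] [CompleteSpace E]

/-- By the sum-integral lemma both sides are the triple integral of Φ; a point set that is summed
over and one that is integrated over may exchange roles. This is the duality between creation and
annihilation. -/
theorem integral_asum_integral_swap {K a b c R : ℝ} (ha : 0 ≤ a) (hb : 0 ≤ b) (hc : 0 ≤ c)
    {Φ : Multiset ℝ → Multiset ℝ → Multiset ℝ → E}
    (hm : Measurable fun p : Multiset ℝ × Multiset ℝ × Multiset ℝ => Φ p.1 p.2.1 p.2.2)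
    (hΦ : ∀ α ρ υ, ‖Φ α ρ υ‖ ≤ K * (wt a R α * wt b R ρ * wt c R υ)) :
    ∫ ω, asum (fun α ρ => ∫ υ, Φ α ρ υ ∂lam) ω ∂lam =
      ∫ ω, asum (fun υ ρ => ∫ α, Φ α ρ υ ∂lam) ω ∂lam := by
  have iw : ∀ {a b : ℝ}, 0 ≤ a → 0 ≤ b →
      Integrable (fun p : Multiset ℝ × Multiset ℝ => wt a R p.1 * wt b R p.2) (lam.prod lam) :=
    fun ha hb => (integrable_wt ha R).mul_prod (integrable_wt hb R)
  have hm1 : StronglyMeasurable fun p : Multiset ℝ × Multiset ℝ => ∫ υ, Φ p.1 p.2 υ ∂lam := by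
    have : Measurable fun p : (Multiset ℝ × Multiset ℝ) × Multiset ℝ => Φ p.1.1 p.1.2 p.2 :=
      hm.comp (f := fun p : (Multiset ℝ × Multiset ℝ) × Multiset ℝ => (p.1.1, p.1.2, p.2)) (by fun_prop)
    exact this.stronglyMeasurable.integral_prod_right
  have hm2 : StronglyMeasurable fun p : Multiset ℝ × Multiset ℝ => ∫ α, Φ α p.2 p.1 ∂lam := by
    have : Measurable fun p : (Multiset ℝ × Multiset ℝ) × Multiset ℝ => Φ p.2 p.1.2 p.1.1 :=
      hm.comp (f := fun p : (Multiset ℝ × Multiset ℝ) × Multiset ℝ => (p.2, p.1.2, p.1.1)) (by fun_prop)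
    exact this.stronglyMeasurable.integral_prod_right
  have hi1 : Integrable (fun p : Multiset ℝ × Multiset ℝ => ∫ υ, Φ p.1 p.2 υ ∂lam) (lam.prod lam) := by
    refine ((iw ha hb).const_mul (K * ∫ υ, wt c R υ ∂lam)).mono' hm1.aestronglyMeasurable
      (Eventually.of_forall fun p => (norm_integral_le_of_norm_le
        ((integrable_wt hc R).const_mul (K * (wt a R p.1 * wt b R p.2)))
        (Eventually.of_forall fun υ => ?_)).trans_eq ?_)
    · exact (hΦ _ _ _).trans_eq (by ring)
    · rw [integral_const_mul]; ring
  have hi2 : Integrable (fun p : Multiset ℝ × Multiset ℝ => ∫ α, Φ α p.2 p.1 ∂lam) (lam.prod lam) := by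
    refine ((iw hc hb).const_mul (K * ∫ υ, wt a R υ ∂lam)).mono' hm2.aestronglyMeasurable
      (Eventually.of_forall fun p => (norm_integral_le_of_norm_le
        ((integrable_wt ha R).const_mul (K * (wt c R p.1 * wt b R p.2)))
        (Eventually.of_forall fun υ => ?_)).trans_eq ?_)
    · exact (hΦ _ _ _).trans_eq (by ring)
    · rw [integral_const_mul]; ring
  rw [(integral_asum (f := fun α ρ => ∫ υ, Φ α ρ υ ∂lam) hm1 hi1).2,
    (integral_asum (f := fun υ ρ => ∫ α, Φ α ρ υ ∂lam) hm2 hi2).2,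
    integral_integral_swap (f := fun α ρ => ∫ υ, Φ α ρ υ ∂lam) hi1,
    integral_integral_swap (f := fun υ ρ => ∫ α, Φ α ρ υ ∂lam) hi2]
  refine integral_congr_ae (Eventually.of_forall fun ρ => ?_)
  refine integral_integral_swap (f := fun α υ => Φ α ρ υ) ?_
  refine ((iw ha hc).const_mul (K * wt b R ρ)).mono' ?_ (Eventually.of_forall fun p => ?_)
  · exact (hm.comp (f := fun p : Multiset ℝ × Multiset ℝ => (p.1, ρ, p.2))
      (by fun_prop)).aestronglyMeasurable
  · exact (hΦ _ _ _).trans_eq (by ring)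

end

variable {k : Type*} [NormedAddCommGroup k] [InnerProductSpace ℂ k] [CompleteSpace k]

theorem inner_kernelOp {F : Multiset ℝ → Multiset ℝ → Multiset ℝ → (k →L[ℂ] k)} {f g : Multiset ℝ → k}
    (hi : ∀ α β ρ, Integrable (fun υ => F α β υ (g (ρ + υ))) lam) (ω : Multiset ℝ) :
    inner ℂ (f ω) (kernelOp F g ω) = asum (fun α ρ =>
      ∫ υ, asum (fun β _ => inner ℂ (f (α + ρ)) (F α β υ (g (ρ + υ)))) ρ ∂lam) ω := by
  rw [kernelOp_eq, ← innerSL_apply_apply ℂ, map_asum]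
  refine asum_congr fun α ρ h => ?_
  rw [map_asum, (integral_asum_comm (fun β _ => (hi α β ρ).const_inner (f (α + ρ))) ρ).2]
  refine asum_congr fun β _ _ => ?_
  rw [innerSL_apply_apply, integral_inner (hi α β ρ), h]

/-- The time reversed adjoint kernel acts as the time reversal of the adjoint evolution. -/
theorem kernelOp_star_kernel (A : SignType → (k →L[ℂ] k)) (B : k →L[ℂ] k) (s t : ℝ)
    (f : Multiset ℝ → k) (ω : Multiset ℝ) :
    kernelOp (fun α β υ => star (kernel A B t s υ β α)) f ω =
      kernelOp (kernel (adjCoeff A) (star B) (-s) (-t)) (fun ω => f (reflect ω)) (reflect ω) := by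
  rw [kernelOp_eq, kernelOp_eq, reflect, asum_map]
  refine asum_congr fun α ρ _ => ?_
  rw [asum_map]
  refine asum_congr fun β _ _ => ?_
  rw [← integral_reflect]
  refine integral_congr_ae (Eventually.of_forall fun υ => ?_)
  simp only [star_kernel, ← reflect.eq_def, reflect_reflect, reflect_add]

variable [MeasurableSpace k] [BorelSpace k] [SecondCountableTopology k]

omit [InnerProductSpace ℂ k] [CompleteSpace k] [BorelSpace k] [SecondCountableTopology k] in
theorem Dominated.reflect {D q R : ℝ} {g : Multiset ℝ → k} (hg : Dominated D q R g) :
    Dominated D q R fun ω => g (reflect ω) :=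
  ⟨hg.measurable.comp measurePreserving_reflect.measurable, hg.D_nonneg, hg.q_nonneg, fun ω =>
    (hg.bound _).trans_eq (by rw [wt_reflect])⟩

/-- In the inner product the created points α are summed and the annihilated points υ integrated.
Swapping the two and moving each kernel to the left factor gives the action of the adjoint kernel
with α and υ interchanged, which is a time reversed evolution. -/
theorem integral_inner_kernelOp (A : SignType → (k →L[ℂ] k)) (B : k →L[ℂ] k) {s t R D q D' q' : ℝ}
    (hs : -R ≤ s) (ht : t ≤ R) {f g : Multiset ℝ → k} (hf : Dominated D' q' R f)
    (hg : Dominated D q R g) :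
    ∫ ω, inner ℂ (f ω) (kernelOp (kernel A B t s) g ω) ∂lam =
      ∫ ω, inner ℂ (kernelOp (kernel (adjCoeff A) (star B) (-s) (-t))
        (fun ω => f (reflect ω)) (reflect ω)) (g ω) ∂lam := by
  obtain ⟨C, hC⟩ := exists_forall_norm_le A
  have hC0 : 0 ≤ C := (norm_nonneg _).trans (hC 0)
  have hC' : ∀ i, ‖adjCoeff A i‖ ≤ C := fun i => by rw [adjCoeff, norm_star]; exact hC _
  have hi2 : ∀ α β ρ, Integrable (fun υ => star (kernel A B t s υ β α) (f (ρ + υ))) lam := by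
    intro α β ρ
    have h := measurePreserving_reflect.integrable_comp_of_integrable
      (integrable_kernel_apply (star B) hC' (neg_le_neg ht) (neg_le.1 hs) hf.reflect
      (reflect α) (reflect β) (reflect ρ))
    refine h.congr (Eventually.of_forall fun υ => ?_)
    simp only [Function.comp_apply, star_kernel, reflect_add, reflect_reflect]
    rfl
  set Φ : Multiset ℝ → Multiset ℝ → Multiset ℝ → ℂ := fun α ρ υ =>
    asum (fun β _ => inner ℂ (f (α + ρ)) (kernel A B t s α β υ (g (ρ + υ)))) ρ with hΦ
  have hm : Measurable fun p : Multiset ℝ × Multiset ℝ × Multiset ℝ => Φ p.1 p.2.1 p.2.2 := by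
    have h := measurable_asum (Y := Multiset ℝ × Multiset ℝ × Multiset ℝ)
      (F := fun p β _ => (inner ℂ (f (p.1 + p.2.1)) (kernel A B t s p.1 β p.2.2 (g (p.2.1 + p.2.2))) : ℂ)) ?_
    · exact h.comp (f := fun p : Multiset ℝ × Multiset ℝ × Multiset ℝ => (p, p.2.1)) (by fun_prop)
    · refine Measurable.inner (hf.measurable.comp (Measurable.multiset_add (by fun_prop) (by fun_prop))) ?_
      refine (measurable_kernel_apply A B s).comp
        (f := fun p : (Multiset ℝ × Multiset ℝ × Multiset ℝ) × Multiset ℝ × Multiset ℝ =>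
          ((t, p.1.1, p.2.1, p.1.2.2), g (p.1.2.1 + p.1.2.2))) ?_
      exact Measurable.prodMk (by fun_prop)
        (hg.measurable.comp (Measurable.multiset_add (by fun_prop) (by fun_prop)))
  set K := D' * (Real.exp (2 * R * ‖B‖) * D)
  -- Points of α carry q' from f and C from the kernel, points of υ carry C and q. Points of ρ carry
  -- q'q from both functions, and another C if they lie in β.
  have hbd : ∀ α ρ υ, ‖Φ α ρ υ‖ ≤ K * (wt (q' * C) R α * wt (C * (q' * q) + q' * q) R ρ * wt (C * q) R υ) := by
    intro α ρ υ
    have : K * (wt (q' * C) R α * wt (C * (q' * q) + q' * q) R ρ * wt (C * q) R υ) =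
        asum (fun β γ => K * (wt (q' * C) R α * (wt C R β * wt (q' * q) R ρ) * wt (C * q) R υ)) ρ := by
      rw [← asum_wt, mul_right_comm (wt (q' * C) R α), ← mul_assoc, ← asum_const_mul]
      refine asum_congr fun β γ h => ?_
      rw [h, wt_add, ← wt_mul C (q' * q)]
      ring
    rw [this]
    refine (norm_asum_le _ _).trans (asum_mono (fun β γ => ?_) ρ)
    refine (norm_inner_le_norm _ _).trans ((mul_le_mul (hf.bound _)
      (norm_kernel_apply_le B hC hs ht hg α β ρ υ) (norm_nonneg _)
      ((norm_nonneg _).trans (hf.bound _))).trans_eq ?_)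
    rw [wt_add, ← wt_mul q' C, ← wt_mul q' q]
    ring
  have hswap := integral_asum_integral_swap (mul_nonneg hf.q_nonneg hC0)
    (add_nonneg (mul_nonneg hC0 (mul_nonneg hf.q_nonneg hg.q_nonneg))
      (mul_nonneg hf.q_nonneg hg.q_nonneg)) (mul_nonneg hC0 hg.q_nonneg) hm hbd
  simp only [← kernelOp_star_kernel]
  simp only [inner_kernelOp (integrable_kernel_apply B hC hs ht hg)]
  rw [hswap]
  refine integral_congr_ae (Eventually.of_forall fun ω => ?_)
  beta_reduce
  rw [← inner_conj_symm, inner_kernelOp hi2]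
  have hconj := map_asum (starAddEquiv (R := ℂ)) (fun υ ρ => ∫ α, asum (fun β _ =>
    inner ℂ (g (υ + ρ)) (star (kernel A B t s α β υ) (f (ρ + α)))) ρ ∂lam) ω
  refine Eq.trans ?_ hconj.symm
  refine asum_congr fun υ ρ _ => ?_
  refine Eq.trans ?_ (integral_conj (𝕜 := ℂ)) 
  refine integral_congr_ae (Eventually.of_forall fun α => ?_)
  refine Eq.trans ?_ (map_asum (starAddEquiv (R := ℂ)) _ ρ).symm
  refine asum_congr fun β _ _ => ?_
  rw [ContinuousLinearMap.star_eq_adjoint, ContinuousLinearMap.adjoint_inner_right, add_comm υ ρ,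
    add_comm ρ α]
  exact (inner_conj_symm _ _).symm

end WhiteNoise

namespace WhiteNoise

/-! ### Density of the test functions -/

section Test

variable {k : Type*} [NormedAddCommGroup k]

/-- Test functions are dominated. -/
theorem IsTest.dominated [MeasurableSpace k] [BorelSpace k] {g : Multiset ℝ → k} (hg : IsTest g) :
    ∃ D R₀, ∀ R, R₀ ≤ R → Dominated D 1 R g := by
  have hgm : Measurable g := measurable_of_comp_points fun n =>
    (hg.continuous.comp (continuous_word n)).measurable
  obtain ⟨D, hD⟩ := hg.hasCompactSupport.exists_bound_of_continuous hg.continuous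
  have hnorm : Continuous fun w : Words => ‖w.2‖ := continuous_sigma fun n => continuous_norm
  -- The sup norm is bounded on the compact support, so all coordinates lie in one interval. No
  -- bound on the number of points is needed, since the weight has q = 1.
  obtain ⟨R₀, hR₀⟩ := (IsCompact.image hg.hasCompactSupport hnorm).bddAbove
  refine ⟨D, R₀, fun R hR => ⟨hgm, (norm_nonneg _).trans (hD ⟨0, 0⟩), zero_le_one, fun ω => ?_⟩⟩
  obtain ⟨w, rfl⟩ := exists_points_eq ω
  have hD0 : 0 ≤ D := (norm_nonneg _).trans (hD w)
  by_cases hw : w ∈ tsupport fun w : Words => g (points w)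
  · have hx : ∀ x ∈ points w, x ∈ Icc (-R) R := by
      intro x hx
      obtain ⟨i, -, rfl⟩ := Multiset.mem_map.1 hx
      exact abs_le.1 ((norm_le_pi_norm w.2 i).trans ((hR₀ ⟨w, hw, rfl⟩).trans hR))
    rw [wt_eq_pow hx, one_pow, mul_one]
    exact hD w
  · have : g (points w) = 0 :=
      image_eq_zero_of_notMem_tsupport (f := fun w : Words => g (points w)) hw
    rw [this, norm_zero]
    exact mul_nonneg hD0 (wt_nonneg zero_le_one R _)

variable [NormedSpace ℝ k] {n : ℕ}

open Classical in
/-- The symmetrization of `χ` times the vector `y`. -/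
noncomputable def symmetrized (χ : (Fin n → ℝ) → ℝ) (y : k) (ω : Multiset ℝ) : k :=
  if h : ∃ x : Fin n → ℝ, points (word n x) = ω then
    ∑ σ : Equiv.Perm (Fin n), χ (h.choose ∘ σ) • y else 0

theorem symmetrized_points (χ : (Fin n → ℝ) → ℝ) (y : k) (x : Fin n → ℝ) :
    symmetrized χ y (points (word n x)) = ∑ σ : Equiv.Perm (Fin n), χ (x ∘ σ) • y := by
  have h : ∃ x' : Fin n → ℝ, points (word n x') = points (word n x) := ⟨x, rfl⟩
  obtain ⟨τ, hτ⟩ := points_word_eq_iff.1 h.choose_spec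
  rw [symmetrized, dif_pos h, hτ]
  exact Equiv.sum_comp (Equiv.mulLeft τ) fun σ => χ (x ∘ σ) • y

theorem symmetrized_points_of_ne (χ : (Fin n → ℝ) → ℝ) (y : k) {m : ℕ} (hm : m ≠ n) (x : Fin m → ℝ) :
    symmetrized χ y (points (word m x)) = 0 := by
  refine dif_neg ?_
  rintro ⟨x', hx'⟩
  have := congrArg Multiset.card hx'
  rw [card_points, card_points] at this
  exact hm this.symm

theorem isTest_symmetrized {χ : (Fin n → ℝ) → ℝ} (hχ : Continuous χ) (hc : HasCompactSupport χ)
    (y : k) : IsTest (symmetrized χ y) := by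
  have hcomp : ∀ σ : Equiv.Perm (Fin n), Continuous fun x : Fin n → ℝ => x ∘ σ := fun σ => by
    fun_prop
  constructor
  · refine continuous_sigma fun m => ?_
    by_cases hm : m = n
    · subst hm
      refine (show Continuous fun x : Fin m → ℝ => ∑ σ : Equiv.Perm (Fin m), χ (x ∘ σ) • y from
        continuous_finsetSum _ fun σ _ => (hχ.comp (hcomp σ)).smul continuous_const).congr fun x =>
          (symmetrized_points χ y x).symm
    · exact (continuous_const (y := (0 : k))).congr fun x => (symmetrized_points_of_ne χ y hm x).symm
  · have hK : IsCompact (word n '' ⋃ σ : Equiv.Perm (Fin n), (fun x => x ∘ σ) '' tsupport χ) :=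
      (isCompact_iUnion fun σ => IsCompact.image hc (hcomp σ)).image (continuous_word n)
    have hcl : T2Space Words := inferInstance
    refine HasCompactSupport.intro hK ?_
    rintro ⟨m, x⟩ hx
    by_cases hm : m = n
    · subst hm
      refine (symmetrized_points χ y x).trans (Finset.sum_eq_zero fun σ _ => ?_)
      by_contra hne
      have hσ : x ∘ σ ∈ tsupport χ := subset_tsupport χ fun h0 => hne (by rw [h0, zero_smul])
      refine hx ⟨x, mem_iUnion.2 ⟨σ⁻¹, _, hσ, ?_⟩, rfl⟩
      ext i
      simp
    · exact symmetrized_points_of_ne χ y hm x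

end Test

theorem integral_lam_of_card {E : Type*} [NormedAddCommGroup E] [NormedSpace ℝ E] {F : Multiset ℝ → E}
    {n : ℕ} (hi : Integrable F lam) (hF : ∀ m ≠ n, ∀ x : Fin m → ℝ, F (points (word m x)) = 0) :
    ∫ ω, F ω ∂lam = ((n ! : ℝ≥0∞)⁻¹).toReal • ∫ x : Fin n → ℝ, F (points (word n x)) := by
  have hi' : Integrable (fun w => F (points w)) wordMeasure :=
    (integrable_map_measure hi.aestronglyMeasurable measurable_points.aemeasurable).1 hi
  have hm : ∀ m, AEStronglyMeasurable (fun w => F (points w)) (Measure.map (word m) volume) := by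
    intro m
    refine AEStronglyMeasurable.mono_ac (μ := wordMeasure) ?_ hi'.aestronglyMeasurable
    refine Measure.AbsolutelyContinuous.trans ?_ (Measure.le_sum _ m).absolutelyContinuous
    exact Measure.absolutelyContinuous_smul (by simp)
  rw [lam, integral_map measurable_points.aemeasurable hi.aestronglyMeasurable]
  rw [wordMeasure] at hi' ⊢
  rw [integral_sum_measure hi', tsum_eq_single n]
  · rw [integral_smul_measure, integral_map (measurable_word n).aemeasurable (hm n)]
  · intro m hmn
    rw [integral_smul_measure, integral_map (measurable_word m).aemeasurable (hm m)]
    simp only [hF m hmn, integral_zero, smul_zero]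

theorem ae_lam_of_forall {p : Multiset ℝ → Prop} (hp : MeasurableSet {ω | p ω})
    (h : ∀ n, ∀ᵐ x : Fin n → ℝ, p (points (word n x))) : ∀ᵐ ω ∂lam, p ω := by
  rw [lam, ae_map_iff measurable_points.aemeasurable hp, wordMeasure]
  refine (Measure.ae_sum_iff' (measurable_points hp)).2 ?_
  intro n
  refine Measure.ae_smul_measure ?_ _
  rw [ae_map_iff (measurable_word n).aemeasurable (measurable_points hp)]
  exact h n

theorem memLp_comp_points_word {E : Type*} [NormedAddCommGroup E] {F : Multiset ℝ → E}
    (hF : MemLp F 2 lam) (n : ℕ) : MemLp (fun x : Fin n → ℝ => F (points (word n x))) 2 := by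
  have h1 : MemLp (fun w => F (points w)) 2 wordMeasure :=
    (memLp_map_measure_iff hF.1 measurable_points.aemeasurable).1 hF
  have h2 := (h1.mono_measure (Measure.le_sum _ n)).smul_measure (c := (n ! : ℝ≥0∞)) (by simp)
  rw [smul_smul, ENNReal.mul_inv_cancel (by exact_mod_cast n.factorial_ne_zero) (by simp), one_smul] at h2
  exact (memLp_map_measure_iff h2.1 (measurable_word n).aemeasurable).1 h2

variable {k : Type*} [NormedAddCommGroup k] [InnerProductSpace ℂ k] [CompleteSpace k]
  [TopologicalSpace.SeparableSpace k]

/-- A square integrable function orthogonal to the test functions vanishes. -/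
theorem eq_zero_of_inner_isTest (f : Fock k)
    (hf : ∀ (g : Multiset ℝ → k) (hg : IsTest g), inner ℂ (hg.memLp.toLp g) f = 0) : f = 0 := by
  have hfm := Lp.stronglyMeasurable f
  rw [Lp.eq_zero_iff_ae_eq_zero]
  refine ae_lam_of_forall (hfm.measurableSet_eq_fun stronglyMeasurable_zero) fun n => ?_
  have hmem := memLp_comp_points_word (Lp.memLp f) n
  -- It suffices to test the n-point part on ℝⁿ against smooth compactly supported χ, which need not
  -- be symmetric.
  refine ae_eq_zero_of_integral_contDiff_smul_eq_zero (hmem.locallyIntegrable one_le_two) ?_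
  intro χ hχ hχc
  have hint : Integrable fun x => χ x • f (points (word n x)) := 
    (hmem.locallyIntegrable one_le_two).integrable_smul_left_of_hasCompactSupport hχ.continuous hχc
  refine ext_inner_left ℂ fun y => ?_
  rw [inner_zero_right, ← integral_inner hint]
  -- The hypothesis covers symmetric functions only, so χ is symmetrized. As f is symmetric, the n!
  -- terms have equal integrals, and each of them vanishes with their sum.
  have hg : IsTest (symmetrized χ y) := isTest_symmetrized hχ.continuous hχc y
  have h0 := hf _ hg
  have hae : (fun ω => inner ℂ (hg.memLp.toLp _ ω) (f ω)) =ᵐ[lam]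
      fun ω => inner ℂ (symmetrized χ y ω) (f ω) := by
    filter_upwards [hg.memLp.coeFn_toLp] with ω hω
    rw [hω]
  rw [L2.inner_def, integral_congr_ae hae, integral_lam_of_card (n := n)
    ((L2.integrable_inner _ _).congr hae)
    (fun m hm x => by rw [symmetrized_points_of_ne χ y hm, inner_zero_left]), smul_eq_zero] at h0
  have h1 := h0.resolve_left (by
    rw [ENNReal.toReal_inv]
    simp [Nat.factorial_ne_zero])
  have hcongr : ∀ σ : Equiv.Perm (Fin n), (fun x : Fin n → ℝ => x ∘ σ) =
      MeasurableEquiv.piCongrLeft (fun _ => ℝ) σ.symm := by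
    intro σ
    ext x i
    obtain ⟨j, rfl⟩ := σ.symm.surjective i
    rw [MeasurableEquiv.coe_piCongrLeft, Equiv.piCongrLeft_apply_apply]
    simp
  have hperm : ∀ σ : Equiv.Perm (Fin n), MeasurePreserving (fun x : Fin n → ℝ => x ∘ σ) := fun σ => by
    rw [hcongr]
    exact volume_measurePreserving_piCongrLeft (fun _ => ℝ) σ.symm
  set H : (Fin n → ℝ) → ℂ := fun x => inner ℂ y (χ x • f (points (word n x))) with hH
  have hHi : Integrable H := hint.const_inner y
  have hsum : ∀ x, (inner ℂ (symmetrized χ y (points (word n x))) (f (points (word n x))) : ℂ) =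
      ∑ σ : Equiv.Perm (Fin n), H (x ∘ σ) := by
    intro x
    rw [symmetrized_points, sum_inner]
    refine Finset.sum_congr rfl fun σ _ => ?_
    have : points (word n (x ∘ σ)) = points (word n x) := points_word_eq_iff.2 ⟨σ, rfl⟩
    simp only [hH, this]
    rw [← Complex.coe_smul, ← Complex.coe_smul, inner_smul_left, inner_smul_right, Complex.conj_ofReal]
  simp only [hsum] at h1
  have hHσ : ∀ σ : Equiv.Perm (Fin n), Integrable fun x => H (x ∘ σ) := fun σ =>
    (hperm σ).integrable_comp_of_integrable hHi
  rw [integral_finsetSum _ fun σ _ => hHσ σ] at h1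
  have hinv : ∀ σ : Equiv.Perm (Fin n), ∫ x, H (x ∘ σ) = ∫ x, H x := fun σ =>
    (hperm σ).integral_comp (by
      rw [hcongr]
      exact (MeasurableEquiv.piCongrLeft (fun _ => ℝ) σ.symm).measurableEmbedding) H
  simp only [hinv, Finset.sum_const, smul_eq_zero, Finset.card_univ, Fintype.card_perm] at h1
  exact h1.resolve_left (by simp [Nat.factorial_ne_zero])

/-- The test functions are dense. -/
theorem eq_top_of_isTest_mem {S : Submodule ℂ (Fock k)} (hS : IsClosed (S : Set (Fock k)))
    (h : ∀ (g : Multiset ℝ → k) (hg : IsTest g), hg.memLp.toLp g ∈ S) : S = ⊤ := by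
  have := hS.completeSpace_coe
  rw [← Submodule.orthogonal_eq_bot_iff, Submodule.eq_bot_iff]
  exact fun f hf => eq_zero_of_inner_isTest f fun g hg => hf _ (h g hg)

theorem continuousLinearMap_ext_isTest {E : Type*} [NormedAddCommGroup E] [NormedSpace ℂ E]
    {V W : Fock k →L[ℂ] E}
    (h : ∀ (g : Multiset ℝ → k) (hg : IsTest g), V (hg.memLp.toLp g) = W (hg.memLp.toLp g)) :
    V = W := by
  have := eq_top_of_isTest_mem (S := LinearMap.eqLocus V.toLinearMap W.toLinearMap)
    (isClosed_eq V.continuous W.continuous) h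
  ext1 f
  exact (this ▸ Submodule.mem_top : f ∈ LinearMap.eqLocus V.toLinearMap W.toLinearMap)

end WhiteNoise

namespace WhiteNoise

/-! ### Extension of the forward evolution to unitary operators on Fock space -/

variable {k : Type*} [NormedAddCommGroup k] [MeasurableSpace k] [BorelSpace k]
  [SecondCountableTopology k]

omit [SecondCountableTopology k] in
theorem Dominated.const_smul [NormedSpace ℂ k] {D q R : ℝ} {g : Multiset ℝ → k}
    (hg : Dominated D q R g) (c : ℂ) : Dominated (‖c‖ * D) q R (c • g) := by
  refine ⟨hg.measurable.const_smul c, mul_nonneg (norm_nonneg _) hg.D_nonneg, hg.q_nonneg, fun ω => ?_⟩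
  rw [Pi.smul_apply, norm_smul, mul_assoc]
  exact mul_le_mul_of_nonneg_left (hg.bound ω) (norm_nonneg _)

theorem wt_shift_le {q : ℝ} (hq : 0 ≤ q) (R r : ℝ) (ω : Multiset ℝ) :
    wt q R (shift r ω) ≤ wt q (R + |r|) ω := by
  induction ω using Multiset.induction_on with
  | empty => exact le_rfl
  | cons a ω ih =>
    have : shift r (a ::ₘ ω) = (a + r) ::ₘ shift r ω := by simp [shift]
    rw [this, wt_cons, wt_cons]
    refine mul_le_mul ?_ ih (wt_nonneg hq _ _) (indicator_nonneg (fun _ _ => hq) _)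
    by_cases h : a + r ∈ Icc (-R) R
    · have h' : a ∈ Icc (-(R + |r|)) (R + |r|) := by
        constructor
        · linarith [h.1, le_abs_self r]
        · linarith [h.2, neg_abs_le r]
      rw [indicator_of_mem h, indicator_of_mem h']
    · rw [indicator_of_notMem h]
      exact indicator_nonneg (fun _ _ => hq) _

omit [BorelSpace k] [SecondCountableTopology k] in
theorem Dominated.shift {D q R : ℝ} {g : Multiset ℝ → k} (hg : Dominated D q R g) (r : ℝ) :
    Dominated D q (R + |r|) fun ω => g (shift r ω) :=
  ⟨hg.measurable.comp (measurePreserving_shift r).measurable, hg.D_nonneg, hg.q_nonneg, fun ω =>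
    (hg.bound _).trans (mul_le_mul_of_nonneg_left (wt_shift_le hg.q_nonneg R r ω) hg.D_nonneg)⟩

section

variable [NormedSpace ℂ k]

variable (k) in
/-- The space of dominated functions. -/
noncomputable def dominatedSubmodule : Submodule ℂ (Multiset ℝ → k) where
  carrier := {g | ∃ D q R, Dominated D q R g}
  zero_mem' := ⟨0, 0, 0, measurable_const, le_rfl, le_rfl, fun ω => by simp⟩
  add_mem' := by
    rintro f g ⟨D₁, q₁, R₁, hf⟩ ⟨D₂, q₂, R₂, hg⟩
    exact ⟨_, _, _, (hf.mono le_rfl le_rfl (le_max_left R₁ R₂)).add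
      (hg.mono le_rfl le_rfl (le_max_right R₁ R₂))⟩
  smul_mem' := by
    rintro c g ⟨D, q, R, hg⟩
    exact ⟨_, _, _, hg.const_smul c⟩

theorem memLp_of_mem {g : Multiset ℝ → k} (hg : g ∈ dominatedSubmodule k) : MemLp g 2 lam := by
  obtain ⟨D, q, R, hg⟩ := hg
  exact hg.memLp

theorem exists_dominated {g : Multiset ℝ → k} (hg : g ∈ dominatedSubmodule k) (s t : ℝ) :
    ∃ D q R, -R ≤ s ∧ t ≤ R ∧ Dominated D q R g := by
  obtain ⟨D, q, R, hg⟩ := hg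
  refine ⟨D, q, max R (max (-s) t), ?_, ?_, hg.mono le_rfl le_rfl (le_max_left _ _)⟩
  · exact neg_le.1 ((le_max_left _ _).trans (le_max_right _ _))
  · exact (le_max_right _ _).trans (le_max_right _ _)

theorem IsTest.mem_dominatedSubmodule {g : Multiset ℝ → k} (hg : IsTest g) :
    g ∈ dominatedSubmodule k := by
  obtain ⟨D, R, h⟩ := hg.dominated
  exact ⟨D, 1, R, h R le_rfl⟩

end

variable [InnerProductSpace ℂ k]

variable (k) in
/-- The class of a dominated function in the Fock space. -/
noncomputable def toFock : dominatedSubmodule k →ₗ[ℂ] Fock k where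
  toFun g := (memLp_of_mem g.2).toLp g.1
  map_add' _ _ := MemLp.toLp_add _ _
  map_smul' c _ := MemLp.toLp_const_smul c _

theorem coeFn_toFock (g : dominatedSubmodule k) : toFock k g =ᵐ[lam] g.1 :=
  (memLp_of_mem g.2).coeFn_toLp

theorem toFock_eq_iff {f g : dominatedSubmodule k} : toFock k f = toFock k g ↔ f.1 =ᵐ[lam] g.1 :=
  MemLp.toLp_eq_toLp_iff (memLp_of_mem f.2) (memLp_of_mem g.2)

theorem inner_toFock (f g : dominatedSubmodule k) :
    inner ℂ (toFock k f) (toFock k g) = ∫ ω, inner ℂ (f.1 ω) (g.1 ω) ∂lam := by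
  rw [L2.inner_def]
  refine integral_congr_ae ?_
  filter_upwards [coeFn_toFock f, coeFn_toFock g] with ω hf hg
  rw [hf, hg]

theorem norm_sq_toFock (g : dominatedSubmodule k) : ‖toFock k g‖ ^ 2 = ∫ ω, ‖g.1 ω‖ ^ 2 ∂lam := by
  have h := inner_toFock g g
  simp only [inner_self_eq_norm_sq_to_K] at h
  have : ∀ ω, ((‖g.1 ω‖ : ℂ)) ^ 2 = ((‖g.1 ω‖ ^ 2 : ℝ) : ℂ) := fun ω => by push_cast; rfl
  simp only [Complex.coe_algebraMap, this, integral_complex_ofReal] at h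
  exact_mod_cast h

theorem norm_toFock_eq_iff {f g : dominatedSubmodule k} :
    ‖toFock k f‖ = ‖toFock k g‖ ↔ ∫ ω, ‖f.1 ω‖ ^ 2 ∂lam = ∫ ω, ‖g.1 ω‖ ^ 2 ∂lam := by
  rw [← norm_sq_toFock, ← norm_sq_toFock, sq_eq_sq₀ (norm_nonneg _) (norm_nonneg _)]

variable [CompleteSpace k]

theorem denseRange_toFock : DenseRange (toFock k) := by
  have h : (LinearMap.range (toFock k)).topologicalClosure = ⊤ :=
    eq_top_of_isTest_mem (Submodule.isClosed_topologicalClosure _) fun g hg =>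
      Submodule.le_topologicalClosure _ ⟨⟨g, hg.mem_dominatedSubmodule⟩, rfl⟩
  have := Submodule.dense_iff_topologicalClosure_eq_top.2 h
  rwa [LinearMap.coe_range] at this

theorem clm_ext_toFock {E : Type*} [NormedAddCommGroup E] [NormedSpace ℂ E] {V W : Fock k →L[ℂ] E}
    (h : ∀ g, V (toFock k g) = W (toFock k g)) : V = W :=
  DFunLike.ext _ _ fun f =>
    denseRange_toFock.induction_on f (isClosed_eq V.continuous W.continuous) h

theorem norm_map_of_toFock {V : Fock k →L[ℂ] Fock k} (h : ∀ g, ‖V (toFock k g)‖ = ‖toFock k g‖)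
    (f : Fock k) : ‖V f‖ = ‖f‖ :=
  denseRange_toFock.induction_on f (isClosed_eq (by fun_prop) (by fun_prop)) h

variable (A : SignType → (k →L[ℂ] k)) (B : k →L[ℂ] k)

theorem kernelOp_mem (s t : ℝ) {g : Multiset ℝ → k} (hg : g ∈ dominatedSubmodule k) :
    kernelOp (kernel A B t s) g ∈ dominatedSubmodule k := by
  obtain ⟨C, hC⟩ := exists_forall_norm_le A
  obtain ⟨D, q, R, hs, ht, hg⟩ := exists_dominated hg s t
  exact ⟨_, _, _, dominated_kernelOp B hC hs ht hg⟩

theorem integrable_kernel_apply_of_mem (s t : ℝ) {g : Multiset ℝ → k}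
    (hg : g ∈ dominatedSubmodule k) (α β ρ : Multiset ℝ) :
    Integrable (fun υ => kernel A B t s α β υ (g (ρ + υ))) lam := by
  obtain ⟨C, hC⟩ := exists_forall_norm_le A
  obtain ⟨D, q, R, hs, ht, hg⟩ := exists_dominated hg s t
  exact integrable_kernel_apply B hC hs ht hg α β ρ

/-- The action of the kernel `u^t_s` on the dominated functions. -/
noncomputable def evolve (s t : ℝ) : dominatedSubmodule k →ₗ[ℂ] dominatedSubmodule k where
  toFun g := ⟨kernelOp (kernel A B t s) g.1, kernelOp_mem A B s t g.2⟩
  map_add' f g := by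
    refine Subtype.ext (funext fun ω => ?_)
    change kernelOp _ (f.1 + g.1) ω = kernelOp _ f.1 ω + kernelOp _ g.1 ω
    simp only [kernelOp_eq, ← asum_add]
    refine asum_congr fun α ρ _ => asum_congr fun β _ _ => ?_
    rw [← integral_add (integrable_kernel_apply_of_mem A B s t f.2 α β ρ)
      (integrable_kernel_apply_of_mem A B s t g.2 α β ρ)]
    simp only [Pi.add_apply, map_add]
  map_smul' c g := by
    refine Subtype.ext (funext fun ω => ?_)
    change kernelOp _ (c • g.1) ω = c • kernelOp _ g.1 ω
    have hsm : ∀ (F : Multiset ℝ → Multiset ℝ → k) (ω), c • asum F ω = asum (fun α β => c • F α β) ω :=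
      fun F ω => map_asum (DistribSMul.toAddMonoidHom k c) F ω
    simp only [kernelOp_eq, hsm]
    refine asum_congr fun α ρ _ => asum_congr fun β _ _ => ?_
    rw [← integral_smul]
    simp only [Pi.smul_apply, map_smul]

/-- The forward evolution operator on the Fock space. -/
noncomputable def forwardOp (s t : ℝ) : Fock k →L[ℂ] Fock k :=
  (toFock k ∘ₗ evolve A B s t).extendOfNorm (toFock k)

variable {A B} {Y : k →L[ℂ] k}

theorem norm_toFock_evolve (hI : IsometryConditions A B Y) {s t : ℝ} (hst : s < t)
    (g : dominatedSubmodule k) : ‖toFock k (evolve A B s t g)‖ = ‖toFock k g‖ := by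
  rw [norm_toFock_eq_iff]
  obtain ⟨D, q, R, hs, ht, hg⟩ := exists_dominated g.2 s t
  exact integral_norm_sq_kernelOp hI hst hs ht hg

/-- Isometry supplies the norm bound without which `extendOfNorm` need not extend anything; it also
shows that the evolution respects almost everywhere equality. -/
theorem forwardOp_toFock (hI : IsometryConditions A B Y) {s t : ℝ} (hst : s < t)
    (g : dominatedSubmodule k) :
    forwardOp A B s t (toFock k g) = toFock k (evolve A B s t g) :=
  LinearMap.extendOfNorm_eq (f := toFock k ∘ₗ evolve A B s t) denseRange_toFock
    ⟨1, fun g => by rw [one_mul]; exact (norm_toFock_evolve hI hst g).le⟩ g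

theorem norm_forwardOp (hI : IsometryConditions A B Y) {s t : ℝ} (hst : s < t) (f : Fock k) :
    ‖forwardOp A B s t f‖ = ‖f‖ :=
  norm_map_of_toFock (fun g => by rw [forwardOp_toFock hI hst, norm_toFock_evolve hI hst]) f

theorem forwardOp_mul (hI : IsometryConditions A B Y) {s m t : ℝ} (hsm : s < m) (hmt : m < t) :
    forwardOp A B m t * forwardOp A B s m = forwardOp A B s t := by
  refine clm_ext_toFock fun g => ?_
  rw [mul_apply_eq_comp, forwardOp_toFock hI hsm, forwardOp_toFock hI hmt,
    forwardOp_toFock hI (hsm.trans hmt), toFock_eq_iff]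
  obtain ⟨D, q, R, hs, ht, hg⟩ := exists_dominated g.2 s t
  exact kernelOp_comp hI hsm hmt hs ht hg

/-- On dominated functions the adjoint is reflection, followed by the evolution with the adjoint
coefficients from -t to -s, followed by reflection. All three preserve the norm. -/
theorem norm_star_forwardOp (hI : IsometryConditions A B Y) {Y' : k →L[ℂ] k}
    (hI' : IsometryConditions (adjCoeff A) (star B) Y') {s t : ℝ} (hst : s < t) (f : Fock k) :
    ‖star (forwardOp A B s t) f‖ = ‖f‖ := by
  refine norm_map_of_toFock (fun f => ?_) f
  have hr : ∀ {g : Multiset ℝ → k}, g ∈ dominatedSubmodule k →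
      (fun ω => g (reflect ω)) ∈ dominatedSubmodule k := by
    rintro g ⟨D, q, R, hg⟩
    exact ⟨D, q, R, hg.reflect⟩
  have hst' : -t < -s := neg_lt_neg hst
  let f' : dominatedSubmodule k := ⟨_, hr f.2⟩
  let h : dominatedSubmodule k := ⟨_, hr (evolve (adjCoeff A) (star B) (-t) (-s) f').2⟩
  have key : star (forwardOp A B s t) (toFock k f) = toFock k h := by
    refine ext_inner_right ℂ fun g => ?_
    refine denseRange_toFock.induction_on g (isClosed_eq (by fun_prop) (by fun_prop)) fun g => ?_
    rw [ContinuousLinearMap.star_eq_adjoint, ContinuousLinearMap.adjoint_inner_left,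
      forwardOp_toFock hI hst, inner_toFock, inner_toFock]
    obtain ⟨D, q, R₁, hs, ht, hg⟩ := exists_dominated g.2 s t
    obtain ⟨D', q', R₂, hf⟩ := f.2
    exact integral_inner_kernelOp A B ((neg_le_neg (le_max_left R₁ R₂)).trans hs)
      (ht.trans (le_max_left R₁ R₂)) (hf.mono le_rfl le_rfl (le_max_right R₁ R₂))
      (hg.mono le_rfl le_rfl (le_max_left R₁ R₂))
  rw [key, norm_toFock_eq_iff]
  have h1 : ∫ ω, ‖h.1 ω‖ ^ 2 ∂lam = _ :=
    integral_reflect fun ω => ‖(evolve (adjCoeff A) (star B) (-t) (-s) f').1 ω‖ ^ 2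
  have h2 : ∫ ω, ‖f'.1 ω‖ ^ 2 ∂lam = _ := integral_reflect fun ω => ‖f.1 ω‖ ^ 2
  rw [h1, ← h2, ← norm_toFock_eq_iff]
  exact norm_toFock_evolve hI' hst' f'

theorem forwardOp_mem_unitary (hI : IsometryConditions A B Y) {Y' : k →L[ℂ] k}
    (hI' : IsometryConditions (adjCoeff A) (star B) Y') {s t : ℝ} (hst : s < t) :
    forwardOp A B s t ∈ unitary (Fock k →L[ℂ] Fock k) := by
  rw [Unitary.mem_iff]
  refine ⟨(ContinuousLinearMap.norm_map_iff_adjoint_comp_self _).1 (norm_forwardOp hI hst), ?_⟩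
  have := (ContinuousLinearMap.norm_map_iff_adjoint_comp_self _).1 (norm_star_forwardOp hI hI' hst)
  rw [← ContinuousLinearMap.star_eq_adjoint, star_star] at this
  exact this

end WhiteNoise

namespace WhiteNoise

/-! ### Isometry conditions for both evolutions; the composition law for all time orders -/

section Conditions

variable {k : Type*} [NormedAddCommGroup k] [InnerProductSpace ℂ k] [CompleteSpace k]
  {A : SignType → (k →L[ℂ] k)} {B : k →L[ℂ] k}

theorem UnitarityConditions.isometryConditions (h : UnitarityConditions A B) :
    ∃ Y, IsometryConditions A B Y := by
  obtain ⟨Y, hY, h0, h1, h2, h3⟩ := h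
  exact ⟨Y, (Unitary.mem_iff.1 hY).1, h0, h1, h2⟩

/-- Υ⁺ is the isometry here, which needs ΥΥ⁺ = 1. Cancelling Υ⁺Υ = 1 in A₁ = -ΥA₋₁⁺ gives the
relation for A₋₁⁺, and B + B⁺ = -A₋₁A₋₁⁺ becomes the dissipation condition. -/
theorem UnitarityConditions.isometryConditions_adj (h : UnitarityConditions A B) :
    ∃ Y, IsometryConditions (adjCoeff A) (star B) Y := by
  obtain ⟨Y, hY, h0, h1, h2, h3⟩ := h
  refine ⟨star Y, ?_, ?_, ?_, ?_⟩
  · rw [star_star]; exact (Unitary.mem_iff.1 hY).2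
  · rw [adjCoeff, show -(0 : SignType) = 0 from rfl, h0, star_sub, star_one]
  · rw [adjCoeff, adjCoeff, neg_neg, h1, star_star, mul_neg, ← mul_assoc, (Unitary.mem_iff.1 hY).1,
      one_mul, neg_neg]
  · rw [adjCoeff, star_star, star_star, add_comm, h3]

end Conditions

section Cocycle

variable {M : Type*} [Monoid M] [StarMul M]

/-- Adjoints give the law for decreasing times. In each mixed order the longest step splits at the
intermediate time and one factor cancels against its inverse. -/
theorem cocycle_of_unitary {U : ℝ → ℝ → M} (hU : ∀ s t, U t s ∈ unitary M) (h1 : ∀ s, U s s = 1)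
    (hstar : ∀ s t, U t s = star (U s t)) (h : ∀ s r t, s < r → r < t → U t r * U r s = U t s)
    (r s t : ℝ) : U t r * U r s = U t s := by
  have hinv : ∀ s t, U s t * U t s = 1 := fun s t => by
    rw [hstar t s]; exact (Unitary.mem_iff.1 (hU s t)).1
  have h' : ∀ s r t, t < r → r < s → U t r * U r s = U t s := fun s r t htr hrs => by
    rw [hstar, hstar s r, ← star_mul, h t r s htr hrs, ← hstar]
  rcases lt_trichotomy s r with hsr | rfl | hrs
  · rcases lt_trichotomy r t with hrt | rfl | htr
    · exact h s r t hsr hrt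
    · rw [h1, one_mul]
    · rcases lt_trichotomy s t with hst | rfl | hts
      · rw [← h s t r hst htr, ← mul_assoc, hinv, one_mul]
      · rw [hinv, h1]
      · rw [← h' r s t hts hsr, mul_assoc, hinv, mul_one]
  · rw [h1, mul_one]
  · rcases lt_trichotomy r t with hrt | rfl | htr
    · rcases lt_trichotomy s t with hst | rfl | hts
      · rw [← h r s t hrs hst, mul_assoc, hinv, mul_one]
      · rw [hinv, h1]
      · rw [← h' s t r hrt hts, ← mul_assoc, hinv, one_mul]
    · rw [h1, one_mul]
    · exact h' s r t htr hrs

end Cocycle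

/-! ### Time shifts: covariance, unitarity and continuity -/

theorem integral_shift {E : Type*} [NormedAddCommGroup E] [NormedSpace ℝ E] (r : ℝ)
    (f : Multiset ℝ → E) : ∫ ω, f (shift r ω) ∂lam = ∫ ω, f ω ∂lam := by
  have h : ∀ r ω, shift (-r) (shift r ω) = ω := fun r ω => by simp [shift]
  let e : Multiset ℝ ≃ᵐ Multiset ℝ :=
    ⟨⟨shift r, shift (-r), h r, fun ω => by simpa using h (-r) ω⟩,
      (measurePreserving_shift r).measurable, (measurePreserving_shift (-r)).measurable⟩
  exact (measurePreserving_shift r).integral_comp e.measurableEmbedding f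

theorem shift_add (a b : ℝ) (ω : Multiset ℝ) : shift (a + b) ω = shift b (shift a ω) := by
  simp [shift, add_assoc]

theorem shift_zero (ω : Multiset ℝ) : shift 0 ω = ω := by simp [shift]

/-- Shifting the integrated points as well leaves the integral unchanged and moves the shift into
the times of the kernel. -/
theorem kernelOp_shift {k : Type*} [NormedAddCommGroup k] [InnerProductSpace ℂ k]
    (A : SignType → (k →L[ℂ] k)) (B : k →L[ℂ] k) (r s t : ℝ) (g : Multiset ℝ → k) (ω : Multiset ℝ) :
    kernelOp (kernel A B t s) (fun ω => g (shift (-r) ω)) (shift r ω) =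
      kernelOp (kernel A B (t - r) (s - r)) g ω := by
  rw [kernelOp_eq, kernelOp_eq, shift, asum_map]
  refine asum_congr fun α ρ _ => ?_
  rw [asum_map]
  refine asum_congr fun β _ _ => ?_
  rw [← integral_shift r]
  refine integral_congr_ae (Eventually.of_forall fun υ => ?_)
  have h : ∀ ω, (shift r ω) = Multiset.map (· + r) ω := fun ω => rfl
  simp only [← h, kernel_shift]
  congr 2
  rw [shift, Multiset.map_add, ← shift, ← shift, ← shift_add, ← shift_add, add_neg_cancel, shift_zero,
    shift_zero]

variable {k : Type*} [NormedAddCommGroup k] [InnerProductSpace ℂ k]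

theorem norm_Theta (r : ℝ) (f : Fock k) : ‖Theta r f‖ = ‖f‖ :=
  (Lp.compMeasurePreservingₗᵢ ℂ (shift r) (measurePreserving_shift r)).norm_map f

theorem Theta_zero : Theta (k := k) 0 = 1 := by
  ext1 f
  refine Lp.ext ?_
  refine (Lp.coeFn_compMeasurePreserving f (measurePreserving_shift 0)).trans ?_
  exact Eventually.of_forall fun ω => congrArg f (shift_zero ω)

theorem Theta_add (a b : ℝ) : Theta (k := k) (a + b) = Theta a * Theta b := by
  ext1 f
  refine Lp.ext ?_
  refine (Lp.coeFn_compMeasurePreserving f (measurePreserving_shift (a + b))).trans ?_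
  refine EventuallyEq.trans ?_ (Lp.coeFn_compMeasurePreserving (Theta b f)
    (measurePreserving_shift a)).symm
  have h := (measurePreserving_shift a).quasiMeasurePreserving.ae_eq_comp
    (Lp.coeFn_compMeasurePreserving f (measurePreserving_shift b))
  refine EventuallyEq.trans (Eventually.of_forall fun ω => ?_) h.symm
  exact congrArg f (shift_add a b ω)

variable [CompleteSpace k]

theorem Theta_mem_unitary (r : ℝ) : Theta r ∈ unitary (Fock k →L[ℂ] Fock k) := by
  have h1 : star (Theta (k := k) r) * Theta r = 1 :=
    (ContinuousLinearMap.norm_map_iff_adjoint_comp_self _).1 (norm_Theta r)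
  have h2 : Theta (k := k) r * Theta (-r) = 1 := by rw [← Theta_add, add_neg_cancel, Theta_zero]
  exact Unitary.mem_iff.2 ⟨h1, by rw [left_inv_eq_right_inv h1 h2, h2]⟩

theorem star_Theta (r : ℝ) : star (Theta (k := k) r) = Theta (-r) :=
  left_inv_eq_right_inv (Unitary.mem_iff.1 (Theta_mem_unitary r)).1
    (by rw [← Theta_add, add_neg_cancel, Theta_zero])

variable [MeasurableSpace k] [BorelSpace k] [SecondCountableTopology k]

omit [CompleteSpace k] in
theorem Theta_toFock (r : ℝ) {g : Multiset ℝ → k} (hg : g ∈ dominatedSubmodule k) :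
    ∃ hg' : (fun ω => g (shift r ω)) ∈ dominatedSubmodule k,
      Theta r (toFock k ⟨g, hg⟩) = toFock k ⟨_, hg'⟩ := by
  have hg' : (fun ω => g (shift r ω)) ∈ dominatedSubmodule k := by
    obtain ⟨D, q, R, h⟩ := hg
    exact ⟨_, _, _, h.shift r⟩
  refine ⟨hg', Lp.ext ?_⟩
  refine (Lp.coeFn_compMeasurePreserving _ (measurePreserving_shift r)).trans ?_
  refine ((measurePreserving_shift r).quasiMeasurePreserving.ae_eq_comp
    (coeFn_toFock ⟨g, hg⟩)).trans ?_
  exact (coeFn_toFock ⟨_, hg'⟩).symm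

variable {A : SignType → (k →L[ℂ] k)} {B Y : k →L[ℂ] k}

theorem Theta_mul_forwardOp_mul (hI : IsometryConditions A B Y) (r : ℝ) {s t : ℝ} (hst : s < t) :
    Theta r * forwardOp A B s t * Theta (-r) = forwardOp A B (s - r) (t - r) := by
  refine clm_ext_toFock fun g => ?_
  rw [mul_apply_eq_comp, mul_apply_eq_comp]
  obtain ⟨h1, h1'⟩ := Theta_toFock (-r) g.2
  obtain ⟨h2, h2'⟩ := Theta_toFock r (evolve A B s t ⟨_, h1⟩).2
  rw [h1', forwardOp_toFock hI hst, h2', forwardOp_toFock hI (sub_lt_sub_right hst r)]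
  congr 1
  exact Subtype.ext (funext fun ω => kernelOp_shift A B r s t g.1 ω)

omit [CompleteSpace k] in
/-- The shift is continuous on test functions. -/
theorem tendsto_norm_Theta_sub {g : Multiset ℝ → k} (hg : IsTest g) :
    Tendsto (fun h => ‖Theta h (hg.memLp.toLp g) - hg.memLp.toLp g‖) (𝓝 0) (𝓝 0) := by
  obtain ⟨D, R, hD⟩ := hg.dominated
  have hR := hD R le_rfl
  set g' : dominatedSubmodule k := ⟨g, hg.mem_dominatedSubmodule⟩ with hg'
  have hsq : ∀ h, ‖Theta h (toFock k g') - toFock k g'‖ ^ 2 =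
      ∫ ω, ‖g (shift h ω) - g ω‖ ^ 2 ∂lam := fun h => by
    obtain ⟨h1, h1'⟩ := Theta_toFock h g'.2
    have : (⟨_, g'.2⟩ : dominatedSubmodule k) = g' := rfl
    rw [← this, h1', ← map_sub, norm_sq_toFock]
    rfl
  have hlim : Tendsto (fun h => ∫ ω, ‖g (shift h ω) - g ω‖ ^ 2 ∂lam) (𝓝 0)
      (𝓝 (∫ _, (0 : ℝ) ∂lam)) := by
    have hm : ∀ h, Measurable fun ω => g (shift h ω) := fun h =>
      hR.measurable.comp (measurePreserving_shift h).measurable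
    refine tendsto_integral_filter_of_dominated_convergence
      (fun ω => ((D + D) * (D + D)) * wt (1 * 1) (R + 1) ω) ?_ ?_
      ((integrable_wt (by norm_num) _).const_mul _) ?_
    · exact Eventually.of_forall fun h =>
        (((hm h).sub hR.measurable).norm.pow_const 2).aestronglyMeasurable
    · filter_upwards [Metric.ball_mem_nhds (0 : ℝ) one_pos] with h hh
      have hh' : |h| ≤ 1 := by
        rw [Metric.mem_ball, Real.dist_0_eq_abs] at hh
        exact hh.le
      refine Eventually.of_forall fun ω => ?_
      rw [Real.norm_of_nonneg (by positivity), ← wt_mul, sq, mul_mul_mul_comm]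
      refine mul_self_le_mul_self (norm_nonneg _) ((norm_sub_le _ _).trans ?_)
      rw [add_mul]
      exact add_le_add (((hR.shift h).mono le_rfl le_rfl (add_le_add le_rfl hh')).bound ω)
        ((hD (R + 1) (by linarith)).bound ω)
    · refine Eventually.of_forall fun ω => ?_
      obtain ⟨w, rfl⟩ := exists_points_eq ω
      have hc : Continuous fun h : ℝ => g (shift h (points w)) := by
        have : ∀ h, shift h (points w) = points (word w.1 fun i => w.2 i + h) := fun h => by
          simp only [shift, points, word, Multiset.map_map, Function.comp_def]
          rfl
        simp only [this]
        exact hg.continuous.comp ((continuous_word w.1).comp (by fun_prop))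
      have h1 := (((hc.tendsto 0).sub_const (g (points w))).norm).pow 2
      simpa [shift_zero] using h1
  have := hlim.sqrt
  rw [integral_zero, Real.sqrt_zero] at this
  refine this.congr fun h => ?_
  rw [← hsq, Real.sqrt_sq (norm_nonneg _)]
  rfl

/-- The choice R with s + 1 ≤ R leaves room to the right of s for the pointwise limit and its
uniform dominating function. -/
theorem tendsto_norm_forwardOp_sub (hI : IsometryConditions A B Y) (s : ℝ)
    (g : dominatedSubmodule k) :
    Tendsto (fun t => ‖forwardOp A B s t (toFock k g) - toFock k g‖) (𝓝[>] s) (𝓝 0) := by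
  obtain ⟨D, q, R, hs, ht, hg⟩ := exists_dominated g.2 s (s + 1)
  have := (tendsto_integral_norm_sq_kernelOp (A := A) (B := B) hs (by linarith) hg).sqrt
  rw [Real.sqrt_zero] at this
  refine this.congr' ?_
  filter_upwards [self_mem_nhdsWithin] with t ht
  rw [forwardOp_toFock hI ht, ← map_sub]
  refine (congrArg Real.sqrt (norm_sq_toFock (evolve A B s t g - g)).symm).trans ?_
  exact Real.sqrt_sq (norm_nonneg _)

end WhiteNoise

namespace WhiteNoise

/-! ### Strong continuity of unitary groups -/

section Continuity

variable {H : Type*} [NormedAddCommGroup H] [InnerProductSpace ℂ H] [CompleteSpace H]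

theorem norm_map_of_mem_unitary {V : H →L[ℂ] H} (hV : V ∈ unitary (H →L[ℂ] H)) (f : H) : ‖V f‖ = ‖f‖ :=
  (ContinuousLinearMap.norm_map_iff_adjoint_comp_self V).2 (Unitary.mem_iff.1 hV).1 f

/-- A one-parameter unitary group is strongly continuous if it is right continuous at `0` on a
dense set. -/
theorem continuous_of_unitary_group {W : ℝ → (H →L[ℂ] H)} (hW : ∀ t, W t ∈ unitary (H →L[ℂ] H))
    (h0 : W 0 = 1) (hadd : ∀ s t, W (s + t) = W s * W t) {S : Set H} (hS : Dense S)
    (h : ∀ f ∈ S, Tendsto (fun t => W t f) (𝓝[>] 0) (𝓝 f)) (f : H) :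
    Continuous fun t => W t f := by
  have hnorm := fun t => norm_map_of_mem_unitary (hW t)
  -- Applying the isometry W(-t) exchanges t and -t in the increment, so continuity from the right
  -- controls both sides.
  have habs : ∀ t f, ‖W t f - f‖ = ‖W |t| f - f‖ := by
    intro t f
    rcases abs_choice t with ht | ht
    · rw [ht]
    · rw [ht, ← hnorm (-t), map_sub, ← mul_apply_eq_comp, ← hadd, neg_add_cancel, h0,
        one_apply_eq_self, norm_sub_rev]
  have hzero : Tendsto (fun t => ‖W t f - f‖) (𝓝 0) (𝓝 0) := by
    rw [Metric.tendsto_nhds]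
    intro ε hε
    obtain ⟨g, hgS, hg⟩ := Metric.dense_iff.1 hS f (ε / 3) (by positivity)
    have hfg : ‖f - g‖ < ε / 3 := by rwa [← dist_eq_norm, dist_comm]
    have h1 := Metric.tendsto_nhds.1 (h g hg) (ε / 3) (by positivity)
    rw [eventually_nhdsWithin_iff, Metric.eventually_nhds_iff] at h1
    obtain ⟨δ, hδ, h1⟩ := h1
    rw [Metric.eventually_nhds_iff]
    refine ⟨δ, hδ, fun t ht => ?_⟩
    rw [Real.dist_0_eq_abs] at ht ⊢
    rw [abs_norm, habs]
    have hgt : ‖W |t| g - g‖ < ε / 3 := by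
      rcases (abs_nonneg t).eq_or_lt with h' | h'
      · rw [← h', h0, one_apply_eq_self, sub_self, norm_zero]
        positivity
      · have := h1 (y := |t|) (by rwa [Real.dist_0_eq_abs, abs_abs]) h'
        rwa [dist_eq_norm] at this
    -- Three terms, each below ε/3: two by closeness of f and g, since W is isometric, and one by
    -- continuity at g.
    have hsplit : W |t| f - f = W |t| (f - g) + (W |t| g - g) - (f - g) := by
      rw [map_sub]; abel
    rw [hsplit]
    refine (norm_sub_le _ _).trans_lt ?_
    have := norm_add_le (W |t| (f - g)) (W |t| g - g)
    rw [hnorm] at this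
    linarith
  refine continuous_iff_continuousAt.2 fun t => ?_
  rw [ContinuousAt, tendsto_iff_norm_sub_tendsto_zero]
  have hsub : Tendsto (fun x => x - t) (𝓝 t) (𝓝 0) := by
    simpa using (tendsto_id (x := 𝓝 t)).sub_const t
  refine (hzero.comp hsub).congr fun x => ?_
  rw [Function.comp_apply, ← hnorm t, map_sub, ← mul_apply_eq_comp, ← hadd, add_sub_cancel]

end Continuity

variable {k : Type*} [NormedAddCommGroup k] [InnerProductSpace ℂ k] [CompleteSpace k]

/-! ### The evolution for all times and the group W -/

section Evolution

variable (A : SignType → (k →L[ℂ] k)) (B : k →L[ℂ] k) [MeasurableSpace k] [BorelSpace k]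
  [SecondCountableTopology k]

/-- The operators `U^t_s` for all `s` and `t`. -/
noncomputable def evolutionOp (t s : ℝ) : Fock k →L[ℂ] Fock k :=
  if s < t then forwardOp A B s t else if t < s then star (forwardOp A B t s) else 1

variable {A B}

theorem evolutionOp_of_lt {s t : ℝ} (h : s < t) : evolutionOp A B t s = forwardOp A B s t := if_pos h

theorem evolutionOp_of_gt {s t : ℝ} (h : t < s) :
    evolutionOp A B t s = star (forwardOp A B t s) := by
  rw [evolutionOp, if_neg h.not_gt, if_pos h]

theorem evolutionOp_self (s : ℝ) : evolutionOp A B s s = 1 := by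
  rw [evolutionOp, if_neg (lt_irrefl s), if_neg (lt_irrefl s)]

theorem evolutionOp_eq_star (s t : ℝ) : evolutionOp A B t s = star (evolutionOp A B s t) := by
  rcases lt_trichotomy s t with h | rfl | h
  · rw [evolutionOp_of_lt h, evolutionOp_of_gt h, star_star]
  · rw [evolutionOp_self, star_one]
  · rw [evolutionOp_of_gt h, evolutionOp_of_lt h]

theorem groupW_evolutionOp_zero : groupW (evolutionOp A B) 0 = 1 := by
  rw [groupW, evolutionOp_self, Theta_zero, mul_one]

theorem isEvolution_evolutionOp (h : UnitarityConditions A B) : IsEvolution A B (evolutionOp A B) := by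
  obtain ⟨Y, hI⟩ := h.isometryConditions
  refine ⟨fun s t hst g hg => ?_, evolutionOp_self, fun s t _ => evolutionOp_eq_star s t⟩
  rw [evolutionOp_of_lt hst]
  change (forwardOp A B s t (toFock k ⟨g, hg.mem_dominatedSubmodule⟩) : Multiset ℝ → k) =ᵐ[lam] _
  rw [forwardOp_toFock hI hst]
  exact coeFn_toFock _

theorem evolutionOp_mem_unitary (h : UnitarityConditions A B) (s t : ℝ) :
    evolutionOp A B t s ∈ unitary (Fock k →L[ℂ] Fock k) := by
  obtain ⟨Y, hI⟩ := h.isometryConditions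
  obtain ⟨Y', hI'⟩ := h.isometryConditions_adj
  rcases lt_trichotomy s t with h | rfl | h
  · rw [evolutionOp_of_lt h]; exact forwardOp_mem_unitary hI hI' h
  · rw [evolutionOp_self]; exact one_mem _
  · rw [evolutionOp_of_gt h]; exact Unitary.star_mem (forwardOp_mem_unitary hI hI' h)

theorem evolutionOp_mul (h : UnitarityConditions A B) (r s t : ℝ) :
    evolutionOp A B t r * evolutionOp A B r s = evolutionOp A B t s := by
  obtain ⟨Y, hI⟩ := h.isometryConditions
  refine cocycle_of_unitary (evolutionOp_mem_unitary h) evolutionOp_self evolutionOp_eq_star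
    (fun s r t hsr hrt => ?_) r s t
  rw [evolutionOp_of_lt hsr, evolutionOp_of_lt hrt, evolutionOp_of_lt (hsr.trans hrt),
    forwardOp_mul hI hsr hrt]

theorem Theta_mul_evolutionOp_mul (h : UnitarityConditions A B) (r s t : ℝ) :
    Theta r * evolutionOp A B t s * Theta (-r) = evolutionOp A B (t - r) (s - r) := by
  obtain ⟨Y, hI⟩ := h.isometryConditions
  have key : ∀ {s t : ℝ}, s < t → Theta r * evolutionOp A B t s * Theta (-r) =
      evolutionOp A B (t - r) (s - r) := fun {s t} hst => by
    rw [evolutionOp_of_lt hst, evolutionOp_of_lt (sub_lt_sub_right hst r),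
      Theta_mul_forwardOp_mul hI r hst]
  rcases lt_trichotomy s t with hst | rfl | hst
  · exact key hst
  · rw [evolutionOp_self, evolutionOp_self, mul_one, ← Theta_add, add_neg_cancel, Theta_zero]
  · rw [evolutionOp_eq_star, evolutionOp_eq_star (s - r), ← key hst, star_mul, star_mul, star_Theta,
      star_Theta, neg_neg, mul_assoc]

theorem groupW_evolutionOp_mem_unitary (h : UnitarityConditions A B) (t : ℝ) :
    groupW (evolutionOp A B) t ∈ unitary (Fock k →L[ℂ] Fock k) :=
  mul_mem (Theta_mem_unitary t) (evolutionOp_mem_unitary h 0 t)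

/-- U^{s+t}_0 factors as U^{s+t}_t U^t_0, and covariance gives U^{s+t}_t = Θ(-t) U^s_0 Θ(t), whose
first factor cancels Θ(t). -/
theorem groupW_evolutionOp_add (h : UnitarityConditions A B) (s t : ℝ) : groupW (evolutionOp A B) (s + t) =
    groupW (evolutionOp A B) s * groupW (evolutionOp A B) t := by
  have h1 := Theta_mul_evolutionOp_mul h (-t) 0 s
  rw [sub_neg_eq_add, zero_sub, neg_neg] at h1
  rw [groupW, groupW, groupW, ← evolutionOp_mul h t 0 (s + t), ← h1, Theta_add]
  have h2 : Theta (k := k) t * Theta (-t) = 1 := by rw [← Theta_add, add_neg_cancel, Theta_zero]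
  simp only [mul_assoc]
  rw [← mul_assoc (Theta t) (Theta (-t)), h2, one_mul]

theorem groupW_evolutionOp_neg (h : UnitarityConditions A B) (t : ℝ) :
    groupW (evolutionOp A B) (-t) = star (groupW (evolutionOp A B) t) := by
  refine left_inv_eq_right_inv (a := groupW (evolutionOp A B) t) ?_
    (Unitary.mem_iff.1 (groupW_evolutionOp_mem_unitary h t)).2
  rw [← groupW_evolutionOp_add h, neg_add_cancel, groupW_evolutionOp_zero]

/-- For a test function g, ‖Θ(t)U^t_0 g - g‖ ≤ ‖U^t_0 g - g‖ + ‖Θ(t)g - g‖, as Θ(t) is isometric.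
The vectors with right continuity at 0 form a subspace, which is therefore dense. -/
theorem continuous_groupW_evolutionOp (h : UnitarityConditions A B) (f : Fock k) :
    Continuous fun t => groupW (evolutionOp A B) t f := by
  obtain ⟨Y, hI⟩ := h.isometryConditions
  let S : Submodule ℂ (Fock k) :=
    { carrier := {f | Tendsto (fun t => groupW (evolutionOp A B) t f) (𝓝[>] 0) (𝓝 f)}
      zero_mem' := by simp
      add_mem' := fun {f g} hf hg => (hf.add hg).congr fun t => (map_add _ f g).symm
      smul_mem' := fun c f hf => (hf.const_smul c).congr fun t => (map_smul _ c f).symm }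
  have hS : Dense (S : Set (Fock k)) := by
    rw [Submodule.dense_iff_topologicalClosure_eq_top]
    refine eq_top_of_isTest_mem (Submodule.isClosed_topologicalClosure _) fun g hg =>
      Submodule.le_topologicalClosure _ ?_
    change Tendsto (fun t => groupW (evolutionOp A B) t (hg.memLp.toLp g)) (𝓝[>] 0) (𝓝 _)
    rw [tendsto_iff_norm_sub_tendsto_zero]
    have h1 := (tendsto_norm_Theta_sub hg).mono_left (nhdsWithin_le_nhds (s := Ioi 0))
    have h2 := tendsto_norm_forwardOp_sub hI 0 ⟨g, hg.mem_dominatedSubmodule⟩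
    have h3 := h2.add h1
    rw [add_zero] at h3
    refine squeeze_zero' (Eventually.of_forall fun t => norm_nonneg _) ?_ h3
    filter_upwards [self_mem_nhdsWithin] with t ht
    rw [groupW, mul_apply_eq_comp, evolutionOp_of_lt ht]
    refine (norm_sub_le_norm_sub_add_norm_sub _ (Theta t (hg.memLp.toLp g)) _).trans
      (add_le_add_left (le_of_eq ?_) _)
    rw [← map_sub, norm_Theta]
    rfl
  exact continuous_of_unitary_group (groupW_evolutionOp_mem_unitary h) groupW_evolutionOp_zero
    (groupW_evolutionOp_add h) hS (fun f hf => hf) f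

end Evolution

/-- There is at most one evolution attached to `A` and `B`. -/
theorem IsEvolution.eq [TopologicalSpace.SeparableSpace k] {A : SignType → (k →L[ℂ] k)} {B : k →L[ℂ] k}
    {U V : ℝ → ℝ → (Fock k →L[ℂ] Fock k)} (hU : IsEvolution A B U) (hV : IsEvolution A B V) :
    V = U := by
  have key : ∀ {s t : ℝ}, s < t → V t s = U t s := fun {s t} hst =>
    continuousLinearMap_ext_isTest fun g hg => Lp.ext <|
      (hV.extends_kernelOp s t hst g hg).trans (hU.extends_kernelOp s t hst g hg).symm
  ext1 t
  ext1 s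
  rcases lt_trichotomy s t with hst | rfl | hst
  · exact key hst
  · rw [hU.self, hV.self]
  · rw [hU.backward s t hst, hV.backward s t hst, key hst]

end WhiteNoise

theorem proposition5p1p2 {k : Type*} [NormedAddCommGroup k] [InnerProductSpace ℂ k]
    [CompleteSpace k] [TopologicalSpace.SeparableSpace k]
    (A : SignType → (k →L[ℂ] k)) (B : k →L[ℂ] k)
    (hAB : WhiteNoise.UnitarityConditions A B) :
    ∃ U : ℝ → ℝ → (WhiteNoise.Fock k →L[ℂ] WhiteNoise.Fock k),
      -- `U` is the evolution attached to `A` and `B`, and it is the only one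
      WhiteNoise.IsEvolution A B U ∧
      (∀ V : ℝ → ℝ → (WhiteNoise.Fock k →L[ℂ] WhiteNoise.Fock k),
        WhiteNoise.IsEvolution A B V → V = U) ∧
      -- unitarity, composition law and cocycle property
      (∀ s t : ℝ, U t s ∈ unitary (WhiteNoise.Fock k →L[ℂ] WhiteNoise.Fock k)) ∧
      (∀ r s t : ℝ, U t r * U r s = U t s) ∧
      (∀ r s t : ℝ,
        WhiteNoise.Theta r * U t s * WhiteNoise.Theta (-r) = U (t - r) (s - r)) ∧
      -- `W(t) = Θ(t) U^t_0` is a strongly continuous one-parameter unitary group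
      (∀ t : ℝ, WhiteNoise.groupW U t ∈ unitary (WhiteNoise.Fock k →L[ℂ] WhiteNoise.Fock k)) ∧
      WhiteNoise.groupW U 0 = 1 ∧
      (∀ s t : ℝ, WhiteNoise.groupW U (s + t) = WhiteNoise.groupW U s * WhiteNoise.groupW U t) ∧
      (∀ t : ℝ, WhiteNoise.groupW U (-t) = star (WhiteNoise.groupW U t)) ∧
      (∀ f : WhiteNoise.Fock k, Continuous fun t : ℝ => WhiteNoise.groupW U t f) := by
  have := UniformSpace.secondCountable_of_separable k
  -- The statement puts no σ-algebra on 𝔨; the construction uses the Borel one, countably generated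
  -- by separability.
  borelize k
  exact ⟨WhiteNoise.evolutionOp A B, WhiteNoise.isEvolution_evolutionOp hAB,
    fun _ hV => (WhiteNoise.isEvolution_evolutionOp hAB).eq hV,
    WhiteNoise.evolutionOp_mem_unitary hAB, WhiteNoise.evolutionOp_mul hAB,
    WhiteNoise.Theta_mul_evolutionOp_mul hAB, WhiteNoise.groupW_evolutionOp_mem_unitary hAB,
    WhiteNoise.groupW_evolutionOp_zero, WhiteNoise.groupW_evolutionOp_add hAB,
    WhiteNoise.groupW_evolutionOp_neg hAB, WhiteNoise.continuous_groupW_evolutionOp hAB⟩
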